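/- Let $N\ge 1$, let $G\subset\mathbb R^N$ be open and let $V:G\to\mathbb R$ be real analytic with exactly one critical point $q_c\in G$. Assume that $V(q_c)=0$ and that the Hessian matrix $H=\bigl(\partial_i\partial_jV(q_c)\bigr)_{i,j}$ is non-singular, and let $k$ be the index of $q_c$, i.e. the number of negative eigenvalues of $H$ counted with multiplicity. For an open set $U\subset G$ let $$\Omega_{N,U}(v)=\int_U\delta(V(q)-Nv)\,dq=\lim_{\eta\to0^+}\frac{1}{2\eta}\,\mathrm{vol}\{q\in U:\ |V(q)-Nv|<\eta\}$$ be the density of states of $V$ on $U$, and define $$h_{N,k}(v)=\frac{(2\pi N)^{N/2}}{N\,\Gamma(N/2)}\times\begin{cases}(-1)^{\frac{N-k}{2}}\,(-v)^{\frac{N-2}{2}}\,\Theta(-v)&\text{for } N,k \text{ odd},\\ (-1)^{\frac k2}\,v^{\frac{N-2}{2}}\,\Theta(v)&\text{for } k \text{ even},\\ (-1)^{\frac{k+1}{2}}\,v^{\frac{N-2}{2}}\,\pi^{-1}\ln|v|&\text{for } N \text{ even},\ k \text{ odd},\end{cases}$$ where $\Theta$ is the Heaviside step function. Say that the expansion $(*)$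 holds on $U$ if for all sufficiently small $v\neq0$ the limit $\Omega_{N,U}(v)$ exists and is finite, and there is a polynomial $P$ of degree less than $N/2$ such that for every $\epsilon>0$ $$\Omega_{N,U}(v)=P(v)+\frac{h_{N,k}(v)}{\sqrt{|\det H|}}+O\bigl(|v|^{N/2-\epsilon}\bigr)\qquad(v\to0,\ v\ne0).\tag{$*$}$$ (1) The expansion $(*)$ holds on $G$ provided that the boundary of $G$ is regular at level zero, in the following sense: for some $\delta>0$ the set $\{q\in G:|V(q)|\le\delta\}$ is bounded, and at each boundary point $b$ of $G$ for which there are points $q_n\in G$ with $q_n\to b$ and $V(q_n)\to0$, the boundary is smooth and transverse to the level set. The last condition means that near $b$ one has $G=\{\rho<0\}$ with $\rho$ smooth, $V$ extends from $G$ to a function $W$ that is smooth near $b$, and $dW(b)$ and $d\rho(b)$ are linearly independent. (2) Without any condition on the boundary of $G$, the expansion $(*)$ holds on every sufficiently small open ball centred at $q_c$. -/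

import Mathlib

open Filter Topology MeasureTheory
open scoped NNReal ENNReal ContDiff

noncomputable section

/-- The Hessian matrix of second partial derivatives of `V` at `q`. -/
def hessian {N : ℕ} (V : EuclideanSpace ℝ (Fin N) → ℝ) (q : EuclideanSpace ℝ (Fin N)) :
    Matrix (Fin N) (Fin N) ℝ :=
  Matrix.of fun i j =>
    fderiv ℝ (fun x => fderiv ℝ V x (EuclideanSpace.single j 1)) q (EuclideanSpace.single i 1)

/-- The index: the number of negative eigenvalues of the Hessian, counted with multiplicity. -/
def morseIndex {N : ℕ} (V : EuclideanSpace ℝ (Fin N) → ℝ) (q : EuclideanSpace ℝ (Fin N)) : ℕ :=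
  ((hessian V q).charpoly.roots.filter (fun x => x < 0)).card

/-- `V` is a Morse function on `G`: it is real analytic and its Hessian is non-singular at every
critical point in `G`. Only the values of `V` on the open set `G` matter. -/
def IsMorseOn {N : ℕ} (V : EuclideanSpace ℝ (Fin N) → ℝ) (G : Set (EuclideanSpace ℝ (Fin N))) :
    Prop :=
  AnalyticOnNhd ℝ V G ∧ ∀ q ∈ G, fderiv ℝ V q = 0 → (hessian V q).det ≠ 0

/-- `d` is the value at `v` of the density of states `∫_G δ(V(q) - N v) dq`, the delta function
being the limit as `η → 0+` of the normalised indicator functions `(2η)⁻¹ 1_{(-η, η)}`.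
The volume is taken in `ℝ≥0∞`, so that an infinite volume does not count as zero. -/
def IsDensityOfStatesAt {N : ℕ} (V : EuclideanSpace ℝ (Fin N) → ℝ)
    (G : Set (EuclideanSpace ℝ (Fin N))) (v : ℝ) (d : ℝ≥0) : Prop :=
  Tendsto (fun η : ℝ => volume {q ∈ G | |V q - N * v| < η} / ENNReal.ofReal (2 * η))
    (𝓝[>] 0) (𝓝 (d : ℝ≥0∞))

/-- The Heaviside step function. -/
def heaviside (x : ℝ) : ℝ := if 0 < x then 1 else 0

/-- The universal function `h_{N,k}`. The exponent `(N - 2) / 2` is a real number. It is an integer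
when `N` is even; when `N` is odd, the base is positive wherever the step function is not zero. -/
def hUniv (N k : ℕ) (v : ℝ) : ℝ :=
  (2 * Real.pi * N) ^ ((N : ℝ) / 2) / (N * Real.Gamma ((N : ℝ) / 2)) *
    (if Even k then
      (-1) ^ (k / 2) * v ^ (((N : ℝ) - 2) / 2) * heaviside v
    else if Odd N then
      (-1) ^ ((N - k) / 2) * (-v) ^ (((N : ℝ) - 2) / 2) * heaviside (-v)
    else
      (-1) ^ ((k + 1) / 2) * v ^ (((N : ℝ) - 2) / 2) * (Real.pi⁻¹ * Real.log |v|))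

/-- Near `b` the set `G` is `{ρ < 0}` with `ρ` smooth, the function `V` extends smoothly from `G`
across `b`, and at `b` the differentials of the extension and of `ρ` are linearly independent, so
that the boundary of `G` is transverse at `b` to the level set. -/
def IsTransverseAt {N : ℕ} (V : EuclideanSpace ℝ (Fin N) → ℝ)
    (G : Set (EuclideanSpace ℝ (Fin N))) (b : EuclideanSpace ℝ (Fin N)) : Prop :=
  ∃ W ρ : EuclideanSpace ℝ (Fin N) → ℝ,
    ContDiffAt ℝ ∞ W b ∧ ContDiffAt ℝ ∞ ρ b ∧
    (∀ᶠ q in 𝓝[G] b, V q = W q) ∧ (∀ᶠ q in 𝓝 b, q ∈ G ↔ ρ q < 0) ∧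
    LinearIndependent ℝ ![fderiv ℝ W b, fderiv ℝ ρ b]

/-- The levels of `V` near zero stay in a bounded part of `G`, and they approach the boundary
of `G`, if at all, only transversally. -/
def IsRegularAtZeroLevel {N : ℕ} (V : EuclideanSpace ℝ (Fin N) → ℝ)
    (G : Set (EuclideanSpace ℝ (Fin N))) : Prop :=
  (∃ δ > 0, Bornology.IsBounded {q ∈ G | |V q| ≤ δ}) ∧
    ∀ b ∈ frontier G, MapClusterPt 0 (𝓝[G] b) V → IsTransverseAt V G b

/-- For all small `v ≠ 0` the density of states `Ω v` of `V` on `G` exists and is finite, and there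
is a polynomial `P` of degree less than `N / 2` with
`Ω v = P v + h_{N,k} v / √|det Hess V(qc)| + O(|v| ^ (N / 2 - ε))` as `v → 0`, for every `ε > 0`,
where `k` is the index of `V` at `qc`. -/
def HasCriticalExpansion {N : ℕ} (V : EuclideanSpace ℝ (Fin N) → ℝ)
    (G : Set (EuclideanSpace ℝ (Fin N))) (qc : EuclideanSpace ℝ (Fin N)) : Prop :=
  ∃ Ω : ℝ → ℝ≥0, (∀ᶠ v in 𝓝[≠] (0 : ℝ), IsDensityOfStatesAt V G v (Ω v)) ∧
    ∃ P : Polynomial ℝ, (P.natDegree : ℝ) < (N : ℝ) / 2 ∧ ∀ ε : ℝ, 0 < ε →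
      (fun v : ℝ => (Ω v : ℝ) -
          (P.eval v + hUniv N (morseIndex V qc) v / √|(hessian V qc).det|))
        =O[𝓝[≠] (0 : ℝ)] (fun v : ℝ => |v| ^ ((N : ℝ) / 2 - ε))

end

/-! Write F_ψ(t) for the integral of a weight ψ over the part of G where V < t (`sublevelIntegral`).
If χ is a cutoff equal to 1 wherever |V| is small, differences of F_χ near 0 are volumes, so the
density of states at v is F_χ'(N v) (`isDensityOfStatesAt_of_hasDerivAt`). The question is the
singularity of F_χ' at 0.

A weight vanishing at q_c can be written as dV(θ), with θ a compactly supported field tangent to the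
boundary of G. Integration by parts then gives F_ψ' = F_{div θ} (`setIntegral_deriv_comp_mul`,
`sublevelIntegral_sub_eq`). At regular points θ is a multiple of a constant vector; at boundary
points transversality supplies a tangent field along which V has derivative 1; at q_c both dV and ψ
factor through x - q_c by Hadamard's lemma, and nondegeneracy solves for θ. Finitely many such
neighbourhoods cover the compact set where levels near zero accumulate (`exists_isReducible_cover`).

So one reference weight ψ₀ with ψ₀(q_c) ≠ 0 decides everything. The weight χ - ψ₀/ψ₀(q_c) vanishes
at q_c, so its sublevel integral has derivative F_{ψ₁} for some ψ₁, and ψ₁ is again a multiple of ψ₀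
plus a weight vanishing at q_c. Integrating back gains one order per round, up to the order N/2 of
F_{ψ₀} itself; hence F_{ψ₁} is a polynomial up to O(|t|^{N/2 - ε}) (`IsReducible.polyBigO`), and the
leading singularity of F_χ' is that of F_{ψ₀}'/ψ₀(q_c).

The reference weight is free to choose. The Morse lemma turns V into a form with coefficients ±1/2,
and a weight pulled back from there takes the Jacobian √|det H| as its value at q_c; this is the
normalising factor in the expansion. For diagonal forms, weights are built whose sublevel integral
is an explicit singular function plus a smooth one (`IsModel`). In polar coordinates two further
squares of equal sign act as a half-line convolution, which is an integration up to a smooth term,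
so all signatures follow from those with at most one square of each sign (`hasModel`). The logarithm
is born in the hyperbolic form u w (`isModel_mul`).

Small balls need no hypothesis on the boundary of G, because near a nondegenerate critical point the
critical level crosses small spheres transversally (`eventually_fderiv_ne_smul_innerSL`). -/

noncomputable section

/-! ### Polynomial expansions at zero with power-type errors -/

/-- One-sided growth bound at `0` for a function whose derivative is dominated by a power. -/
theorem abs_sub_le_of_deriv_le_rpow_right {G g : ℝ → ℝ} {a C δ : ℝ} (ha : -1 < a)
    (hG : ContinuousAt G 0) (hd : ∀ v, 0 < v → v < δ → HasDerivAt G (g v) v)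
    (hg : ∀ v, 0 < v → v < δ → |g v| ≤ C * v ^ a) {v : ℝ} (hv : 0 < v) (hvδ : v < δ) :
    |G v - G 0| ≤ C / (a + 1) * v ^ (a + 1) := by
  have ha1 : 0 < a + 1 := by linarith
  have hp : ∀ x : ℝ, 0 < x → HasDerivAt (fun x : ℝ => C / (a + 1) * x ^ (a + 1)) (C * x ^ a) x := by
    intro x hx
    have := (Real.hasDerivAt_rpow_const (x := x) (p := a + 1) (Or.inl hx.ne')).const_mul
      (C / (a + 1))
    refine this.congr_deriv ?_
    rw [add_sub_cancel_right]
    field_simp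
  have hpc : Continuous (fun x : ℝ => C / (a + 1) * x ^ (a + 1)) :=
    continuous_const.mul (Real.continuous_rpow_const ha1.le)
  have hGc : ContinuousOn G (Set.Icc 0 v) := by
    intro x hx
    rcases hx.1.eq_or_lt with h | h
    · rw [← h]; exact hG.continuousWithinAt
    · exact (hd x h (hx.2.trans_lt hvδ)).continuousAt.continuousWithinAt
  -- Both signs at once: the primitive of the bound plus ±`G` has nonnegative derivative.
  have key : ∀ σ : ℝ, |σ| = 1 → 0 ≤ C / (a + 1) * v ^ (a + 1) + σ * (G v - G 0) := by
    intro σ hσ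
    have hmono : MonotoneOn (fun x : ℝ => C / (a + 1) * x ^ (a + 1) + σ * G x) (Set.Icc 0 v) := by
      apply monotoneOn_of_deriv_nonneg (convex_Icc 0 v)
      · exact hpc.continuousOn.add (continuousOn_const.mul hGc)
      · rw [interior_Icc]
        intro x hx
        exact ((hp x hx.1).add ((hd x hx.1 (hx.2.trans hvδ)).const_mul
          σ)).differentiableAt.differentiableWithinAt
      · rw [interior_Icc]
        intro x hx
        have h1 := (hp x hx.1).add ((hd x hx.1 (hx.2.trans hvδ)).const_mul σ)
        have h2 : deriv (fun x : ℝ => C / (a + 1) * x ^ (a + 1) + σ * G x) x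
            = C * x ^ a + σ * g x := h1.deriv
        rw [h2]
        have h3 := hg x hx.1 (hx.2.trans hvδ)
        have h4 : |σ * g x| = |g x| := by rw [abs_mul, hσ, one_mul]
        have := neg_abs_le (σ * g x)
        linarith
    have := hmono (Set.left_mem_Icc.2 hv.le) (Set.right_mem_Icc.2 hv.le) hv.le
    simp only [Real.zero_rpow ha1.ne', mul_zero, zero_add] at this
    linarith
  have k1 := key 1 (by simp)
  have k2 := key (-1) (by simp)
  rw [abs_le]
  constructor <;> linarith

/-- Growth bound at `0` for a function whose derivative is dominated by a power. -/
theorem abs_sub_le_of_deriv_le_rpow {G g : ℝ → ℝ} {a C δ : ℝ} (ha : -1 < a)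
    (hG : ContinuousAt G 0) (hd : ∀ v, v ≠ 0 → |v| < δ → HasDerivAt G (g v) v)
    (hg : ∀ v, v ≠ 0 → |v| < δ → |g v| ≤ C * |v| ^ a) {v : ℝ} (hv : v ≠ 0) (hvδ : |v| < δ) :
    |G v - G 0| ≤ C / (a + 1) * |v| ^ (a + 1) := by
  rcases lt_or_gt_of_ne hv with h | h
  · have hG' : ContinuousAt (fun x => G (-x)) 0 := by
      apply ContinuousAt.comp (g := G) (by simpa using hG) continuous_neg.continuousAt
    have := abs_sub_le_of_deriv_le_rpow_right (G := fun x => G (-x)) (g := fun x => -g (-x))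
      (a := a) (C := C) (δ := δ) (v := -v) ha hG' ?_ ?_ (by linarith)
      (by rwa [← abs_of_neg h])
    · simpa [abs_of_neg h] using this
    · intro x hx hxδ
      have h1 := hd (-x) (by linarith) (by rwa [abs_neg, abs_of_pos hx])
      exact (HasDerivAt.comp x h1 (hasDerivAt_neg x)).congr_deriv (by ring)
    · intro x hx hxδ
      have := hg (-x) (by linarith) (by rwa [abs_neg, abs_of_pos hx])
      rwa [abs_neg x, abs_of_pos hx, ← abs_neg (g (-x))] at this
  · rw [abs_of_pos h] at hvδ ⊢
    refine abs_sub_le_of_deriv_le_rpow_right ha hG (fun x hx hxδ => hd x hx.ne' ?_)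
      (fun x hx hxδ => ?_) h hvδ
    · rwa [abs_of_pos hx]
    · have := hg x hx.ne' (by rwa [abs_of_pos hx])
      rwa [abs_of_pos hx] at this

theorem eventually_punctured_iff {p : ℝ → Prop} :
    (∀ᶠ v in 𝓝[≠] (0 : ℝ), p v) ↔ ∃ δ > 0, ∀ v, v ≠ 0 → |v| < δ → p v := by
  rw [eventually_nhdsWithin_iff, Metric.eventually_nhds_iff]
  simp only [dist_zero_right, Real.norm_eq_abs, Set.mem_compl_iff, Set.mem_singleton_iff]
  constructor
  · rintro ⟨δ, h0, h⟩; exact ⟨δ, h0, fun v h1 h2 => h h2 h1⟩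
  · rintro ⟨δ, h0, h⟩; exact ⟨δ, h0, fun v h1 h2 => h v h2 h1⟩

/-- Two functions that are continuous at `0` and have the same derivative off `0` differ by
a constant. -/
theorem eventually_sub_eq_of_hasDerivAt {F G f : ℝ → ℝ} (hF : ContinuousAt F 0)
    (hG : ContinuousAt G 0) (hFd : ∀ᶠ v in 𝓝[≠] (0 : ℝ), HasDerivAt F (f v) v)
    (hGd : ∀ᶠ v in 𝓝[≠] (0 : ℝ), HasDerivAt G (f v) v) :
    ∀ᶠ v in 𝓝[≠] (0 : ℝ), F v = G v + (F 0 - G 0) := by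
  obtain ⟨δ, hδ, h⟩ := eventually_punctured_iff.1 (hFd.and hGd)
  refine eventually_punctured_iff.2 ⟨δ, hδ, fun v hv hvδ => ?_⟩
  have := abs_sub_le_of_deriv_le_rpow (G := fun x => F x - G x) (g := fun _ => 0) (a := 0)
    (C := 0) (δ := δ) (by norm_num) (hF.sub hG)
    (fun x hx hxδ => ((h x hx hxδ).1.sub (h x hx hxδ).2).congr_deriv (sub_self _)) (by simp) hv hvδ
  have h0 : F v - G v - (F 0 - G 0) = 0 := by
    have := abs_nonneg (F v - G v - (F 0 - G 0))
    apply abs_eq_zero.1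
    simp only [zero_div, zero_mul] at *
    linarith
  linarith

theorem isBigO_rpow_of_le {a b : ℝ} (h : b ≤ a) :
    (fun v : ℝ => |v| ^ a) =O[𝓝[≠] 0] fun v : ℝ => |v| ^ b := by
  apply Asymptotics.IsBigO.of_bound 1
  refine eventually_punctured_iff.2 ⟨1, one_pos, fun v hv hv1 => ?_⟩
  rw [Real.norm_of_nonneg (by positivity), Real.norm_of_nonneg (by positivity), one_mul]
  exact Real.rpow_le_rpow_of_exponent_ge (abs_pos.2 hv) hv1.le h

/-- `f` agrees near `0` with a polynomial up to errors of order arbitrarily close to `s`. -/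
def PolyBigO (s : ℝ) (f : ℝ → ℝ) : Prop :=
  ∃ P : Polynomial ℝ, ∀ ε : ℝ, 0 < ε →
    (fun v => f v - P.eval v) =O[𝓝[≠] (0 : ℝ)] fun v : ℝ => |v| ^ (s - ε)

namespace PolyBigO

theorem mono {s t : ℝ} {f : ℝ → ℝ} (h : PolyBigO s f) (hts : t ≤ s) : PolyBigO t f := by
  obtain ⟨P, hP⟩ := h
  exact ⟨P, fun ε hε => (hP ε hε).trans (isBigO_rpow_of_le (by linarith))⟩

theorem congr {s : ℝ} {f g : ℝ → ℝ} (h : PolyBigO s f) (hfg : ∀ᶠ v in 𝓝[≠] (0 : ℝ), f v = g v) :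
    PolyBigO s g := by
  obtain ⟨P, hP⟩ := h
  refine ⟨P, fun ε hε => (hP ε hε).congr' ?_ EventuallyEq.rfl⟩
  filter_upwards [hfg] with v hv
  rw [hv]

theorem add {s : ℝ} {f g : ℝ → ℝ} (hf : PolyBigO s f) (hg : PolyBigO s g) :
    PolyBigO s (fun v => f v + g v) := by
  obtain ⟨P, hP⟩ := hf
  obtain ⟨Q, hQ⟩ := hg
  refine ⟨P + Q, fun ε hε => ((hP ε hε).add (hQ ε hε)).congr_left fun v => ?_⟩
  simp only [Polynomial.eval_add]
  ring

theorem const_mul {s : ℝ} {f : ℝ → ℝ} (hf : PolyBigO s f) (c : ℝ) :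
    PolyBigO s (fun v => c * f v) := by
  obtain ⟨P, hP⟩ := hf
  refine ⟨Polynomial.C c * P, fun ε hε => ((hP ε hε).const_mul_left c).congr_left fun v => ?_⟩
  simp only [Polynomial.eval_mul, Polynomial.eval_C]
  ring

theorem polynomial (s : ℝ) (P : Polynomial ℝ) : PolyBigO s (fun v => P.eval v) :=
  ⟨P, fun ε _ => by simpa using Asymptotics.isBigO_zero _ _⟩

theorem of_isBigO {s : ℝ} {f : ℝ → ℝ}
    (h : ∀ ε : ℝ, 0 < ε → f =O[𝓝[≠] (0 : ℝ)] fun v : ℝ => |v| ^ (s - ε)) : PolyBigO s f :=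
  ⟨0, fun ε hε => by simpa using h ε hε⟩

theorem of_continuousAt {f : ℝ → ℝ} (h : ContinuousAt f 0) : PolyBigO 0 f := by
  apply of_isBigO
  intro ε hε
  have h1 : f =O[𝓝[≠] (0 : ℝ)] fun v : ℝ => |v| ^ (0 : ℝ) := by
    simpa using (h.tendsto.mono_left nhdsWithin_le_nhds).isBigO_one ℝ
  exact h1.trans (isBigO_rpow_of_le (by linarith))

theorem comp_mul {s : ℝ} {f : ℝ → ℝ} (hf : PolyBigO s f) {c : ℝ} (hc : c ≠ 0) :
    PolyBigO s (fun v => f (c * v)) := by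
  obtain ⟨P, hP⟩ := hf
  refine ⟨P.comp (Polynomial.C c * Polynomial.X), fun ε hε => ?_⟩
  have ht : Tendsto (fun v : ℝ => c * v) (𝓝[≠] 0) (𝓝[≠] 0) := by
    apply tendsto_nhdsWithin_of_tendsto_nhds_of_eventually_within
    · have : Tendsto (fun v : ℝ => c * v) (𝓝 0) (𝓝 (c * 0)) := (continuous_const_mul c).tendsto 0
      rw [mul_zero] at this
      exact this.mono_left nhdsWithin_le_nhds
    · filter_upwards [self_mem_nhdsWithin] with v hv
      exact mul_ne_zero hc hv
  have h1 := (hP ε hε).comp_tendsto ht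
  have h2 : ((fun v : ℝ => |v| ^ (s - ε)) ∘ fun v : ℝ => c * v)
      = fun v : ℝ => |c| ^ (s - ε) * |v| ^ (s - ε) := by
    funext v
    simp only [Function.comp, abs_mul]
    exact Real.mul_rpow (abs_nonneg _) (abs_nonneg _)
  rw [h2] at h1
  refine (h1.trans (Asymptotics.isBigO_const_mul_self _ _ _)).congr_left fun v => ?_
  simp

theorem exists_derivative_eq (P : Polynomial ℝ) : ∃ Q : Polynomial ℝ, Q.derivative = P := by
  induction P using Polynomial.induction_on' with
  | add p q hp hq =>
    obtain ⟨p', rfl⟩ := hp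
    obtain ⟨q', rfl⟩ := hq
    exact ⟨p' + q', by simp⟩
  | monomial n a =>
    refine ⟨Polynomial.monomial (n + 1) (a / (n + 1)), ?_⟩
    rw [Polynomial.derivative_monomial]
    have : (n : ℝ) + 1 ≠ 0 := by positivity
    simp [this]

/-- Integration raises the order of the error by one. -/
theorem integrate {s : ℝ} {F f : ℝ → ℝ} (hs : -1 < s) (hf : PolyBigO s f)
    (hF : ContinuousAt F 0) (hd : ∀ᶠ v in 𝓝[≠] (0 : ℝ), HasDerivAt F (f v) v) :
    PolyBigO (s + 1) F := by
  obtain ⟨P, hP⟩ := hf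
  obtain ⟨Q, rfl⟩ := exists_derivative_eq P
  refine ⟨Q + Polynomial.C (F 0 - Q.eval 0), ?_⟩
  -- The power |v|^(s - ε) must be integrable at 0. Larger ε only weaken the claim and follow from a
  -- smaller one at the end.
  have small : ∀ ε : ℝ, 0 < ε → -1 < s - ε →
      (fun v => F v - (Q + Polynomial.C (F 0 - Q.eval 0)).eval v)
        =O[𝓝[≠] (0 : ℝ)] fun v : ℝ => |v| ^ (s + 1 - ε) := by
    intro ε hε hsε
    obtain ⟨C, hC⟩ := (hP ε hε).bound
    obtain ⟨δ, hδ, h⟩ := eventually_punctured_iff.1 (hd.and hC)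
    apply Asymptotics.IsBigO.of_bound (C / (s - ε + 1))
    refine eventually_punctured_iff.2 ⟨δ, hδ, fun v hv hvδ => ?_⟩
    have := abs_sub_le_of_deriv_le_rpow (G := fun x => F x - Q.eval x)
      (g := fun x => f x - Q.derivative.eval x) (a := s - ε)
      (C := C) (δ := δ) hsε (hF.sub Q.continuous.continuousAt)
      (fun x hx hxδ => (h x hx hxδ).1.sub (Q.hasDerivAt x)) (fun x hx hxδ => ?_) hv hvδ
    · rw [Real.norm_of_nonneg (by positivity : 0 ≤ |v| ^ (s + 1 - ε)), Real.norm_eq_abs,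
        show s + 1 - ε = s - ε + 1 by ring]
      convert this using 2
      simp only [Polynomial.eval_add, Polynomial.eval_C]
      ring
    · have h2 := (h x hx hxδ).2
      rwa [Real.norm_eq_abs, Real.norm_of_nonneg (by positivity)] at h2
  intro ε hε
  have h1 : 0 < min ε ((s + 1) / 2) := lt_min hε (by linarith)
  have h2 : min ε ((s + 1) / 2) ≤ (s + 1) / 2 := min_le_right _ _
  exact (small _ h1 (by linarith)).trans
    (isBigO_rpow_of_le (by linarith [min_le_left ε ((s + 1) / 2)]))

/-- Taylor expansion by repeated integration: continuity gives order 0, and every derivative of a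
smooth function is again smooth. -/
theorem of_contDiff {S : ℝ → ℝ} (hS : ContDiff ℝ ∞ S) (s : ℝ) : PolyBigO s S := by
  have key : ∀ n : ℕ, ∀ S : ℝ → ℝ, ContDiff ℝ ∞ S → PolyBigO n S := by
    intro n
    induction n with
    | zero => exact fun S hS => by simpa using of_continuousAt hS.continuous.continuousAt
    | succ n ih =>
      intro S hS
      have h1 := contDiff_infty_iff_deriv.1 hS
      have := integrate (s := n) (by linarith [Nat.cast_nonneg (α := ℝ) n]) (ih _ h1.2)
        hS.continuous.continuousAt (Eventually.of_forall fun v => (h1.1 v).hasDerivAt)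
      exact_mod_cast this
  obtain ⟨n, hn⟩ := exists_nat_ge s
  exact (key n S hS).mono hn

/-- Terms of degree at least n ≥ s are already inside the error, so the polynomial may be reduced
modulo `X ^ n`. -/
theorem exists_natDegree_lt {n : ℕ} (hn : 0 < n) {s : ℝ} {f : ℝ → ℝ} (hs : s ≤ n)
    (h : PolyBigO s f) :
    ∃ P : Polynomial ℝ, P.natDegree < n ∧ ∀ ε : ℝ, 0 < ε →
      (fun v => f v - P.eval v) =O[𝓝[≠] (0 : ℝ)] fun v : ℝ => |v| ^ (s - ε) := by
  obtain ⟨P, hP⟩ := h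
  refine ⟨P %ₘ (Polynomial.X ^ n), ?_, fun ε hε => ?_⟩
  · have := Polynomial.natDegree_modByMonic_lt P (Polynomial.monic_X_pow (R := ℝ) n)
      (by
        intro h
        have := congrArg Polynomial.natDegree h
        simp at this
        omega)
    simpa using this
  · have h1 : (fun v : ℝ => (P /ₘ (Polynomial.X ^ n)).eval v * v ^ n)
        =O[𝓝[≠] (0 : ℝ)] fun v : ℝ => |v| ^ (s - ε) := by
      have a1 : (fun v : ℝ => (P /ₘ (Polynomial.X ^ n)).eval v)
          =O[𝓝[≠] (0 : ℝ)] fun _ : ℝ => (1 : ℝ) :=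
        (((P /ₘ (Polynomial.X ^ n)).continuous.tendsto 0).mono_left
          nhdsWithin_le_nhds).isBigO_one ℝ
      have a2 : (fun v : ℝ => v ^ n) =O[𝓝[≠] (0 : ℝ)] fun v : ℝ => |v| ^ (s - ε) := by
        refine Asymptotics.IsBigO.trans ?_ (isBigO_rpow_of_le (show s - ε ≤ (n : ℝ) by linarith))
        apply Asymptotics.IsBigO.of_bound 1
        filter_upwards with v
        rw [Real.norm_eq_abs, Real.norm_eq_abs, Real.rpow_natCast, abs_pow, abs_pow, abs_abs,
          one_mul]
      simpa using a1.mul a2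
    refine ((hP ε hε).add h1).congr_left fun v => ?_
    have := congrArg (Polynomial.eval v) (Polynomial.modByMonic_add_div P (Polynomial.X ^ n))
    simp only [Polynomial.eval_add, Polynomial.eval_mul, Polynomial.eval_pow,
      Polynomial.eval_X] at this
    rw [← this]
    ring

end PolyBigO

/-! ### Half-line convolutions and sublevel integrals -/

theorem measurable_heaviside : Measurable heaviside :=
  Measurable.ite measurableSet_Ioi measurable_const measurable_const

theorem abs_heaviside_le (x : ℝ) : |heaviside x| ≤ 1 := by
  unfold heaviside; split_ifs <;> norm_num

theorem heaviside_of_pos {x : ℝ} (h : 0 < x) : heaviside x = 1 := if_pos h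

theorem heaviside_of_nonpos {x : ℝ} (h : x ≤ 0) : heaviside x = 0 := if_neg h.not_gt

/-- Integration by parts of a test function against a bounded function on a half-line. -/
theorem integral_Ioi_mul_eq_primitive_add {η F : ℝ → ℝ} {B R : ℝ} (hη : ContDiff ℝ ∞ η)
    (hR : 0 < R) (hηR : ∀ s, R ≤ s → η s = 0) (hη0 : η 0 = 1) (hF : Measurable F)
    (hB : ∀ s, |F s| ≤ B) (v : ℝ) :
    ∫ s in Set.Ioi 0, η s * F (v - s) =
      (∫ u in (0)..v, F u) + ∫ s in Set.Ioi 0, deriv η s * (∫ u in (0)..(v - s), F u) := by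
  have hFi : ∀ a b, IntervalIntegrable F volume a b := fun a b => by
    rw [intervalIntegrable_iff]
    exact Measure.integrableOn_of_bounded (M := B) (by simp) hF.aestronglyMeasurable
      (Eventually.of_forall hB)
  have hFl : LocallyIntegrable F volume := by
    intro x
    refine ⟨Set.Icc (x - 1) (x + 1), Icc_mem_nhds (by linarith) (by linarith), ?_⟩
    exact Measure.integrableOn_of_bounded (M := B) (by simp) hF.aestronglyMeasurable
      (Eventually.of_forall hB)
  set A : ℝ → ℝ := fun x => ∫ u in (0)..x, F u with hA
  obtain ⟨K₀, hK₀⟩ : ∃ K₀ : ℝ≥0, ∀ s, |F s| ≤ K₀ :=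
    ⟨B.toNNReal, fun s => (hB s).trans (Real.le_coe_toNNReal B)⟩
  -- `F` is only bounded and measurable, so its primitive is merely Lipschitz. Integration by parts
  -- goes through absolute continuity and the derivative almost everywhere.
  have hLip : LipschitzWith K₀ A := by
    apply LipschitzWith.of_dist_le_mul
    intro x y
    simp only [hA, Real.dist_eq]
    rw [intervalIntegral.integral_interval_sub_left (hFi _ _) (hFi _ _)]
    have := intervalIntegral.norm_integral_le_of_norm_le_const (a := y) (b := x) (f := F)
      (C := K₀) (fun s _ => hK₀ s)
    exact this
  have hg : LipschitzWith K₀ (fun s => A (v - s)) := by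
    have h1 : LipschitzWith 1 (fun s : ℝ => v - s) := by
      apply LipschitzWith.of_dist_le_mul
      intro x y
      rw [NNReal.coe_one, one_mul, dist_sub_left]
    have := hLip.comp h1
    rwa [mul_one] at this
  have hac := (hg.lipschitzOnWith (s := Set.uIcc 0 R)).absolutelyContinuousOnInterval
  obtain ⟨K, hK⟩ := (hη.contDiffOn.mono (Set.subset_univ (Set.uIcc 0 R))).of_le
    (by norm_cast : (1 : WithTop ℕ∞) ≤ (∞ : ℕ∞ω)) |>.exists_lipschitzOnWith one_ne_zero
      (convex_uIcc 0 R) isCompact_uIcc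
  have hηac := hK.absolutelyContinuousOnInterval
  have ibp := hηac.integral_mul_deriv_eq_deriv_mul hac
  have hderiv : ∀ᵐ s, deriv (fun s => A (v - s)) s = - F (v - s) := by
    have h1 := (LocallyIntegrable.ae_hasDerivAt_integral hFl)
    have h2 : ∀ᵐ s : ℝ, ∀ c, HasDerivAt (fun x => ∫ t in c..x, F t) (F (v - s)) (v - s) :=
      (Measure.measurePreserving_sub_left volume v).quasiMeasurePreserving.ae h1
    filter_upwards [h2] with s hs
    have := HasDerivAt.comp s (hs 0) ((hasDerivAt_id s).const_sub v)
    exact (this.congr_deriv (by ring)).deriv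
  have e1 : ∀ f : ℝ → ℝ, (∀ s, R ≤ s → f s = 0) →
      ∫ s in Set.Ioi 0, f s = ∫ s in (0)..R, f s := by
    intro f hf
    rw [intervalIntegral.integral_of_le hR.le]
    apply setIntegral_eq_of_subset_of_forall_sdiff_eq_zero measurableSet_Ioi
    · exact fun x hx => hx.1
    · intro x hx
      apply hf
      by_contra h
      exact hx.2 ⟨hx.1, (not_le.1 h).le⟩
  have hdη : ∀ s, R ≤ s → deriv η s = 0 := by
    have h1 : ∀ s, R < s → deriv η s = 0 := by
      intro s hs
      have : η =ᶠ[𝓝 s] fun _ => 0 := by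
        filter_upwards [lt_mem_nhds hs] with t ht using hηR t ht.le
      rw [this.deriv_eq]; simp
    intro s hs
    have hc : Continuous (deriv η) := hη.continuous_deriv (by norm_cast)
    have h2 : closure (Set.Ioi R) ⊆ {s | deriv η s = 0} :=
      closure_minimal h1 (isClosed_eq hc continuous_const)
    rw [closure_Ioi] at h2
    exact h2 hs
  rw [e1 _ (fun s hs => by rw [hηR s hs, zero_mul]), e1 _ (fun s hs => by rw [hdη s hs, zero_mul])]
  have e2 : ∫ s in (0)..R, η s * deriv (fun s => A (v - s)) s
      = - ∫ s in (0)..R, η s * F (v - s) := by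
    rw [← intervalIntegral.integral_neg]
    apply intervalIntegral.integral_congr_ae
    filter_upwards [hderiv] with s hs _
    rw [hs]; ring
  rw [e2, hηR R le_rfl, hη0] at ibp
  simp only [sub_zero] at ibp
  linarith

/-- Half-line convolution with a test function that is `1` near `0` is integration up to a smooth
error. -/
theorem exists_contDiff_integral_Ioi_mul {η F : ℝ → ℝ} {B R : ℝ} (hη : ContDiff ℝ ∞ η)
    (hR : 0 < R) (hηR : ∀ s, R ≤ s → η s = 0) (hη0 : ∀ᶠ s in 𝓝 0, η s = 1) (hF : Measurable F)
    (hB : ∀ s, |F s| ≤ B) :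
    ∃ S : ℝ → ℝ, ContDiff ℝ ∞ S ∧ ∀ v,
      ∫ s in Set.Ioi 0, η s * F (v - s) = (∫ u in (0)..v, F u) + S v := by
  have hFi : ∀ a b, IntervalIntegrable F volume a b := fun a b => by
    rw [intervalIntegrable_iff]
    exact Measure.integrableOn_of_bounded (M := B) (by simp) hF.aestronglyMeasurable
      (Eventually.of_forall hB)
  have hd : ContDiff ℝ ∞ (deriv η) := (contDiff_infty_iff_deriv.1 hη).2
  -- Since η is constant near 0, cutting η' off at 0 keeps it smooth. The correction term becomes a
  -- convolution of this smooth kernel with the continuous primitive of `F`.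
  set ζ : ℝ → ℝ := (Set.Ioi 0).indicator (deriv η) with hζ
  obtain ⟨δ, hδ, hδ1⟩ := Metric.eventually_nhds_iff.1 hη0
  have hd0 : ∀ s, |s| < δ → deriv η s = 0 := by
    intro s hs
    have : η =ᶠ[𝓝 s] fun _ => 1 := by
      have : Metric.ball (0 : ℝ) δ ∈ 𝓝 s := Metric.isOpen_ball.mem_nhds (by simpa using hs)
      filter_upwards [this] with t ht using hδ1 ht
    rw [this.deriv_eq]; simp
  have hζs : ContDiff ℝ ∞ ζ := by
    rw [contDiff_iff_contDiffAt]
    intro s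
    rcases lt_or_ge 0 s with h | h
    · refine hd.contDiffAt.congr_of_eventuallyEq ?_
      filter_upwards [lt_mem_nhds h] with t ht
      exact Set.indicator_of_mem (s := Set.Ioi 0) ht _
    · refine (contDiffAt_const (c := (0 : ℝ))).congr_of_eventuallyEq ?_
      filter_upwards [gt_mem_nhds (lt_of_le_of_lt h hδ)] with t ht
      by_cases h0 : 0 < t
      · rw [hζ, Set.indicator_of_mem (s := Set.Ioi 0) h0]
        exact hd0 t (by rwa [abs_of_pos h0])
      · exact Set.indicator_of_notMem h0 _
  have hζc : HasCompactSupport ζ := by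
    apply HasCompactSupport.of_support_subset_isCompact (isCompact_Icc (a := 0) (b := R))
    intro s hs
    by_contra hcon
    apply hs
    by_cases h0 : 0 < s
    · rw [hζ, Set.indicator_of_mem (s := Set.Ioi 0) h0]
      have hRs : R < s := by
        by_contra h
        exact hcon ⟨h0.le, not_lt.1 h⟩
      have : η =ᶠ[𝓝 s] fun _ => 0 := by
        filter_upwards [lt_mem_nhds hRs] with t ht using hηR t ht.le
      rw [this.deriv_eq]; simp
    · exact Set.indicator_of_notMem h0 _
  have hAc : Continuous (fun x => ∫ u in (0)..x, F u) := intervalIntegral.continuous_primitive hFi 0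
  refine ⟨_, hζc.contDiff_convolution_left (ContinuousLinearMap.mul ℝ ℝ) (n := ⊤) (μ := volume)
    hζs hAc.locallyIntegrable, fun v => ?_⟩
  rw [integral_Ioi_mul_eq_primitive_add hη hR hηR hη0.self_of_nhds hF hB v]
  congr 1
  rw [convolution_def, ← integral_indicator measurableSet_Ioi]
  congr 1
  funext s
  by_cases h0 : 0 < s
  · simp [hζ, Set.indicator_of_mem (s := Set.Ioi (0 : ℝ)) h0]
  · simp [hζ, Set.indicator_of_notMem (s := Set.Ioi (0 : ℝ)) h0]

/-- Polar coordinates for functions of `(x² + y²) / 2`. -/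
theorem integral_half_sq_add_sq (g : ℝ → ℝ) :
    ∫ z : ℝ × ℝ, g ((z.1 ^ 2 + z.2 ^ 2) / 2) = 2 * Real.pi * ∫ s in Set.Ioi 0, g s := by
  rw [← integral_comp_polarCoord_symm, polarCoord_target]
  have h1 : ∀ p : ℝ × ℝ, p.1 • g (((polarCoord.symm p).1 ^ 2 + (polarCoord.symm p).2 ^ 2) / 2)
      = (p.1 * g (p.1 ^ 2 / 2)) * 1 := by
    intro p
    rw [polarCoord_symm_apply]
    have : (p.1 * Real.cos p.2) ^ 2 + (p.1 * Real.sin p.2) ^ 2 = p.1 ^ 2 := by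
      have := Real.sin_sq_add_cos_sq p.2
      linear_combination p.1 ^ 2 * this
    simp only [this, smul_eq_mul, mul_one]
  simp_rw [h1]
  rw [Measure.volume_eq_prod, setIntegral_prod_mul (fun r : ℝ => r * g (r ^ 2 / 2)) (fun _ => 1)]
  have h2 : ∫ r in Set.Ioi (0 : ℝ), r * g (r ^ 2 / 2) = ∫ s in Set.Ioi 0, g s := by
    have a1 := integral_comp_rpow_Ioi_of_pos (g := fun y => g (y / 2)) (p := 2) (by norm_num)
    have a2 := integral_comp_mul_left_Ioi g 0 (b := (2 : ℝ)⁻¹) (by norm_num)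
    have a3 : ∫ x in Set.Ioi (0 : ℝ), ((2 : ℝ) * x ^ ((2 : ℝ) - 1)) • g (x ^ (2 : ℝ) / 2)
        = 2 * ∫ r in Set.Ioi (0 : ℝ), r * g (r ^ 2 / 2) := by
      rw [← integral_const_mul]
      refine setIntegral_congr_fun measurableSet_Ioi fun x hx => ?_
      have e1 : x ^ ((2 : ℝ) - 1) = x := by norm_num
      have e2 : x ^ (2 : ℝ) = x ^ 2 := by norm_cast
      simp only [e1, e2, smul_eq_mul]
      ring
    rw [a3] at a1
    simp only [mul_zero, inv_inv, smul_eq_mul] at a2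
    have a4 : (fun y : ℝ => g (y / 2)) = fun y => g (2⁻¹ * y) := by
      funext y; congr 1; ring
    simp only [div_eq_inv_mul] at a1 a2 ⊢
    linarith
  rw [h2]
  have h3 : (0 : ℝ) ≤ Real.pi * 2 := by positivity
  simp
  ring_nf
  rw [max_eq_left h3]
  ring

/-- The integral of the weight `ψ` over the sublevel set `{Q < v}`. -/
def sublevelIntegral {M : Type*} [MeasurableSpace M] (μ : Measure M) (Q ψ : M → ℝ) (v : ℝ) : ℝ :=
  ∫ x, heaviside (v - Q x) * ψ x ∂μ

section Sublevel

variable {M : Type*} [MeasurableSpace M] {μ : Measure M} {Q ψ : M → ℝ}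

theorem aestronglyMeasurable_heaviside_sub (hQ : AEMeasurable Q μ) (v : ℝ) :
    AEStronglyMeasurable (fun x => heaviside (v - Q x)) μ :=
  (measurable_heaviside.comp_aemeasurable (hQ.const_sub v)).aestronglyMeasurable

theorem integrable_heaviside_mul (hQ : AEMeasurable Q μ) (hψ : Integrable ψ μ) (v : ℝ) :
    Integrable (fun x => heaviside (v - Q x) * ψ x) μ := by
  refine hψ.bdd_mul (aestronglyMeasurable_heaviside_sub hQ v) (c := 1) ?_
  exact Eventually.of_forall fun x => abs_heaviside_le _

theorem abs_sublevelIntegral_le (hψ : Integrable ψ μ) (v : ℝ) :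
    |sublevelIntegral μ Q ψ v| ≤ ∫ x, |ψ x| ∂μ := by
  rw [sublevelIntegral, ← Real.norm_eq_abs]
  refine (norm_integral_le_integral_norm _).trans ?_
  apply integral_mono_of_nonneg (Eventually.of_forall fun x => norm_nonneg _) hψ.abs
  refine Eventually.of_forall fun x => ?_
  simp only [norm_mul, Real.norm_eq_abs]
  exact mul_le_of_le_one_left (abs_nonneg _) (abs_heaviside_le _)

theorem measurable_sublevelIntegral [SFinite μ] (hQ : AEMeasurable Q μ)
    (hψ : AEStronglyMeasurable ψ μ) : Measurable (sublevelIntegral μ Q ψ) := by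
  have h1 : sublevelIntegral μ Q ψ = fun v => ∫ x, heaviside (v - hQ.mk Q x) * hψ.mk ψ x ∂μ := by
    funext v
    apply integral_congr_ae
    filter_upwards [hQ.ae_eq_mk, hψ.ae_eq_mk] with x h1 h2
    rw [h1, h2]
  rw [h1]
  refine (StronglyMeasurable.integral_prod_right (f := fun (v : ℝ) (x : M) =>
    heaviside (v - hQ.mk Q x) * hψ.mk ψ x) ?_).measurable
  apply Measurable.stronglyMeasurable
  apply Measurable.mul
  · exact measurable_heaviside.comp
      (measurable_fst.sub (hQ.measurable_mk.comp measurable_snd))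
  · exact hψ.stronglyMeasurable_mk.measurable.comp measurable_snd

/-- Where the sublevel integral is continuous, closed and open sublevel sets have equal weight. -/
theorem integral_heaviside_closed_eq (hQ : AEMeasurable Q μ) (hψ : Integrable ψ μ) {u : ℝ}
    (hc : ContinuousAt (sublevelIntegral μ Q ψ) u) :
    ∫ x, (1 - heaviside (Q x - u)) * ψ x ∂μ = sublevelIntegral μ Q ψ u := by
  have h1 : Tendsto (fun n : ℕ => sublevelIntegral μ Q ψ (u + 1 / ((n : ℝ) + 1))) atTop
      (𝓝 (sublevelIntegral μ Q ψ u)) := by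
    apply hc.tendsto.comp
    have := (tendsto_const_nhds (x := u)).add (tendsto_one_div_add_atTop_nhds_zero_nat (𝕜 := ℝ))
    rwa [add_zero] at this
  refine tendsto_nhds_unique ?_ h1
  apply tendsto_integral_of_dominated_convergence (fun x => |ψ x|)
  · exact fun n => (integrable_heaviside_mul hQ hψ _).aestronglyMeasurable
  · exact hψ.abs
  · intro n
    refine Eventually.of_forall fun x => ?_
    simp only [norm_mul, Real.norm_eq_abs]
    exact mul_le_of_le_one_left (abs_nonneg _) (abs_heaviside_le _)
  · refine Eventually.of_forall fun x => ?_
    apply Tendsto.mul_const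
    apply tendsto_const_nhds.congr'
    rcases le_or_gt (Q x) u with h | h
    · refine Eventually.of_forall fun n => ?_
      have : (0 : ℝ) < 1 / ((n : ℝ) + 1) := by positivity
      simp only
      rw [heaviside_of_nonpos (by linarith : Q x - u ≤ 0), sub_zero,
        heaviside_of_pos (by linarith)]
    · have h2 := (tendsto_one_div_add_atTop_nhds_zero_nat (𝕜 := ℝ)).eventually_lt_const
        (sub_pos.2 h)
      filter_upwards [h2] with n hn
      rw [heaviside_of_pos (by linarith : 0 < Q x - u), sub_self,
        heaviside_of_nonpos (by linarith)]

end Sublevel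

/-! ### Model weights: sign change and addition of two squares -/

/-- Weights supported near `0` can be chosen so that the sublevel integral of `Q` equals `H` near
level zero, up to a smooth function. -/
def IsModel {M : Type*} [NormedAddCommGroup M] [NormedSpace ℝ M] [MeasurableSpace M]
    (μ : Measure M) (Q : M → ℝ) (H : ℝ → ℝ) : Prop :=
  Continuous Q ∧ ∀ U ∈ 𝓝 (0 : M), ∃ ψ : M → ℝ, ContDiff ℝ ∞ ψ ∧ HasCompactSupport ψ ∧
    tsupport ψ ⊆ U ∧ ψ 0 = 1 ∧ ∃ S : ℝ → ℝ, ContDiff ℝ ∞ S ∧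
      ∀ᶠ v in 𝓝[≠] (0 : ℝ), sublevelIntegral μ Q ψ v = H v + S v

theorem exists_contDiff_primitive {f : ℝ → ℝ} (hf : ContDiff ℝ ∞ f) :
    ∃ T : ℝ → ℝ, ContDiff ℝ ∞ T ∧ ∀ v, HasDerivAt T (f v) v := by
  have hd : ∀ v, HasDerivAt (fun v => ∫ u in (0)..v, f u) (f v) v := fun v =>
    intervalIntegral.integral_hasDerivAt_right (hf.continuous.intervalIntegrable _ _)
      hf.continuous.aestronglyMeasurable.stronglyMeasurableAtFilter hf.continuous.continuousAt
  refine ⟨_, contDiff_infty_iff_deriv.2 ⟨fun v => (hd v).differentiableAt, ?_⟩, hd⟩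
  rwa [show deriv (fun v => ∫ u in (0)..v, f u) = f from funext fun v => (hd v).deriv]

/-- A smooth bump at `0` in the line: it is `1` near `0` and vanishes beyond `R`. -/
theorem exists_bump_line {R : ℝ} (hR : 0 < R) :
    ∃ η : ℝ → ℝ, ContDiff ℝ ∞ η ∧ (∀ s, |s| ≤ R / 2 → η s = 1) ∧ (∀ s, R ≤ |s| → η s = 0) ∧
      ∀ s, η (-s) = η s := by
  let f : ContDiffBump (0 : ℝ) := ⟨R / 2, R, by linarith, by linarith⟩
  refine ⟨f, f.contDiff, fun s hs => f.one_of_mem_closedBall (by simpa using hs),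
    fun s hs => f.zero_of_le_dist (by simpa using hs), fun s => f.neg s⟩

namespace IsModel

variable {M : Type*} [NormedAddCommGroup M] [NormedSpace ℝ M] [MeasurableSpace M] {μ : Measure M}
  {Q : M → ℝ} {H : ℝ → ℝ}

/-- The remainder in a model is an arbitrary smooth function, so `H` matters only modulo smooth
functions. -/
theorem congr {H' p : ℝ → ℝ} (h : IsModel μ Q H) (hp : ContDiff ℝ ∞ p)
    (hH : ∀ v, v ≠ 0 → H v = H' v + p v) : IsModel μ Q H' := by
  refine ⟨h.1, fun U hU => ?_⟩
  obtain ⟨ψ, h1, h2, h3, h4, S, hS, h5⟩ := h.2 U hU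
  refine ⟨ψ, h1, h2, h3, h4, fun v => p v + S v, hp.add hS, ?_⟩
  filter_upwards [h5, self_mem_nhdsWithin] with v hv hv0
  rw [hv, hH v hv0]
  ring

theorem map [BorelSpace M] {M' : Type*} [NormedAddCommGroup M'] [NormedSpace ℝ M']
    [MeasurableSpace M'] [BorelSpace M'] {μ' : Measure M'} {Q' : M' → ℝ} (h : IsModel μ Q H)
    (e : M ≃L[ℝ] M') (he : MeasurePreserving e μ μ') (hQ : ∀ x, Q' (e x) = Q x) :
    IsModel μ' Q' H := by
  have hQ' : Q' = Q ∘ e.symm := by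
    funext y
    rw [Function.comp, ← hQ, e.apply_symm_apply]
  refine ⟨hQ' ▸ h.1.comp e.symm.continuous, fun U hU => ?_⟩
  have hU' : e ⁻¹' U ∈ 𝓝 (0 : M) := e.continuous.continuousAt (by rwa [map_zero])
  obtain ⟨ψ, h1, h2, h3, h4, S, hS, h5⟩ := h.2 _ hU'
  refine ⟨ψ ∘ e.symm, h1.comp e.symm.contDiff, h2.comp_homeomorph e.symm.toHomeomorph, ?_,
    by simp [h4], S, hS, ?_⟩
  · intro y hy
    have := tsupport_comp_subset_preimage ψ e.symm.continuous hy
    simpa using h3 this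
  · filter_upwards [h5] with v hv
    rw [← hv, sublevelIntegral, sublevelIntegral,
      ← he.integral_comp e.toHomeomorph.measurableEmbedding]
    simp [hQ]

variable [BorelSpace M] [IsFiniteMeasureOnCompacts μ]

/-- The set {-Q < v} is the complement of {Q ≤ -v}. Continuity of `H` off 0 shows that the level {Q
= -v} carries no weight, so the new sublevel integral is the total weight minus the old one at -v.
-/
theorem neg (h : IsModel μ Q H) (hH : ∀ v, v ≠ 0 → ContinuousAt H v) :
    IsModel μ (fun x => -Q x) (fun v => -H (-v)) := by
  refine ⟨h.1.neg, fun U hU => ?_⟩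
  obtain ⟨ψ, h1, h2, h3, h4, S, hS, h5⟩ := h.2 U hU
  refine ⟨ψ, h1, h2, h3, h4, fun v => (∫ x, ψ x ∂μ) - S (-v),
    contDiff_const.sub (hS.comp contDiff_neg), ?_⟩
  obtain ⟨δ, hδ, h6⟩ := eventually_punctured_iff.1 h5
  refine eventually_punctured_iff.2 ⟨δ, hδ, fun v hv hvδ => ?_⟩
  have hψ : Integrable ψ μ := h1.continuous.integrable_of_hasCompactSupport h2
  have hc : ContinuousAt (sublevelIntegral μ Q ψ) (-v) := by
    have : (fun v => H v + S v) =ᶠ[𝓝 (-v)] sublevelIntegral μ Q ψ := by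
      have a1 : ∀ᶠ x in 𝓝 (-v), x ≠ 0 := isOpen_ne.mem_nhds (neg_ne_zero.2 hv)
      have a2 : ∀ᶠ x in 𝓝 (-v), |x| < δ :=
        (isOpen_lt continuous_abs continuous_const).mem_nhds (by simpa using hvδ)
      filter_upwards [a1, a2] with x b1 b2 using (h6 x b1 b2).symm
    exact ((hH _ (neg_ne_zero.2 hv)).add hS.continuous.continuousAt).congr this
  have e1 := integral_heaviside_closed_eq h.1.measurable.aemeasurable hψ hc
  rw [h6 (-v) (neg_ne_zero.2 hv) (by rwa [abs_neg])] at e1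
  have e2 : ∀ x, (1 - heaviside (Q x - -v)) * ψ x = ψ x - heaviside (v - -Q x) * ψ x := by
    intro x
    rw [show Q x - -v = v - -Q x by ring]
    ring
  simp_rw [e2] at e1
  have e3 := integrable_heaviside_mul (Q := fun x => -Q x) h.1.neg.measurable.aemeasurable hψ v
  rw [integral_sub hψ e3] at e1
  rw [sublevelIntegral]
  linarith

/-- Two more positive squares: the singularity is integrated once. -/
theorem add_sq [SecondCountableTopology M] [SFinite μ] (h : IsModel μ Q H) {H' p : ℝ → ℝ}
    (hH : ∀ v, v ≠ 0 → ContinuousAt H v) (hH' : ContinuousAt H' 0) (hp : ContDiff ℝ ∞ p)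
    (hd : ∀ v, v ≠ 0 → HasDerivAt H' (H v + p v) v) :
    IsModel ((volume : Measure (ℝ × ℝ)).prod μ)
      (fun z => (z.1.1 ^ 2 + z.1.2 ^ 2) / 2 + Q z.2) (fun v => 2 * Real.pi * H' v) := by
  have hQc : Continuous fun z : (ℝ × ℝ) × M => (z.1.1 ^ 2 + z.1.2 ^ 2) / 2 + Q z.2 := by
    have := h.1
    fun_prop
  refine ⟨hQc, fun U hU => ?_⟩
  rw [← Prod.mk_zero_zero, mem_nhds_prod_iff] at hU
  obtain ⟨U₁, hU₁, U₂, hU₂, hUU⟩ := hU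
  obtain ⟨ε, hε, hεU⟩ := Metric.nhds_basis_closedBall.mem_iff.1 hU₁
  obtain ⟨ψ, h1, h2, h3, h4, S, hS, h5⟩ := h.2 U₂ hU₂
  -- With this radius (x² + y²)/2 < R forces |x|, |y| ≤ ε, which keeps the support in the prescribed
  -- neighbourhood.
  set R : ℝ := ε ^ 2 / 2 with hRdef
  have hR : 0 < R := by positivity
  obtain ⟨η, hη, hη1, hη0, -⟩ := exists_bump_line hR
  have hψ : Integrable ψ μ := h1.continuous.integrable_of_hasCompactSupport h2
  have hsupp : Function.support (fun z : (ℝ × ℝ) × M => η ((z.1.1 ^ 2 + z.1.2 ^ 2) / 2) * ψ z.2) ⊆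
      Metric.closedBall 0 ε ×ˢ tsupport ψ := by
    intro z hz
    rw [Function.mem_support] at hz
    refine ⟨?_, subset_tsupport _ fun h0 => hz (by rw [h0, mul_zero])⟩
    by_contra hcon
    apply hz
    rw [hη0, zero_mul]
    rw [mem_closedBall_zero_iff, not_le, Prod.norm_def, lt_max_iff] at hcon
    rw [abs_of_nonneg (by positivity), hRdef]
    have hsq : ∀ x : ℝ, ε < ‖x‖ → ε ^ 2 ≤ x ^ 2 := fun x hx => by
      rw [← sq_abs x]
      exact pow_le_pow_left₀ hε.le hx.le 2
    rcases hcon with h | h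
    · have := hsq _ h
      nlinarith [sq_nonneg z.1.2]
    · have := hsq _ h
      nlinarith [sq_nonneg z.1.1]
  have hcpt : IsCompact (Metric.closedBall (0 : ℝ × ℝ) ε ×ˢ tsupport ψ) :=
    (isCompact_closedBall _ _).prod h2
  have hw : ContDiff ℝ ∞ (fun z : (ℝ × ℝ) × M => η ((z.1.1 ^ 2 + z.1.2 ^ 2) / 2) * ψ z.2) := by
    fun_prop
  have hwc : HasCompactSupport
      (fun z : (ℝ × ℝ) × M => η ((z.1.1 ^ 2 + z.1.2 ^ 2) / 2) * ψ z.2) :=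
    HasCompactSupport.of_support_subset_isCompact hcpt hsupp
  refine ⟨_, hw, hwc, ?_, ?_, ?_⟩
  · refine (closure_minimal hsupp hcpt.isClosed).trans (subset_trans ?_ hUU)
    exact Set.prod_mono hεU h3
  · simp [h4, hη1 0 (by simpa using (half_pos hR).le)]
  have hFm := measurable_sublevelIntegral (μ := μ) h.1.measurable.aemeasurable
    hψ.aestronglyMeasurable
  obtain ⟨S₁, hS₁, hconv⟩ := exists_contDiff_integral_Ioi_mul hη hR
    (fun s hs => hη0 s (hs.trans (le_abs_self s)))
    (by
      filter_upwards [Metric.closedBall_mem_nhds (0 : ℝ) (half_pos hR)] with s hs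
      exact hη1 s (by simpa using hs)) hFm
    (abs_sublevelIntegral_le hψ)
  set F := sublevelIntegral μ Q ψ with hFdef
  have hF : ∀ v, sublevelIntegral ((volume : Measure (ℝ × ℝ)).prod μ)
      (fun z => (z.1.1 ^ 2 + z.1.2 ^ 2) / 2 + Q z.2)
      (fun z => η ((z.1.1 ^ 2 + z.1.2 ^ 2) / 2) * ψ z.2) v =
      2 * Real.pi * ((∫ u in (0)..v, F u) + S₁ v) := by
    intro v
    rw [← hconv, ← integral_half_sq_add_sq fun s => η s * F (v - s), sublevelIntegral,
      integral_prod]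
    · congr 1
      funext z
      rw [hFdef, sublevelIntegral, ← integral_const_mul]
      congr 1
      funext x
      rw [show v - ((z.1 ^ 2 + z.2 ^ 2) / 2 + Q x) = v - (z.1 ^ 2 + z.2 ^ 2) / 2 - Q x by ring]
      ring
    · exact integrable_heaviside_mul hQc.measurable.aemeasurable
        (hw.continuous.integrable_of_hasCompactSupport hwc) v
  have hFi : ∀ a b, IntervalIntegrable F volume a b := fun a b => by
    rw [intervalIntegrable_iff]
    exact Measure.integrableOn_of_bounded (by simp) hFm.aestronglyMeasurable
      (Eventually.of_forall (abs_sublevelIntegral_le hψ))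
  -- `T` is chosen so that `H' + T` has derivative `H + S`, the sublevel integral itself; the
  -- primitive of the latter therefore differs from `H' + T` by a constant.
  obtain ⟨T, hT, hTd⟩ := exists_contDiff_primitive (hS.sub hp)
  obtain ⟨δ, hδ, h6⟩ := eventually_punctured_iff.1 h5
  have hprim : ∀ᶠ v in 𝓝[≠] (0 : ℝ),
      HasDerivAt (fun v => ∫ u in (0)..v, F u) (H v + S v) v := by
    refine eventually_punctured_iff.2 ⟨δ, hδ, fun v hv hvδ => ?_⟩
    have hev : (fun v => H v + S v) =ᶠ[𝓝 v] F := by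
      have a1 : ∀ᶠ x in 𝓝 v, x ≠ 0 := isOpen_ne.mem_nhds hv
      have a2 : ∀ᶠ x in 𝓝 v, |x| < δ :=
        (isOpen_lt continuous_abs continuous_const).mem_nhds hvδ
      filter_upwards [a1, a2] with x b1 b2 using (h6 x b1 b2).symm
    have hc : ContinuousAt F v := ((hH _ hv).add hS.continuous.continuousAt).congr hev
    rw [← h6 v hv hvδ]
    exact intervalIntegral.integral_hasDerivAt_right (hFi _ _)
      hFm.stronglyMeasurable.stronglyMeasurableAtFilter hc
  have hcmp := eventually_sub_eq_of_hasDerivAt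
    (intervalIntegral.continuous_primitive hFi 0).continuousAt
    (hH'.add hT.continuous.continuousAt) hprim
    (by
      filter_upwards [self_mem_nhdsWithin] with v hv
      exact ((hd v hv).add (hTd v)).congr_deriv (by ring))
  set c := (∫ u in (0)..0, F u) - (H' + T) 0 with hc
  refine ⟨fun v => 2 * Real.pi * (T v + c + S₁ v),
    contDiff_const.mul ((hT.add contDiff_const).add hS₁), ?_⟩
  filter_upwards [hcmp] with v hv
  rw [hF, hv]
  simp only [Pi.add_apply]
  ring

/-- Two more negative squares. -/
theorem sub_sq [SecondCountableTopology M] [SFinite μ] (h : IsModel μ Q H) {H' p : ℝ → ℝ}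
    (hH : ∀ v, v ≠ 0 → ContinuousAt H v) (hH' : ContinuousAt H' 0) (hp : ContDiff ℝ ∞ p)
    (hd : ∀ v, v ≠ 0 → HasDerivAt H' (-H v + p v) v) :
    IsModel ((volume : Measure (ℝ × ℝ)).prod μ)
      (fun z => -((z.1.1 ^ 2 + z.1.2 ^ 2) / 2) + Q z.2) (fun v => 2 * Real.pi * H' v) := by
  have hneg : ∀ v : ℝ, v ≠ 0 → -v ≠ 0 := fun v hv => neg_ne_zero.2 hv
  -- Negative squares are positive squares of -Q: negate, add, negate back.
  have h1 := (h.neg hH).add_sq (H' := fun v => -H' (-v)) (p := fun v => p (-v))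
    (fun v hv => ((hH _ (hneg v hv)).comp continuous_neg.continuousAt).neg)
    (ContinuousAt.neg (ContinuousAt.comp (g := H') (by simpa using hH')
      continuous_neg.continuousAt))
    (hp.comp contDiff_neg)
    (fun v hv => ((HasDerivAt.comp v (hd _ (hneg v hv)) (hasDerivAt_neg v)).neg).congr_deriv
      (by ring))
  have h2 := h1.neg (fun v hv => by
    have := (HasDerivAt.comp v (hd _ (hneg v hv)) (hasDerivAt_neg v)).continuousAt
    exact continuousAt_const.mul this.neg)
  simp only [neg_neg, mul_neg] at h2
  have e : (fun z : (ℝ × ℝ) × M => -((z.1.1 ^ 2 + z.1.2 ^ 2) / 2 + -Q z.2))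
      = fun z => -((z.1.1 ^ 2 + z.1.2 ^ 2) / 2) + Q z.2 := by
    funext z; ring
  rwa [e] at h2

end IsModel

/-! ### Volume-preserving splitting of two coordinates -/

/-- The continuous linear equivalence that prepends two coordinates. -/
def consTwoEquiv (n : ℕ) : ((ℝ × ℝ) × (Fin n → ℝ)) ≃L[ℝ] (Fin (n + 2) → ℝ) :=
  ((ContinuousLinearEquiv.prodAssoc ℝ ℝ ℝ (Fin n → ℝ)).trans
    ((ContinuousLinearEquiv.refl ℝ ℝ).prodCongr (Fin.consEquivL ℝ (fun _ : Fin (n + 1) => ℝ)))).trans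
      (Fin.consEquivL ℝ (fun _ : Fin (n + 2) => ℝ))

theorem consTwoEquiv_apply (n : ℕ) (z : (ℝ × ℝ) × (Fin n → ℝ)) :
    consTwoEquiv n z = Fin.cons z.1.1 (Fin.cons z.1.2 z.2 : Fin (n + 1) → ℝ) := rfl

theorem measurePreserving_consEquivL (n : ℕ) :
    MeasurePreserving (Fin.consEquivL ℝ (fun _ : Fin (n + 1) => ℝ)) volume volume := by
  have h := (volume_preserving_piFinSuccAbove (fun _ : Fin (n + 1) => ℝ) 0).symm
  have e : ⇑(MeasurableEquiv.piFinSuccAbove (fun _ : Fin (n + 1) => ℝ) 0).symm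
      = ⇑(Fin.consEquivL ℝ (fun _ : Fin (n + 1) => ℝ)) := by
    funext z
    simp [MeasurableEquiv.piFinSuccAbove]
    rfl
  rwa [e] at h

theorem measurePreserving_consTwoEquiv (n : ℕ) :
    MeasurePreserving (consTwoEquiv n) volume volume := by
  have h1 : MeasurePreserving (MeasurableEquiv.prodAssoc : (ℝ × ℝ) × (Fin n → ℝ) ≃ᵐ _)
      volume volume := measurePreserving_prodAssoc volume volume volume
  have h2 : MeasurePreserving (Prod.map id (Fin.consEquivL ℝ (fun _ : Fin (n + 1) => ℝ)))
      (volume : Measure (ℝ × (ℝ × (Fin n → ℝ)))) volume :=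
    (MeasurePreserving.id volume).prod (measurePreserving_consEquivL n)
  exact (measurePreserving_consEquivL (n + 1)).comp (h2.comp h1)

/-! ### Models with at most one square of each sign -/

/-- The primitive of an even test function on the line. -/
theorem integral_heaviside_sub_mul {η : ℝ → ℝ} (hη : Integrable η) (heven : ∀ s, η (-s) = η s)
    {u : ℝ} (hu : u ≠ 0) (v : ℝ) :
    ∫ w, heaviside (v - u * w) * η w =
      (∫ w in Set.Iic 0, η w) + ∫ w in (0)..(v / |u|), η w := by
  have pos : ∀ u : ℝ, 0 < u → ∫ w, heaviside (v - u * w) * η w =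
      (∫ w in Set.Iic 0, η w) + ∫ w in (0)..(v / u), η w := by
    intro u hu
    rw [← intervalIntegral.integral_Iic_sub_Iic hη.integrableOn hη.integrableOn,
      add_sub_cancel, integral_Iic_eq_integral_Iio, ← integral_indicator measurableSet_Iio]
    congr 1
    funext w
    by_cases h : w < v / u
    · rw [Set.indicator_of_mem (show w ∈ Set.Iio (v / u) from h), heaviside_of_pos, one_mul]
      rw [lt_div_iff₀ hu] at h
      linarith
    · rw [Set.indicator_of_notMem (show w ∉ Set.Iio (v / u) from h), heaviside_of_nonpos, zero_mul]
      rw [not_lt, div_le_iff₀ hu] at h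
      linarith
  rcases lt_or_gt_of_ne hu with h | h
  · rw [abs_of_neg h, ← pos (-u) (by linarith), ← integral_neg_eq_self]
    congr 1
    funext w
    rw [heven, mul_neg, neg_mul]
  · rw [abs_of_pos h, pos u h]

/-- The integral that carries the logarithm of the hyperbolic form `u w`. -/
theorem exists_integral_Ioi_mul_eq_log {η J : ℝ → ℝ} {R : ℝ} (hR : 0 < R) (hη : Continuous η)
    (hη1 : ∀ s, |s| ≤ R → η s = 1) (hη0 : ∀ s, 2 * R ≤ |s| → η s = 0) (hJ : Continuous J)
    (hJR : ∀ z, |z| ≤ R → J z = z) {B : ℝ} (hJB : ∀ z, |J z| ≤ B) (hodd : ∀ z, J (-z) = -J z) :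
    ∃ K : ℝ, ∀ᶠ v in 𝓝[≠] (0 : ℝ),
      ∫ u in Set.Ioi 0, η u * J (v / u) = K * v - v * Real.log |v| := by
  obtain ⟨E, hE⟩ := hη.bounded_above_of_compact_support
    (HasCompactSupport.of_support_subset_isCompact (isCompact_closedBall (0 : ℝ) (2 * R)) (by
      intro s hs
      by_contra h
      exact hs (hη0 s (by simpa using (not_le.1 fun h' => h (by simpa using h')).le))))
  have hint : ∀ v a b, IntervalIntegrable (fun u => η u * J (v / u)) volume a b := by
    intro v a b
    rw [intervalIntegrable_iff]
    refine Measure.integrableOn_of_bounded (M := E * B) (by simp) ?_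
      (Eventually.of_forall fun u => ?_)
    · exact (hη.measurable.mul
        (hJ.measurable.comp (measurable_const.div measurable_id))).aestronglyMeasurable
    · rw [norm_mul]
      exact mul_le_mul (hE u) (hJB _) (norm_nonneg _) ((norm_nonneg _).trans (hE u))
  -- The integral is split at u = v/R and u = R. On (0, v/R) the substitution u = v t gives a
  -- multiple of v; on (v/R, R) the integrand is v/u, giving v (2 log R - log v); on (R, 2R) it is
  -- η(u) v/u. `K` collects the linear terms.
  set K : ℝ := (∫ t in (0)..(1 / R), J (1 / t)) + 2 * Real.log R
    + ∫ u in (R)..(2 * R), η u * (1 / u) with hK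
  have pos : ∀ v, 0 < v → v < R ^ 2 →
      ∫ u in Set.Ioi 0, η u * J (v / u) = K * v - v * Real.log v := by
    intro v hv hvR
    have h0 : 0 < v / R := by positivity
    have h1 : v / R ≤ R := by
      rw [div_le_iff₀ hR]; nlinarith
    have a0 : ∫ u in Set.Ioi 0, η u * J (v / u) = ∫ u in (0)..(2 * R), η u * J (v / u) := by
      rw [intervalIntegral.integral_of_le (by linarith)]
      apply setIntegral_eq_of_subset_of_forall_sdiff_eq_zero measurableSet_Ioi
      · exact fun x hx => hx.1
      · intro x hx
        rw [hη0 x, zero_mul]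
        rw [abs_of_pos hx.1]
        by_contra h
        exact hx.2 ⟨hx.1, (not_le.1 h).le⟩
    have a1 : ∫ u in (0)..(v / R), η u * J (v / u) = v * ∫ t in (0)..(1 / R), J (1 / t) := by
      have e1 : ∫ u in (0)..(v / R), η u * J (v / u) = ∫ u in (0)..(v / R), J (v / u) := by
        apply intervalIntegral.integral_congr
        intro u hu
        rw [Set.uIcc_of_le h0.le] at hu
        simp only
        rw [hη1 u (by rw [abs_of_nonneg hu.1]; exact hu.2.trans h1), one_mul]
      have e2 := intervalIntegral.mul_integral_comp_mul_left (a := 0) (b := 1 / R)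
        (f := fun u => J (v / u)) (c := v)
      rw [mul_zero, show v * (1 / R) = v / R by ring] at e2
      rw [e1, ← e2]
      congr 1
      apply intervalIntegral.integral_congr
      intro t ht
      simp only
      rw [div_mul_eq_div_div, div_self hv.ne']
    have a2 : ∫ u in (v / R)..R, η u * J (v / u) = v * (2 * Real.log R - Real.log v) := by
      have e1 : ∫ u in (v / R)..R, η u * J (v / u) = ∫ u in (v / R)..R, v * u⁻¹ := by
        apply intervalIntegral.integral_congr
        intro u hu
        rw [Set.uIcc_of_le h1] at hu
        have hu0 : 0 < u := h0.trans_le hu.1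
        simp only
        rw [hη1 u (by rw [abs_of_pos hu0]; exact hu.2), one_mul, hJR, div_eq_mul_inv]
        rw [abs_of_pos (by positivity), div_le_iff₀ hu0]
        have := hu.1
        rw [div_le_iff₀ hR] at this
        linarith
      rw [e1, intervalIntegral.integral_const_mul, integral_inv_of_pos h0 hR,
        Real.log_div hR.ne' h0.ne', Real.log_div hv.ne' hR.ne']
      ring
    have a3 : ∫ u in (R)..(2 * R), η u * J (v / u) = v * ∫ u in (R)..(2 * R), η u * (1 / u) := by
      rw [← intervalIntegral.integral_const_mul]
      apply intervalIntegral.integral_congr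
      intro u hu
      rw [Set.uIcc_of_le (by linarith)] at hu
      have hu0 : 0 < u := hR.trans_le hu.1
      simp only
      rw [hJR]
      · ring
      · rw [abs_of_pos (by positivity), div_le_iff₀ hu0]
        nlinarith [hu.1]
    rw [a0, ← intervalIntegral.integral_add_adjacent_intervals (hint v 0 (v / R)) (hint v _ _),
      ← intervalIntegral.integral_add_adjacent_intervals (hint v (v / R) R) (hint v _ _),
      a1, a2, a3, hK]
    ring
  refine ⟨K, eventually_punctured_iff.2 ⟨R ^ 2, by positivity, fun v hv hvR => ?_⟩⟩
  rcases lt_or_gt_of_ne hv with h | h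
  · rw [abs_of_neg h] at hvR ⊢
    have := pos (-v) (by linarith) hvR
    have e : ∀ u, η u * J (-v / u) = -(η u * J (v / u)) := by
      intro u; rw [neg_div, hodd]; ring
    simp_rw [e, integral_neg] at this
    linarith
  · rw [abs_of_pos h] at hvR ⊢
    exact pos v h hvR

/-- The hyperbolic form in null coordinates. -/
theorem isModel_mul : IsModel (volume : Measure (ℝ × ℝ)) (fun z => z.1 * z.2)
    (fun v => -(2 * (v * Real.log |v|))) := by
  refine ⟨by fun_prop, fun U hU => ?_⟩
  obtain ⟨ε, hε, hεU⟩ := Metric.nhds_basis_closedBall.mem_iff.1 hU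
  obtain ⟨η, hη, hη1, hη0, heven⟩ := exists_bump_line hε
  have hηc : HasCompactSupport η :=
    HasCompactSupport.of_support_subset_isCompact (isCompact_closedBall (0 : ℝ) ε) (by
      intro s hs
      by_contra h
      exact hs (hη0 s (by simpa using (not_le.1 fun h' => h (by simpa using h')).le)))
  have hηi : Integrable η := hη.continuous.integrable_of_hasCompactSupport hηc
  have hw : ContDiff ℝ ∞ (fun z : ℝ × ℝ => η z.1 * η z.2) := by fun_prop
  have hsupp : Function.support (fun z : ℝ × ℝ => η z.1 * η z.2) ⊆ Metric.closedBall 0 ε := by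
    intro z hz
    rw [mem_closedBall_zero_iff, Prod.norm_def, max_le_iff]
    constructor
    · by_contra h
      exact hz (by simp only; rw [hη0 z.1 (not_le.1 h).le, zero_mul])
    · by_contra h
      exact hz (by simp only; rw [hη0 z.2 (not_le.1 h).le, mul_zero])
  have hwc : HasCompactSupport (fun z : ℝ × ℝ => η z.1 * η z.2) :=
    HasCompactSupport.of_support_subset_isCompact (isCompact_closedBall _ _) hsupp
  have h00 : η 0 = 1 := hη1 0 (by simpa using (half_pos hε).le)
  set J : ℝ → ℝ := fun z => ∫ w in (0)..z, η w with hJ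
  have hJc : Continuous J :=
    intervalIntegral.continuous_primitive (fun a b => hη.continuous.intervalIntegrable a b) 0
  obtain ⟨K, hK⟩ := exists_integral_Ioi_mul_eq_log (η := η) (J := J) (R := ε / 2)
    (B := ∫ w, ‖η w‖) (half_pos hε) hη.continuous hη1
    (by simpa [mul_div_cancel₀] using hη0) hJc (fun z hz => by
      have : J z = ∫ w in (0)..z, (1 : ℝ) := by
        apply intervalIntegral.integral_congr
        intro w hw
        simp only
        apply hη1 w
        have := Set.abs_sub_left_of_mem_uIcc hw
        simp only [sub_zero] at this
        exact this.trans hz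
      simpa using this)
    (fun z => by
      rw [← Real.norm_eq_abs]
      refine (intervalIntegral.norm_integral_le_integral_norm_uIoc).trans ?_
      exact setIntegral_le_integral hηi.norm (Eventually.of_forall fun _ => norm_nonneg _))
    (fun z => by
      have h1 := intervalIntegral.integral_comp_neg (a := 0) (b := z) η
      simp_rw [heven] at h1
      rw [neg_zero] at h1
      simp only [hJ]
      rw [h1, intervalIntegral.integral_symm])
  set c := ∫ w in Set.Iic 0, η w with hc
  refine ⟨_, hw, hwc, (closure_minimal hsupp Metric.isClosed_closedBall).trans hεU, by simp [h00],
    fun v => c * (∫ u, η u) + 2 * K * v, by fun_prop, ?_⟩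
  filter_upwards [hK] with v hv
  rw [sublevelIntegral, Measure.volume_eq_prod, integral_prod]
  -- For fixed u ≠ 0 the condition u w < v is a half-line in w, so the inner integral is half the
  -- mass of η plus its odd primitive at v/|u|. The first piece integrates to a constant, the second
  -- to twice the half-line integral with the logarithm.
  · have e1 : ∀ᵐ u : ℝ, ∫ w, heaviside (v - u * w) * (η u * η w)
        = c * η u + η |u| * J (v / |u|) := by
      have hne : ∀ᵐ u : ℝ, u ≠ 0 := by simp [ae_iff]
      filter_upwards [hne] with u hu
      have e2 : ∀ w, heaviside (v - u * w) * (η u * η w)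
          = η u * (heaviside (v - u * w) * η w) := fun w => by ring
      simp_rw [e2]
      rw [integral_const_mul, integral_heaviside_sub_mul hηi heven hu v]
      have : η |u| = η u := by
        rcases abs_choice u with h | h <;> rw [h]
        exact heven u
      rw [this, ← hc, hJ]
      ring
    rw [integral_congr_ae e1, integral_add (hηi.const_mul c), integral_const_mul,
      integral_comp_abs (f := fun u => η u * J (v / u)), hv]
    · ring
    · refine Integrable.mul_bdd (c := ∫ w, ‖η w‖) ?_ ?_ ?_
      · refine hηi.congr (Eventually.of_forall fun u => ?_)
        simp only
        rcases abs_choice u with h | h <;> rw [h]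
        exact (heven u).symm
      · exact (hJc.measurable.comp (measurable_const.div
          measurable_norm)).aestronglyMeasurable
      · refine Eventually.of_forall fun u => ?_
        refine (intervalIntegral.norm_integral_le_integral_norm_uIoc).trans ?_
        exact setIntegral_le_integral hηi.norm (Eventually.of_forall fun _ => norm_nonneg _)
  · rw [← Measure.volume_eq_prod]
    exact integrable_heaviside_mul (by fun_prop)
      (hw.continuous.integrable_of_hasCompactSupport hwc) v

/-- One positive square. -/
theorem isModel_half_sq : IsModel (volume : Measure ℝ) (fun x => x ^ 2 / 2)
    (fun v => heaviside v * (2 * √(2 * v))) := by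
  refine ⟨by fun_prop, fun U hU => ?_⟩
  obtain ⟨ε, hε, hεU⟩ := Metric.nhds_basis_closedBall.mem_iff.1 hU
  obtain ⟨η, hη, hη1, hη0, heven⟩ := exists_bump_line hε
  have hsupp : Function.support η ⊆ Metric.closedBall 0 ε := by
    intro s hs
    by_contra h
    exact hs (hη0 s (by simpa using (not_le.1 fun h' => h (by simpa using h')).le))
  refine ⟨η, hη, HasCompactSupport.of_support_subset_isCompact (isCompact_closedBall (0 : ℝ) ε)
    hsupp, (closure_minimal hsupp Metric.isClosed_closedBall).trans hεU,
    hη1 0 (by simpa using (half_pos hε).le), fun _ => 0, contDiff_const, ?_⟩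
  -- Below this level the set {x²/2 < v} lies where η = 1, and the weighted length is the true
  -- length 2√(2v).
  refine eventually_punctured_iff.2 ⟨(ε / 2) ^ 2 / 2, by positivity, fun v hv hvε => ?_⟩
  simp only [add_zero, sublevelIntegral]
  rcases lt_or_gt_of_ne hv with h | h
  · rw [heaviside_of_nonpos h.le, zero_mul]
    apply integral_eq_zero_of_ae
    refine Eventually.of_forall fun x => ?_
    simp only [Pi.zero_apply]
    rw [heaviside_of_nonpos (by nlinarith [sq_nonneg x]), zero_mul]
  · rw [heaviside_of_pos h, one_mul]
    have e : ∀ x, heaviside (v - x ^ 2 / 2) * η x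
        = (Set.Ioo (-√(2 * v)) (√(2 * v))).indicator (fun _ => (1 : ℝ)) x := by
      intro x
      have hiff : x ∈ Set.Ioo (-√(2 * v)) (√(2 * v)) ↔ x ^ 2 < 2 * v := by
        rw [Set.mem_Ioo, ← abs_lt, Real.lt_sqrt (abs_nonneg x), sq_abs]
      by_cases hx : x ∈ Set.Ioo (-√(2 * v)) (√(2 * v))
      · have hx2 := hiff.1 hx
        rw [Set.indicator_of_mem hx, heaviside_of_pos (by linarith), hη1, one_mul]
        rw [abs_of_pos h] at hvε
        apply abs_le_of_sq_le_sq _ (by positivity)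
        linarith
      · have hx2 := mt hiff.2 hx
        rw [Set.indicator_of_notMem hx, heaviside_of_nonpos (by linarith), zero_mul]
    simp_rw [e]
    rw [integral_indicator measurableSet_Ioo]
    simp
    ring_nf

theorem isModel_fin_zero : IsModel (volume : Measure (Fin 0 → ℝ)) (fun _ => 0) heaviside := by
  refine ⟨continuous_const, fun U hU => ⟨fun _ => 1, contDiff_const,
    HasCompactSupport.of_compactSpace _, fun x _ => ?_, rfl, fun _ => 0, contDiff_const, ?_⟩⟩
  · rw [Subsingleton.elim x 0]
    exact mem_of_mem_nhds hU
  · refine Eventually.of_forall fun v => ?_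
    simp [sublevelIntegral, Measure.real, volume_pi]

/-! ### Explicit singularities and the models of every signature -/

/-- The normalised one-sided power. -/
def singPow (a v : ℝ) : ℝ := heaviside v * (v ^ a / Real.Gamma (a + 1))

/-- The normalised logarithmic singularity. -/
def singLog (a v : ℝ) : ℝ := v ^ a * (Real.pi⁻¹ * Real.log |v|) / Real.Gamma (a + 1)

/-- The singularity at level zero of the sublevel volume of a quadratic form with `p` positive and
`k` negative squares. -/
def modelSing (p k : ℕ) (v : ℝ) : ℝ :=
  if Even k then (-1) ^ (k / 2) * singPow (((p : ℝ) + k) / 2) v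
  else if Even p then (-1) ^ (p / 2 + 1) * singPow (((p : ℝ) + k) / 2) (-v)
  else (-1) ^ ((k + 1) / 2) * singLog (((p : ℝ) + k) / 2) v

theorem eventually_heaviside_eq {v : ℝ} (hv : v ≠ 0) :
    heaviside =ᶠ[𝓝 v] fun _ => heaviside v := by
  rcases lt_or_gt_of_ne hv with h | h
  · filter_upwards [gt_mem_nhds h] with x hx
    rw [heaviside_of_nonpos hx.le, heaviside_of_nonpos h.le]
  · filter_upwards [lt_mem_nhds h] with x hx
    rw [heaviside_of_pos hx, heaviside_of_pos h]

/-- The Gamma factor is chosen so that integration shifts the exponent by one without producing a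
constant. -/
theorem hasDerivAt_singPow {a v : ℝ} (ha : a + 1 ≠ 0) (hv : v ≠ 0) :
    HasDerivAt (singPow (a + 1)) (singPow a v) v := by
  have h1 := ((Real.hasDerivAt_rpow_const (x := v) (p := a + 1) (Or.inl hv)).div_const
    (Real.Gamma (a + 1 + 1))).const_mul (heaviside v)
  refine (h1.congr_deriv ?_).congr_of_eventuallyEq ?_
  · rw [Real.Gamma_add_one ha, add_sub_cancel_right, mul_div_mul_left _ _ ha, singPow]
  · filter_upwards [eventually_heaviside_eq hv] with x hx
    rw [singPow, hx]

theorem continuousAt_singPow {a v : ℝ} (hv : v ≠ 0) : ContinuousAt (singPow a) v := by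
  have h1 : ContinuousAt (fun x : ℝ => heaviside v * (x ^ a / Real.Gamma (a + 1))) v :=
    continuousAt_const.mul ((Real.continuousAt_rpow_const v a (Or.inl hv)).div_const _)
  refine h1.congr ?_
  filter_upwards [eventually_heaviside_eq hv] with x hx
  rw [singPow, hx]

theorem continuousAt_singPow_zero {a : ℝ} (ha : 0 < a) : ContinuousAt (singPow a) 0 := by
  have h0 : singPow a 0 = 0 := by simp [singPow, heaviside]
  rw [ContinuousAt, h0]
  have h1 : Tendsto (fun x : ℝ => |x ^ a / Real.Gamma (a + 1)|) (𝓝 0) (𝓝 0) := by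
    have := ((Real.continuousAt_rpow_const 0 a (Or.inr ha.le)).div_const
      (Real.Gamma (a + 1))).abs.tendsto
    simpa [Real.zero_rpow ha.ne'] using this
  refine squeeze_zero_norm (fun x => ?_) h1
  rw [singPow, norm_mul]
  exact mul_le_of_le_one_left (norm_nonneg _) (abs_heaviside_le x)

/-- Differentiating the logarithm leaves a pure power. Where this is applied p and k are odd, the
exponent is a natural number, and the extra term is a monomial, hence harmless. -/
theorem hasDerivAt_singLog {a v : ℝ} (ha : a + 1 ≠ 0) (hv : v ≠ 0) :
    HasDerivAt (singLog (a + 1))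
      (singLog a v + v ^ a * (Real.pi⁻¹ / Real.Gamma (a + 1 + 1))) v := by
  have h1 := ((Real.hasDerivAt_rpow_const (x := v) (p := a + 1) (Or.inl hv)).mul
    ((Real.hasDerivAt_log hv).const_mul Real.pi⁻¹)).div_const (Real.Gamma (a + 1 + 1))
  have e : singLog (a + 1) = fun x : ℝ => x ^ (a + 1) * (Real.pi⁻¹ * Real.log x) /
      Real.Gamma (a + 1 + 1) := by
    funext x; rw [singLog, Real.log_abs]
  rw [e]
  refine h1.congr_deriv ?_
  have h2 : v ^ (a + 1) * (Real.pi⁻¹ * v⁻¹) = v ^ a * Real.pi⁻¹ := by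
    rw [Real.rpow_add_one hv]
    field_simp
  rw [h2, add_div, add_sub_cancel_right, singLog, Real.log_abs]
  congr 1
  · rw [Real.Gamma_add_one ha, ← mul_div_mul_left _ (Real.Gamma (a + 1)) ha]
    ring
  · ring

theorem continuousAt_singLog {a v : ℝ} (hv : v ≠ 0) : ContinuousAt (singLog a) v := by
  have h1 : ContinuousAt (fun x : ℝ => x ^ a * (Real.pi⁻¹ * Real.log x) /
      Real.Gamma (a + 1)) v :=
    ((Real.continuousAt_rpow_const v a (Or.inl hv)).mul
      (continuousAt_const.mul (Real.continuousAt_log hv))).div_const _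
  refine h1.congr (Eventually.of_forall fun x => ?_)
  simp only [singLog, Real.log_abs]

/-- One factor x is spent on making x log x continuous, whence a ≥ 1. -/
theorem continuousAt_singLog_zero {a : ℝ} (ha : 1 ≤ a) : ContinuousAt (singLog a) 0 := by
  have e : singLog a = fun x : ℝ => x ^ (a - 1) * (x * Real.log x) *
      (Real.pi⁻¹ / Real.Gamma (a + 1)) := by
    funext x
    rw [singLog, Real.log_abs]
    rcases eq_or_ne x 0 with rfl | hx
    · simp
    · rw [show a = a - 1 + 1 by ring, Real.rpow_add_one hx]
      rw [show a - 1 + 1 - 1 = a - 1 by ring]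
      ring
  rw [e]
  exact ((Real.continuousAt_rpow_const 0 (a - 1) (Or.inr (by linarith))).mul
    Real.continuous_mul_log.continuousAt).mul continuousAt_const

theorem continuousAt_modelSing (p k : ℕ) {v : ℝ} (hv : v ≠ 0) :
    ContinuousAt (modelSing p k) v := by
  unfold modelSing
  split_ifs
  · exact continuousAt_const.mul (continuousAt_singPow hv)
  · exact continuousAt_const.mul (ContinuousAt.comp (g := singPow _)
      (continuousAt_singPow (neg_ne_zero.2 hv)) continuous_neg.continuousAt)
  · exact continuousAt_const.mul (continuousAt_singLog hv)

theorem continuousAt_modelSing_zero {p k : ℕ} (h : 0 < p + k) :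
    ContinuousAt (modelSing p k) 0 := by
  have h' : (0 : ℝ) < ((p : ℝ) + k) / 2 := by
    have : (0 : ℝ) < ((p + k : ℕ) : ℝ) := by exact_mod_cast h
    push_cast at this
    linarith
  unfold modelSing
  split_ifs with h1 h2
  · exact continuousAt_const.mul (continuousAt_singPow_zero h')
  · exact continuousAt_const.mul (ContinuousAt.comp (g := singPow _)
      (by simpa using continuousAt_singPow_zero h') continuous_neg.continuousAt)
  · refine continuousAt_const.mul (continuousAt_singLog_zero ?_)
    have a1 : (1 : ℝ) ≤ p := by exact_mod_cast (Nat.not_even_iff_odd.1 h2).pos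
    have a2 : (1 : ℝ) ≤ k := by exact_mod_cast (Nat.not_even_iff_odd.1 h1).pos
    linarith

/-- The smooth term produced when the singularity is integrated. -/
theorem exists_smooth_eq_rpow {p k : ℕ} (hp : ¬Even p) (hk : ¬Even k) (c : ℝ) :
    ∃ q : ℝ → ℝ, ContDiff ℝ ∞ q ∧ ∀ v, c * v ^ (((p : ℝ) + k) / 2) = q v := by
  obtain ⟨n, hn⟩ := (Nat.not_even_iff_odd.1 hp).add_odd (Nat.not_even_iff_odd.1 hk)
  have e : ((p : ℝ) + k) / 2 = (n : ℕ) := by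
    have : ((p + k : ℕ) : ℝ) = ((n + n : ℕ) : ℝ) := by rw [hn]
    push_cast at this
    linarith
  refine ⟨fun v => c * v ^ n, by fun_prop, fun v => ?_⟩
  rw [e, Real.rpow_natCast]

theorem half_add_ne (p k : ℕ) : ((p : ℝ) + k) / 2 + 1 ≠ 0 := by positivity

/-- Parities are unchanged, so the same case of the definition applies. For the reflected power the
inner derivative -1 is compensated by the sign (-1)^(p/2 + 1), which flips with p. -/
theorem exists_hasDerivAt_modelSing_add_two_left (p k : ℕ) :
    ∃ q : ℝ → ℝ, ContDiff ℝ ∞ q ∧ ∀ v, v ≠ 0 →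
      HasDerivAt (modelSing (p + 2) k) (modelSing p k v + q v) v := by
  have e : (((p + 2 : ℕ) : ℝ) + k) / 2 = ((p : ℝ) + k) / 2 + 1 := by push_cast; ring
  have hpar : Even (p + 2) ↔ Even p := by simp [Nat.even_add]
  unfold modelSing
  rw [e]
  simp only [hpar]
  split_ifs with h1 h2
  · refine ⟨fun _ => 0, contDiff_const, fun v hv => ?_⟩
    exact ((hasDerivAt_singPow (half_add_ne p k) hv).const_mul _).congr_deriv (by ring)
  · refine ⟨fun _ => 0, contDiff_const, fun v hv => ?_⟩
    refine ((HasDerivAt.comp v (hasDerivAt_singPow (half_add_ne p k) (neg_ne_zero.2 hv))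
      (hasDerivAt_neg v)).const_mul _).congr_deriv ?_
    rw [show (p + 2) / 2 + 1 = p / 2 + 1 + 1 by omega, pow_succ]
    ring
  · obtain ⟨q, hq, hq'⟩ := exists_smooth_eq_rpow h2 h1 ((-1) ^ ((k + 1) / 2) *
      (Real.pi⁻¹ / Real.Gamma (((p : ℝ) + k) / 2 + 1 + 1)))
    refine ⟨q, hq, fun v hv => ?_⟩
    refine ((hasDerivAt_singLog (half_add_ne p k) hv).const_mul _).congr_deriv ?_
    rw [← hq']
    ring

/-- Here the derivative comes with a minus sign, as negative squares require: in two cases it comes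
from the power of -1 containing k, in the reflected case from the inner derivative. -/
theorem exists_hasDerivAt_modelSing_add_two_right (p k : ℕ) :
    ∃ q : ℝ → ℝ, ContDiff ℝ ∞ q ∧ ∀ v, v ≠ 0 →
      HasDerivAt (modelSing p (k + 2)) (-modelSing p k v + q v) v := by
  have e : ((p : ℝ) + (k + 2 : ℕ)) / 2 = ((p : ℝ) + k) / 2 + 1 := by push_cast; ring
  have hpar : Even (k + 2) ↔ Even k := by simp [Nat.even_add]
  unfold modelSing
  rw [e]
  simp only [hpar]
  split_ifs with h1 h2
  · refine ⟨fun _ => 0, contDiff_const, fun v hv => ?_⟩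
    refine ((hasDerivAt_singPow (half_add_ne p k) hv).const_mul _).congr_deriv ?_
    rw [show (k + 2) / 2 = k / 2 + 1 by omega, pow_succ]
    ring
  · refine ⟨fun _ => 0, contDiff_const, fun v hv => ?_⟩
    refine ((HasDerivAt.comp v (hasDerivAt_singPow (half_add_ne p k) (neg_ne_zero.2 hv))
      (hasDerivAt_neg v)).const_mul _).congr_deriv ?_
    ring
  · obtain ⟨q, hq, hq'⟩ := exists_smooth_eq_rpow h2 h1 (-(-1) ^ ((k + 1) / 2) *
      (Real.pi⁻¹ / Real.Gamma (((p : ℝ) + k) / 2 + 1 + 1)))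
    refine ⟨q, hq, fun v hv => ?_⟩
    refine ((hasDerivAt_singLog (half_add_ne p k) hv).const_mul _).congr_deriv ?_
    rw [← hq', show (k + 2 + 1) / 2 = (k + 1) / 2 + 1 by omega, pow_succ]
    ring

/-- The diagonal quadratic form with coefficients `σ`. -/
def diagQuad {N : ℕ} (σ : Fin N → ℝ) (x : Fin N → ℝ) : ℝ := (∑ i, σ i * x i ^ 2) / 2

theorem diagQuad_consTwoEquiv {n : ℕ} (s : ℝ) (σ : Fin n → ℝ) (z : (ℝ × ℝ) × (Fin n → ℝ)) :
    diagQuad (Fin.cons s (Fin.cons s σ : Fin (n + 1) → ℝ) : Fin (n + 2) → ℝ) (consTwoEquiv n z)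
      = s * ((z.1.1 ^ 2 + z.1.2 ^ 2) / 2) + diagQuad σ z.2 := by
  rw [consTwoEquiv_apply, diagQuad, diagQuad, Fin.sum_univ_succ, Fin.sum_univ_succ]
  simp only [Fin.cons_zero, Fin.cons_succ]
  ring

theorem card_filter_cons {n : ℕ} (s : ℝ) (σ : Fin n → ℝ) :
    (Finset.univ.filter fun i => (Fin.cons s σ : Fin (n + 1) → ℝ) i = -1).card
      = (if s = -1 then 1 else 0) + (Finset.univ.filter fun i => σ i = -1).card := by
  simp only [Finset.card_filter, Fin.sum_univ_succ, Fin.cons_zero, Fin.cons_succ]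

theorem modelConst_succ (a : ℝ) : (2 * Real.pi) ^ (a + 1) = 2 * Real.pi * (2 * Real.pi) ^ a := by
  rw [Real.rpow_add_one (by positivity)]; ring

/-- There is a diagonal form with `p` positive and `k` negative squares whose sublevel volumes have
the expected singularity at level zero. -/
def HasModel (p k : ℕ) : Prop :=
  ∀ n, n = p + k → ∃ σ : Fin n → ℝ, (∀ i, σ i = 1 ∨ σ i = -1) ∧
    (Finset.univ.filter fun i => σ i = -1).card = k ∧
    IsModel (volume : Measure (Fin n → ℝ)) (diagQuad σ)
      (fun v => (2 * Real.pi) ^ (((p : ℝ) + k) / 2) * modelSing p k v)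

/-- The angular integral supplies the factor 2π that raises the constant (2π)^((p+k)/2) by one
power. -/
theorem HasModel.add_two_left {p k : ℕ} (h : HasModel p k) : HasModel (p + 2) k := by
  intro m hm
  obtain ⟨n, rfl⟩ : ∃ n, m = n + 2 := ⟨p + k, by omega⟩
  obtain ⟨σ, h1, h2, h3⟩ := h n (by omega)
  obtain ⟨q, hq, hq'⟩ := exists_hasDerivAt_modelSing_add_two_left p k
  refine ⟨Fin.cons 1 (Fin.cons 1 σ : Fin (n + 1) → ℝ), ?_, ?_, ?_⟩
  · intro i
    refine Fin.cases (by simp) (fun i => ?_) i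
    refine Fin.cases (by simp) (fun i => ?_) i
    simpa using h1 i
  · rw [card_filter_cons, card_filter_cons, h2]
    norm_num
  · have e : (((p + 2 : ℕ) : ℝ) + k) / 2 = ((p : ℝ) + k) / 2 + 1 := by push_cast; ring
    have h4 := (h3.add_sq
      (H' := fun v => (2 * Real.pi) ^ (((p : ℝ) + k) / 2) * modelSing (p + 2) k v)
      (p := fun v => (2 * Real.pi) ^ (((p : ℝ) + k) / 2) * q v)
      (fun v hv => continuousAt_const.mul (continuousAt_modelSing p k hv))
      (continuousAt_const.mul (continuousAt_modelSing_zero (by omega)))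
      (contDiff_const.mul hq)
      (fun v hv => ((hq' v hv).const_mul _).congr_deriv (by ring))).map (consTwoEquiv n)
      (measurePreserving_consTwoEquiv n) (Q' := diagQuad (Fin.cons 1 (Fin.cons 1 σ : Fin (n + 1) → ℝ)))
      (fun z => by rw [diagQuad_consTwoEquiv]; ring)
    rw [e]
    simp_rw [modelConst_succ, mul_assoc] at h4 ⊢
    exact h4

theorem HasModel.add_two_right {p k : ℕ} (h : HasModel p k) : HasModel p (k + 2) := by
  intro m hm
  obtain ⟨n, rfl⟩ : ∃ n, m = n + 2 := ⟨p + k, by omega⟩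
  obtain ⟨σ, h1, h2, h3⟩ := h n (by omega)
  obtain ⟨q, hq, hq'⟩ := exists_hasDerivAt_modelSing_add_two_right p k
  refine ⟨Fin.cons (-1) (Fin.cons (-1) σ : Fin (n + 1) → ℝ), ?_, ?_, ?_⟩
  · intro i
    refine Fin.cases (by simp) (fun i => ?_) i
    refine Fin.cases (by simp) (fun i => ?_) i
    simpa using h1 i
  · rw [card_filter_cons, card_filter_cons, h2]
    simp
    omega
  · have e : ((p : ℝ) + (k + 2 : ℕ)) / 2 = ((p : ℝ) + k) / 2 + 1 := by push_cast; ring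
    have h4 := (h3.sub_sq
      (H' := fun v => (2 * Real.pi) ^ (((p : ℝ) + k) / 2) * modelSing p (k + 2) v)
      (p := fun v => (2 * Real.pi) ^ (((p : ℝ) + k) / 2) * q v)
      (fun v hv => continuousAt_const.mul (continuousAt_modelSing p k hv))
      (continuousAt_const.mul (continuousAt_modelSing_zero (by omega)))
      (contDiff_const.mul hq)
      (fun v hv => ((hq' v hv).const_mul _).congr_deriv (by ring))).map (consTwoEquiv n)
      (measurePreserving_consTwoEquiv n)
      (Q' := diagQuad (Fin.cons (-1) (Fin.cons (-1) σ : Fin (n + 1) → ℝ)))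
      (fun z => by rw [diagQuad_consTwoEquiv]; ring)
    rw [e]
    simp_rw [modelConst_succ, mul_assoc] at h4 ⊢
    exact h4

theorem hasModel_zero_zero : HasModel 0 0 := by
  rintro n rfl
  refine ⟨fun _ => 1, by simp, by simp, ?_⟩
  have e1 : (diagQuad fun _ : Fin (0 + 0) => (1 : ℝ)) = fun _ => 0 := by
    funext x; simp [diagQuad]
  rw [e1]
  refine isModel_fin_zero.congr (p := fun _ => 0) contDiff_const fun v hv => ?_
  simp [modelSing, singPow]

theorem sqrt_eq_modelSing (v : ℝ) :
    heaviside v * (2 * √(2 * v)) = (2 * Real.pi) ^ ((1 : ℝ) / 2) * singPow (1 / 2) v := by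
  rcases le_or_gt v 0 with h | h
  · simp [singPow, heaviside_of_nonpos h]
  · rw [singPow, heaviside_of_pos h, Real.Gamma_add_one (by norm_num), Real.Gamma_one_half_eq,
      ← Real.sqrt_eq_rpow, ← Real.sqrt_eq_rpow, Real.sqrt_mul (by norm_num),
      Real.sqrt_mul (by norm_num)]
    have := Real.sqrt_pos.2 Real.pi_pos
    field_simp

theorem hasModel_one_zero : HasModel 1 0 := by
  intro n hn
  obtain rfl : n = 1 := hn
  refine ⟨fun _ => 1, by simp, by norm_num, ?_⟩
  have h := isModel_half_sq.map (ContinuousLinearEquiv.funUnique (Fin 1) ℝ ℝ).symm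
    (volume_preserving_funUnique (Fin 1) ℝ).symm (Q' := diagQuad fun _ => (1 : ℝ))
    (fun x => by simp [diagQuad])
  refine h.congr (p := fun _ => 0) contDiff_const fun v hv => ?_
  rw [sqrt_eq_modelSing]
  simp [modelSing]

theorem hasModel_zero_one : HasModel 0 1 := by
  intro n hn
  obtain rfl : n = 1 := hn
  refine ⟨fun _ => -1, by simp, by norm_num, ?_⟩
  have hc : ∀ v : ℝ, v ≠ 0 → ContinuousAt (fun v => heaviside v * (2 * √(2 * v))) v := by
    intro v hv
    simp_rw [sqrt_eq_modelSing]
    exact continuousAt_const.mul (continuousAt_singPow hv)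
  have h := (isModel_half_sq.neg hc).map (ContinuousLinearEquiv.funUnique (Fin 1) ℝ ℝ).symm
    (volume_preserving_funUnique (Fin 1) ℝ).symm (Q' := diagQuad fun _ => (-1 : ℝ))
    (fun x => by simp [diagQuad]; ring)
  refine h.congr (p := fun _ => 0) contDiff_const fun v hv => ?_
  rw [sqrt_eq_modelSing]
  simp [modelSing]

/-- The area-preserving change from null coordinates to the diagonal form. -/
def nullEquiv : (ℝ × ℝ) ≃L[ℝ] (Fin 2 → ℝ) :=
  (LinearEquiv.toContinuousLinearEquiv
    { toFun := fun z => ![z.2 + z.1 / 2, z.2 - z.1 / 2]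
      map_add' := fun x y => by ext i; fin_cases i <;> simp <;> ring
      map_smul' := fun c x => by ext i; fin_cases i <;> simp <;> ring
      invFun := fun x => (x 0 - x 1, (x 0 + x 1) / 2)
      left_inv := fun z => by ext <;> simp
      right_inv := fun x => by ext i; fin_cases i <;> simp <;> ring })

theorem nullEquiv_apply (z : ℝ × ℝ) : nullEquiv z = ![z.2 + z.1 / 2, z.2 - z.1 / 2] := rfl

theorem measurePreserving_nullEquiv : MeasurePreserving nullEquiv volume volume := by
  have h1 : MeasurePreserving (fun z : ℝ × ℝ => (z.1, z.2 + z.1 / 2)) volume volume :=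
    (MeasurePreserving.id volume).skew_product (g := fun u w => w + u / 2)
      (by unfold Function.uncurry; fun_prop)
      (Eventually.of_forall fun u => (measurePreserving_add_right volume (u / 2)).map_eq)
  have h2 : MeasurePreserving (fun z : ℝ × ℝ => (z.1, z.1 - z.2)) volume volume :=
    (MeasurePreserving.id volume).skew_product (g := fun x u => x - u)
      (by unfold Function.uncurry; fun_prop)
      (Eventually.of_forall fun x => (Measure.measurePreserving_sub_left volume x).map_eq)
  have h3 : MeasurePreserving (Prod.swap : ℝ × ℝ → ℝ × ℝ) volume volume :=
    Measure.measurePreserving_swap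
  have h4 := (volume_preserving_finTwoArrow ℝ).symm
  have h5 := h4.comp (h2.comp (h3.comp h1))
  convert! h5 using 1
  funext z
  rw [nullEquiv_apply]
  ext i
  fin_cases i
  · simp
  · simp
    ring

/-- In the null coordinates u = x - y, w = (x + y)/2, which preserve area, the form (x² - y²)/2 is u
w. -/
theorem hasModel_one_one : HasModel 1 1 := by
  intro n hn
  obtain rfl : n = 2 := hn
  refine ⟨![1, -1], ?_, ?_, ?_⟩
  · intro i; fin_cases i <;> simp
  · rw [Finset.card_filter, Fin.sum_univ_two]
    norm_num
  have h := isModel_mul.map nullEquiv measurePreserving_nullEquiv (Q' := diagQuad ![1, -1])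
    (fun z => by simp [diagQuad, nullEquiv_apply, Fin.sum_univ_two]; ring)
  refine h.congr (p := fun _ => 0) contDiff_const fun v hv => ?_
  have : (1 : ℝ) + 1 = 2 := by norm_num
  simp [modelSing, singLog, this]
  field_simp

/-- Removing squares of equal sign in pairs ends in one of the four signatures with p, k ≤ 1. -/
theorem hasModel : ∀ p k : ℕ, HasModel p k
  | p + 2, k => (hasModel p k).add_two_left
  | 0, k + 2 => (hasModel 0 k).add_two_right
  | 1, k + 2 => (hasModel 1 k).add_two_right
  | 0, 0 => hasModel_zero_zero
  | 1, 0 => hasModel_one_zero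
  | 0, 1 => hasModel_zero_one
  | 1, 1 => hasModel_one_one

/-! ### Hadamard's lemma and the Morse lemma -/

section Hadamard

variable {E F : Type*} [NormedAddCommGroup E] [NormedSpace ℝ E]
  [NormedAddCommGroup F] [NormedSpace ℝ F]

/-- The integral is the value at 0 of the convolution of the indicator of (0, 1] with s ↦ g(p, -s).
A cutoff equal to 1 on [-1, 1] gives the kernel compact support without changing that value, and
parametric convolutions are smooth. -/
theorem contDiff_integral_zero_one {n : ℕ∞} {g : E → ℝ → F} (hg : ContDiff ℝ n ↿g) :
    ContDiff ℝ n (fun p => ∫ t in (0 : ℝ)..1, g p t) := by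
  obtain ⟨χ, hχ, hχ1, hχ0, -⟩ := exists_bump_line (R := 2) (by norm_num)
  have hχn : ContDiff ℝ n χ := hχ.of_le (by exact_mod_cast le_top)
  set f : ℝ → ℝ := (Set.Ioc 0 1).indicator fun _ => 1 with hf
  have hfi : LocallyIntegrable f volume := by
    apply Integrable.locallyIntegrable
    exact (integrableOn_const (by simp)).integrable_indicator measurableSet_Ioc
  have h := contDiffOn_convolution_right_with_param_comp (𝕜 := ℝ) (μ := volume)
    (ContinuousLinearMap.lsmul ℝ ℝ : ℝ →L[ℝ] F →L[ℝ] F) (s := Set.univ) (n := n)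
    (v := fun _ : E => (0 : ℝ)) contDiffOn_const (f := f)
    (g := fun p s => χ s • g p (-s)) (k := Metric.closedBall 0 2) isOpen_univ
    (isCompact_closedBall _ _) (fun p x _ hx => by
      rw [hχ0 x, zero_smul]
      simp only [mem_closedBall_zero_iff, not_le, Real.norm_eq_abs] at hx
      exact hx.le) hfi (by
      apply ContDiff.contDiffOn
      have h1 : ContDiff ℝ n (fun q : E × ℝ => g q.1 (-q.2)) :=
        hg.comp (contDiff_fst.prodMk contDiff_snd.neg)
      exact (hχn.comp contDiff_snd).smul h1)
  rw [contDiffOn_univ] at h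
  refine (congrArg (ContDiff ℝ n) (funext fun p => ?_)).mp h
  rw [convolution_def, intervalIntegral.integral_of_le zero_le_one,
    ← integral_indicator measurableSet_Ioc]
  congr 1
  funext t
  by_cases ht : t ∈ Set.Ioc (0 : ℝ) 1
  · rw [Set.indicator_of_mem ht, hf, Set.indicator_of_mem ht]
    simp only [zero_sub, neg_neg, ContinuousLinearMap.lsmul_apply, one_smul]
    rw [hχ1, one_smul]
    rw [abs_neg, abs_of_pos ht.1]
    simpa using ht.2
  · rw [Set.indicator_of_notMem ht, hf, Set.indicator_of_notMem ht]
    simp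

/-- Hadamard's lemma. -/
theorem exists_hadamard [CompleteSpace F] {n : ℕ∞} {f : E → F} (hf : ContDiff ℝ (n + 1) f) (x₀ : E) :
    ∃ a : E → E →L[ℝ] F, ContDiff ℝ n a ∧ (∀ x, f x = f x₀ + a x (x - x₀)) ∧
      a x₀ = fderiv ℝ f x₀ := by
  have hf' : ContDiff ℝ n (fderiv ℝ f) := hf.fderiv_right le_rfl
  have hdiff : Differentiable ℝ f := hf.differentiable (by simp)
  have hg : ContDiff ℝ n ↿(fun (x : E) (t : ℝ) => fderiv ℝ f (x₀ + t • (x - x₀))) := by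
    apply hf'.comp
    exact contDiff_const.add (contDiff_snd.smul (contDiff_fst.sub contDiff_const))
  refine ⟨fun x => ∫ t in (0 : ℝ)..1, fderiv ℝ f (x₀ + t • (x - x₀)),
    contDiff_integral_zero_one hg, fun x => ?_, ?_⟩
  · have hc : Continuous fun t : ℝ => fderiv ℝ f (x₀ + t • (x - x₀)) :=
      hf'.continuous.comp (by fun_prop)
    have hd : ∀ t : ℝ, HasDerivAt (fun t : ℝ => f (x₀ + t • (x - x₀)))
        (fderiv ℝ f (x₀ + t • (x - x₀)) (x - x₀)) t := by
      intro t
      have h1 : HasDerivAt (fun t : ℝ => x₀ + t • (x - x₀)) (x - x₀) t := by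
        simpa using ((hasDerivAt_id t).smul_const (x - x₀)).const_add x₀
      exact (hdiff _).hasFDerivAt.comp_hasDerivAt t h1
    have h2 := intervalIntegral.integral_eq_sub_of_hasDerivAt (a := 0) (b := 1)
      (fun t _ => hd t) ((hc.clm_apply continuous_const).intervalIntegrable _ _)
    rw [ContinuousLinearMap.intervalIntegral_apply (hc.intervalIntegrable _ _), h2]
    simp
  · simp

end Hadamard

theorem contDiff_of_contDiffAt_tsupport {E F : Type*} [NormedAddCommGroup E] [NormedSpace ℝ E]
    [NormedAddCommGroup F] [NormedSpace ℝ F] {n : ℕ∞ω} {f : E → F}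
    (h : ∀ x ∈ tsupport f, ContDiffAt ℝ n f x) : ContDiff ℝ n f := by
  rw [contDiff_iff_contDiffAt]
  intro x
  by_cases hx : x ∈ tsupport f
  · exact h x hx
  · exact contDiffAt_const.congr_of_eventuallyEq (notMem_tsupport_iff_eventuallyEq.1 hx)

/-- A function that is smooth near a point agrees near that point with a globally smooth one. -/
theorem exists_contDiff_eventuallyEq {E F : Type*} [NormedAddCommGroup E] [NormedSpace ℝ E]
    [FiniteDimensional ℝ E] [NormedAddCommGroup F] [NormedSpace ℝ F] {f : E → F} {G : Set E}
    (hG : IsOpen G) (hf : ContDiffOn ℝ ∞ f G) {x₀ : E} (hx : x₀ ∈ G) :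
    ∃ g : E → F, ContDiff ℝ ∞ g ∧ g =ᶠ[𝓝 x₀] f := by
  obtain ⟨ε, hε, hεG⟩ := Metric.nhds_basis_closedBall.mem_iff.1 (hG.mem_nhds hx)
  let χ : ContDiffBump x₀ := ⟨ε / 2, ε, by linarith, by linarith⟩
  refine ⟨fun x => χ x • f x, ?_, ?_⟩
  · apply contDiff_of_contDiffAt_tsupport
    intro x hx
    have h1 : x ∈ tsupport χ := tsupport_smul_subset_left _ _ hx
    rw [χ.tsupport_eq] at h1
    exact χ.contDiff.contDiffAt.smul (hf.contDiffAt (hG.mem_nhds (hεG h1)))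
  · filter_upwards [χ.eventuallyEq_one] with x hx
    simp [hx]

section Morse

variable {E : Type*} [NormedAddCommGroup E] [NormedSpace ℝ E] [FiniteDimensional ℝ E]

/-- A smooth square root near the identity. -/
theorem exists_sqrt_near_one :
    ∃ S : (E →L[ℝ] E) → (E →L[ℝ] E), ContDiffAt ℝ ∞ S 1 ∧ S 1 = 1 ∧
      (∀ᶠ M in 𝓝 1, S M * S M = M) ∧ ∀ᶠ M in 𝓝 1, S (M * M) = M := by
  set f : (E →L[ℝ] E) → (E →L[ℝ] E) := fun M => M * M with hf
  have hfc : ContDiff ℝ ∞ f := contDiff_id.mul contDiff_id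
  -- Squaring has derivative 2·id at the identity, so the inverse function theorem yields the square
  -- root.
  let f' : (E →L[ℝ] E) ≃L[ℝ] (E →L[ℝ] E) :=
    ContinuousLinearEquiv.smulLeft (Units.mk0 (2 : ℝ) two_ne_zero)
  have hd : HasFDerivAt f (f' : (E →L[ℝ] E) →L[ℝ] (E →L[ℝ] E)) 1 := by
    have h1 := (hasFDerivAt_id (𝕜 := ℝ) (1 : E →L[ℝ] E)).mul' (hasFDerivAt_id (𝕜 := ℝ) 1)
    refine h1.congr_fderiv (ContinuousLinearMap.ext fun M => ?_)
    change 1 * M + M * 1 = (2 : ℝ) • M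
    rw [one_mul, mul_one, two_smul]
  have hn : (∞ : ℕ∞ω) ≠ 0 := by simp
  have hf1 : f 1 = 1 := by simp [hf]
  refine ⟨hfc.contDiffAt.localInverse hd hn, ?_, ?_, ?_, ?_⟩
  · have := hfc.contDiffAt.to_localInverse hd hn
    rwa [hf1] at this
  · have := hfc.contDiffAt.localInverse_apply_image hd hn
    rwa [hf1] at this
  · have := (hfc.contDiffAt.hasStrictFDerivAt' hd hn).eventually_right_inverse
    rwa [hf1] at this
  · exact (hfc.contDiffAt.hasStrictFDerivAt' hd hn).eventually_left_inverse

/-- Second-order Hadamard lemma at a critical point. -/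
theorem exists_hadamard_two {V : E → ℝ} (hV : ContDiff ℝ ∞ V) {x₀ : E} (h0 : V x₀ = 0)
    (h1 : fderiv ℝ V x₀ = 0) :
    ∃ B : E → E →L[ℝ] E →L[ℝ] ℝ, ContDiff ℝ ∞ B ∧ (∀ x u w, B x u w = B x w u) ∧
      (∀ x, V x = B x (x - x₀) (x - x₀) / 2) ∧ B x₀ = fderiv ℝ (fderiv ℝ V) x₀ := by
  obtain ⟨a, ha, hVa, ha0⟩ := exists_hadamard (n := ⊤) (by simpa using hV) x₀
  obtain ⟨C, hC, haC, hC0⟩ := exists_hadamard (n := ⊤) (by simpa using ha) x₀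
  have ha' : ContDiff ℝ ∞ (fderiv ℝ a) := ha.fderiv_right (by simp)
  have hda : Differentiable ℝ a := ha.differentiable (by simp)
  have hfl : ContDiff ℝ ∞ fun x => (C x).flip := by
    rw [contDiff_clm_apply_iff]
    intro u
    rw [contDiff_clm_apply_iff]
    intro w
    exact (hC.clm_apply contDiff_const).clm_apply contDiff_const
  -- Two applications of Hadamard's lemma give V = C(x)(x - x₀, x - x₀). Symmetrising doubles the
  -- form, which the division by 2 undoes.
  refine ⟨fun x => C x + (C x).flip, hC.add hfl, fun x u w => ?_, fun x => ?_, ?_⟩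
  · simp [add_comm]
  · rw [hVa x, haC x, h0, ha0, h1]
    simp only [zero_add, add_apply, ContinuousLinearMap.flip_apply]
    ring
  -- Differentiating V = a(x)(x - x₀) twice at x₀ leaves da(x₀) and its transpose; the term with the
  -- second derivative of a is applied to x₀ - x₀.
  · have hfV : ∀ x, fderiv ℝ V x = (fderiv ℝ a x).flip (x - x₀) + a x := by
      intro x
      have e : V = fun x => a x (x - x₀) := by
        funext x; rw [hVa x, h0, zero_add]
      have h2 : HasFDerivAt V ((a x).comp (ContinuousLinearMap.id ℝ E) +
          (fderiv ℝ a x).flip (x - x₀)) x := by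
        have := (hda x).hasFDerivAt.clm_apply ((hasFDerivAt_id x).sub_const x₀)
        rw [e]
        exact this
      rw [h2.fderiv, add_comm]
      rfl
    have hV' : Differentiable ℝ (fderiv ℝ V) :=
      (hV.fderiv_right (m := 1) (by norm_cast)).differentiable one_ne_zero
    ext u w
    obtain ⟨D, hD⟩ : ∃ D, HasFDerivAt (fun x => fderiv ℝ a x w) D x₀ :=
      ⟨_, ((ha'.differentiable (by simp) x₀).clm_apply
        (differentiableAt_const w)).hasFDerivAt⟩
    have h3 : HasFDerivAt (fun x => fderiv ℝ V x w)
        ((fderiv ℝ a x₀ w).comp (ContinuousLinearMap.id ℝ E) + D.flip (x₀ - x₀) +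
          (ContinuousLinearMap.apply ℝ ℝ w).comp (fderiv ℝ a x₀)) x₀ := by
      have e : (fun x => fderiv ℝ V x w) = fun x => fderiv ℝ a x w (x - x₀) + a x w := by
        funext x; rw [hfV]; rfl
      rw [e]
      have h7 : HasFDerivAt (fun x => a x w) _ x₀ :=
        (ContinuousLinearMap.apply ℝ ℝ w).hasFDerivAt.comp x₀ (hda x₀).hasFDerivAt
      exact (hD.clm_apply ((hasFDerivAt_id x₀).sub_const x₀)).add h7
    have h4 : HasFDerivAt (fun x => fderiv ℝ V x w)
        ((ContinuousLinearMap.apply ℝ ℝ w).comp (fderiv ℝ (fderiv ℝ V) x₀)) x₀ :=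
      (ContinuousLinearMap.apply ℝ ℝ w).hasFDerivAt.comp x₀ (hV' x₀).hasFDerivAt
    have h5 := DFunLike.congr_fun (h4.unique h3) u
    simp only [ContinuousLinearMap.comp_apply, ContinuousLinearMap.apply_apply,
      add_apply, sub_self, map_zero, add_zero,
      ContinuousLinearMap.id_apply] at h5
    simp [h5, hC0, add_comm]

/-- The Morse lemma: near a nondegenerate critical point a function is half its Hessian form in
suitable coordinates tangent to the identity. -/
theorem exists_morse_chart {V : E → ℝ} (hV : ContDiff ℝ ∞ V) {x₀ : E} (h0 : V x₀ = 0)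
    (h1 : fderiv ℝ V x₀ = 0) (hH : Function.Injective (fderiv ℝ (fderiv ℝ V) x₀)) :
    ∃ Φ : E → E, ContDiffAt ℝ ∞ Φ x₀ ∧ Φ x₀ = 0 ∧
      HasFDerivAt Φ (ContinuousLinearMap.id ℝ E) x₀ ∧
      ∀ᶠ x in 𝓝 x₀, V x = fderiv ℝ (fderiv ℝ V) x₀ (Φ x) (Φ x) / 2 := by
  obtain ⟨B, hB, hsymm, hVB, hB0⟩ := exists_hadamard_two hV h0 h1
  set H := fderiv ℝ (fderiv ℝ V) x₀
  have hrank : Module.finrank ℝ E = Module.finrank ℝ (E →L[ℝ] ℝ) := by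
    rw [← LinearMap.toContinuousLinearMap.finrank_eq, Module.finrank_linearMap,
      Module.finrank_self, mul_one]
  let He : E ≃L[ℝ] (E →L[ℝ] ℝ) :=
    (LinearEquiv.ofInjectiveOfFinrankEq (H : E →ₗ[ℝ] E →L[ℝ] ℝ) hH hrank).toContinuousLinearEquiv
  obtain ⟨S, hS, hS1, hSr, hSl⟩ := exists_sqrt_near_one (E := E)
  let Hi : (E →L[ℝ] ℝ) →L[ℝ] E := (He.symm : (E →L[ℝ] ℝ) →L[ℝ] E)
  have hHi : ∀ φ : E →L[ℝ] ℝ, H (Hi φ) = φ := fun φ => He.apply_symm_apply φ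
  -- R = H⁻¹B expresses the form B(x) through H and is the identity at x₀. If C² = R with C
  -- self-adjoint for H, then B(y, y) = H(C²y, y) = H(Cy, Cy), so x ↦ C(x)(x - x₀) is the chart.
  let R : E → (E →L[ℝ] E) := fun x => Hi.comp (B x)
  have hR : ContDiff ℝ ∞ R := contDiff_const.clm_comp hB
  have hR0 : R x₀ = 1 := by
    ext u
    simp only [R, hB0, ContinuousLinearMap.comp_apply, one_apply_eq_self]
    exact He.symm_apply_apply u
  have hHR : ∀ x u, H (R x u) = B x u := fun x u => hHi _
  -- `J` is the adjoint with respect to H; R is self-adjoint because B and H are symmetric.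
  let J : (E →L[ℝ] E) → (E →L[ℝ] E) := fun M =>
    (Hi.comp ((ContinuousLinearMap.compL ℝ E E ℝ).flip M)).comp H
  have hJ : ∀ M u w, H (J M u) w = H u (M w) := by
    intro M u w
    simp only [J, ContinuousLinearMap.comp_apply, hHi]
    simp
  have hext : ∀ M M' : E →L[ℝ] E, (∀ u w, H (M u) w = H (M' u) w) → M = M' := by
    intro M M' h
    ext1 u
    exact hH (ContinuousLinearMap.ext (h u))
  have hJmul : ∀ M, J M * J M = J (M * M) := by
    intro M
    apply hext
    intro u w
    simp only [mul_apply_eq_comp, hJ]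
  have hHsymm : ∀ u w, H u w = H w u := by
    intro u w
    rw [← hB0, hsymm]
  have hJR : ∀ x, J (R x) = R x := by
    intro x
    apply hext
    intro u w
    rw [hJ, hHsymm, hHR, hHR, hsymm]
  have hJ1 : J 1 = 1 := by
    apply hext
    intro u w
    rw [hJ]
    simp
  have hJc : Continuous J := by
    have : Continuous fun M : E →L[ℝ] E => (ContinuousLinearMap.compL ℝ E E ℝ).flip M :=
      (ContinuousLinearMap.compL ℝ E E ℝ).flip.continuous
    exact (continuous_const.clm_comp this).clm_comp continuous_const
  let C : E → (E →L[ℝ] E) := fun x => S (R x)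
  have hC : ContDiffAt ℝ ∞ C x₀ := by
    refine ContDiffAt.comp x₀ ?_ hR.contDiffAt
    rwa [hR0]
  have hC0 : C x₀ = 1 := by simp only [C, hR0, hS1]
  have hRt : Tendsto R (𝓝 x₀) (𝓝 1) := by
    have := hR.continuous.tendsto x₀
    rwa [hR0] at this
  have hCt : Tendsto (fun x => J (C x)) (𝓝 x₀) (𝓝 1) := by
    have := (hJc.continuousAt.comp hC.continuousAt).tendsto
    rw [Function.comp_apply, hC0, hJ1] at this
    exact this
  have hCC : ∀ᶠ x in 𝓝 x₀, C x * C x = R x := hRt.eventually hSr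
  -- The adjoint of the root is also a square root of R near the identity, and such roots are
  -- locally unique.
  have hJC : ∀ᶠ x in 𝓝 x₀, J (C x) = C x := by
    filter_upwards [hCC, hCt.eventually hSl] with x h2 h3
    rw [hJmul, h2, hJR] at h3
    exact h3.symm
  have hΦd : HasFDerivAt (fun x => C x (x - x₀)) (ContinuousLinearMap.id ℝ E) x₀ := by
    have h2 := (hC.differentiableAt (by simp)).hasFDerivAt.clm_apply
      ((hasFDerivAt_id x₀).sub_const x₀)
    refine h2.congr_fderiv ?_
    ext u
    simp [hC0]
  refine ⟨fun x => C x (x - x₀), hC.clm_apply (contDiffAt_id.sub contDiffAt_const), by simp,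
    hΦd, ?_⟩
  filter_upwards [hCC, hJC] with x h2 h3
  rw [hVB x, ← hHR, ← h2, mul_apply_eq_comp]
  conv_lhs => rw [← h3, hJ, h3]

end Morse

/-! ### Reduction of the Hessian to signs -/

open Matrix in
-- Sylvester's law by the spectral theorem: scale the eigenvectors by √|λ| and permute them so that
-- negative eigenvalues meet the entries -1. The determinant identity follows from |det of the
-- signs| = 1.
theorem exists_diagonal_congruence {n : ℕ} {A : Matrix (Fin n) (Fin n) ℝ} (hA : A.IsHermitian)
    {σ : Fin n → ℝ} (hσ : ∀ i, σ i = 1 ∨ σ i = -1)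
    (hcard : (Finset.univ.filter fun i => σ i = -1).card =
      (A.charpoly.roots.filter (fun x => x < 0)).card) :
    ∃ L : Matrix (Fin n) (Fin n) ℝ, Lᵀ * diagonal σ * L = A ∧ |L.det| = √|A.det| := by
  classical
  set ev := hA.eigenvalues
  have hroots : (A.charpoly.roots.filter (fun x => x < 0)).card =
      (Finset.univ.filter fun i => ev i < 0).card := by
    rw [hA.roots_charpoly_eq_eigenvalues, Multiset.filter_map, Multiset.card_map]
    rfl
  -- Equality of the two counts is where the Morse index enters.
  have e : {i // σ i = -1} ≃ {i // ev i < 0} := Fintype.equivOfCardEq (by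
    rw [Fintype.card_subtype, Fintype.card_subtype, hcard, hroots])
  let π := e.extendSubtype
  have hπ : ∀ i, σ i * |ev (π i)| = ev (π i) := by
    intro i
    rcases hσ i with h | h
    · have := e.extendSubtype_not_mem i (by rw [h]; norm_num)
      rw [h, one_mul, abs_of_nonneg (not_lt.1 this)]
    · have := e.extendSubtype_mem i h
      rw [h, abs_of_neg this]; ring
  let U : Matrix (Fin n) (Fin n) ℝ := hA.eigenvectorUnitary
  have hspec : A = U * diagonal ev * Uᵀ := by
    have := hA.spectral_theorem
    rw [Unitary.conjStarAlgAut_apply] at this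
    simpa [U, star_eq_conjTranspose, conjTranspose_eq_transpose_of_trivial, ev] using this
  let L : Matrix (Fin n) (Fin n) ℝ := Matrix.of fun i j => √|ev (π i)| * U j (π i)
  have hL : Lᵀ * diagonal σ * L = A := by
    rw [hspec]
    ext a b
    rw [mul_apply, mul_apply]
    simp only [mul_diagonal, transpose_apply, L, of_apply]
    rw [← Equiv.sum_comp π fun i => U a i * ev i * U b i]
    refine Finset.sum_congr rfl fun i _ => ?_
    have : √|ev (π i)| * √|ev (π i)| = |ev (π i)| := Real.mul_self_sqrt (abs_nonneg _)
    calc _ = (σ i * (√|ev (π i)| * √|ev (π i)|)) * U a (π i) * U b (π i) := by ring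
      _ = _ := by rw [this, hπ]; ring
  refine ⟨L, hL, ?_⟩
  have h1 : |A.det| = |L.det| ^ 2 := by
    rw [← hL, det_mul, det_mul, det_transpose, det_diagonal, abs_mul, abs_mul, Finset.abs_prod,
      Finset.prod_eq_one fun i _ => ?_]
    · ring
    · rcases hσ i with h | h <;> simp [h]
  rw [h1, Real.sqrt_sq (abs_nonneg _)]

section Coordinates

variable {N : ℕ}

local notation "E" => EuclideanSpace ℝ (Fin N)

theorem hessian_apply {V : E → ℝ} {q : E} (hV : ContDiffAt ℝ 2 V q) (i j : Fin N) :
    hessian V q i j = fderiv ℝ (fderiv ℝ V) q (EuclideanSpace.single i 1)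
      (EuclideanSpace.single j 1) := by
  have h : DifferentiableAt ℝ (fderiv ℝ V) q :=
    (hV.fderiv_right (m := 1) (by norm_num)).differentiableAt one_ne_zero
  simp only [hessian, Matrix.of_apply]
  rw [fderiv_clm_apply h (differentiableAt_const _)]
  simp

theorem fderiv_fderiv_apply_eq_sum {V : E → ℝ} {q : E} (hV : ContDiffAt ℝ 2 V q) (x y : E) :
    fderiv ℝ (fderiv ℝ V) q x y = ∑ i, ∑ j, x i * y j * hessian V q i j := by
  have hx : ∀ z : E, z = ∑ i, z i • EuclideanSpace.single i (1 : ℝ) := fun z => by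
    ext k; simp [Pi.single_apply]
  conv_lhs => rw [hx x, hx y]
  simp only [map_sum, map_smul, sum_apply, smul_apply, smul_eq_mul,
    Finset.mul_sum]
  rw [Finset.sum_comm]
  refine Finset.sum_congr rfl fun i _ => Finset.sum_congr rfl fun j _ => ?_
  rw [hessian_apply hV]; ring

theorem isHermitian_hessian {V : E → ℝ} {q : E} (hV : ContDiffAt ℝ 2 V q) :
    (hessian V q).IsHermitian := by
  refine Matrix.IsHermitian.ext fun i j => ?_
  have hs : IsSymmSndFDerivAt ℝ V q := hV.isSymmSndFDerivAt (by simp)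
  rw [hessian_apply hV, hessian_apply hV, hs]
  simp

theorem injective_fderiv_fderiv {V : E → ℝ} {q : E} (hV : ContDiffAt ℝ 2 V q)
    (hdet : (hessian V q).det ≠ 0) : Function.Injective (fderiv ℝ (fderiv ℝ V) q) := by
  rw [injective_iff_map_eq_zero]
  intro x hx
  have h : (hessian V q).vecMul (WithLp.ofLp x) = 0 := by
    ext j
    have := DFunLike.congr_fun hx (EuclideanSpace.single j 1)
    rw [fderiv_fderiv_apply_eq_sum hV] at this
    simpa [Matrix.vecMul, dotProduct, Pi.single_apply] using this
  have := Matrix.eq_zero_of_vecMul_eq_zero hdet h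
  ext i
  exact congrFun this i

theorem morseIndex_le (V : E → ℝ) (q : E) : morseIndex V q ≤ N := by
  unfold morseIndex
  calc _ ≤ (hessian V q).charpoly.roots.card := Multiset.card_le_card (Multiset.filter_le _ _)
    _ ≤ _ := Polynomial.card_roots' _
    _ = N := by rw [Matrix.charpoly_natDegree_eq_dim, Fintype.card_fin]

/-- The Morse chart is tangent to the identity, so after composition with the congruence its
Jacobian at q is that of the linear map alone. -/
theorem exists_diagonal_morse_chart {V : E → ℝ} {G : Set E} (hG : IsOpen G)
    (hV : ContDiffOn ℝ ∞ V G) {q : E} (hq : q ∈ G) (h0 : V q = 0) (h1 : fderiv ℝ V q = 0)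
    (hdet : (hessian V q).det ≠ 0) {σ : Fin N → ℝ} (hσ : ∀ i, σ i = 1 ∨ σ i = -1)
    (hcard : (Finset.univ.filter fun i => σ i = -1).card = morseIndex V q) :
    ∃ Ψ : E → E, ContDiffAt ℝ ∞ Ψ q ∧ Ψ q = 0 ∧ |(fderiv ℝ Ψ q).det| = √|(hessian V q).det| ∧
      ∀ᶠ x in 𝓝 q, V x = diagQuad σ (WithLp.ofLp (Ψ x)) := by
  have hVq : ContDiffAt ℝ 2 V q :=
    (hV.contDiffAt (hG.mem_nhds hq)).of_le (by norm_cast)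
  obtain ⟨g, hg, hgV⟩ := exists_contDiff_eventuallyEq hG hV hq
  have hd1 : fderiv ℝ g =ᶠ[𝓝 q] fderiv ℝ V := hgV.fderiv
  have hd2 : fderiv ℝ (fderiv ℝ g) q = fderiv ℝ (fderiv ℝ V) q := hd1.fderiv_eq
  obtain ⟨Φ, hΦ, hΦ0, hΦd, hΦV⟩ := exists_morse_chart hg (hgV.eq_of_nhds.trans h0)
    (hd1.eq_of_nhds.trans h1) (by rw [hd2]; exact injective_fderiv_fderiv hVq hdet)
  obtain ⟨L, hL, hLdet⟩ := exists_diagonal_congruence (isHermitian_hessian hVq) hσ hcard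
  let T : E →L[ℝ] E := (Matrix.toEuclideanLin L).toContinuousLinearMap
  have hT : ∀ x i, T x i = ∑ j, L i j * x j := fun x i => rfl
  have hTdet : T.det = L.det := by
    rw [ContinuousLinearMap.det]
    show LinearMap.det (Matrix.toLpLin 2 2 L) = _
    rw [Matrix.toLpLin_eq_toLin, LinearMap.det_toLin]
  refine ⟨fun x => T (Φ x), T.contDiff.contDiffAt.comp q hΦ, by simp [hΦ0], ?_, ?_⟩
  · have : HasFDerivAt (fun x => T (Φ x)) _ q := T.hasFDerivAt.comp q hΦd
    rw [this.fderiv, ContinuousLinearMap.comp_id, hTdet, hLdet]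
  · filter_upwards [hgV, hΦV] with x hx1 hx2
    rw [← hx1, hx2, hd2, fderiv_fderiv_apply_eq_sum hVq, diagQuad]
    congr 1
    simp only [hT]
    rw [← hL]
    generalize Φ x = y
    have h : ∀ i j, (L.transpose * Matrix.diagonal σ * L) i j = ∑ k, L k i * σ k * L k j := by
      intro i j
      rw [Matrix.mul_apply]
      simp only [Matrix.mul_diagonal, Matrix.transpose_apply]
    simp only [h, pow_two, Finset.sum_mul, Finset.mul_sum]
    symm
    rw [Finset.sum_comm]
    refine Finset.sum_congr rfl fun i _ => ?_
    rw [Finset.sum_comm]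
    refine Finset.sum_congr rfl fun j _ => Finset.sum_congr rfl fun k _ => ?_
    ring

end Coordinates

/-! ### Pullback of model weights -/

section Transfer

variable {N : ℕ}

local notation "E" => EuclideanSpace ℝ (Fin N)

theorem contDiff_det : ContDiff ℝ ∞ fun T : E →L[ℝ] E => T.det := by
  have h : (fun T : E →L[ℝ] E => T.det) = fun T => ∑ τ : Equiv.Perm (Fin N),
      Equiv.Perm.sign τ • ∏ i, T (EuclideanSpace.single i 1) (τ i) := by
    funext T
    rw [ContinuousLinearMap.det,
      ← LinearMap.det_toMatrix (EuclideanSpace.basisFun (Fin N) ℝ).toBasis, Matrix.det_apply]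
    simp [LinearMap.toMatrix_apply]
  rw [h]
  refine ContDiff.sum fun τ _ => ContDiff.const_smul _ (contDiff_prod fun i _ => ?_)
  exact ((EuclideanSpace.proj (τ i)).comp
    (ContinuousLinearMap.apply ℝ E (EuclideanSpace.single i (1 : ℝ)))).contDiff

/-- Pulling back a model along a local diffeomorphism. -/
theorem exists_pullback_weight (m : ℕ) {V : E → ℝ} {G O : Set E} {q : E} (hG : G ∈ 𝓝 q)
    (hGm : MeasurableSet G) (hO : O ∈ 𝓝 q) {Ψ : E → E} (hΨ : ContDiffAt ℝ ∞ Ψ q) (hΨ0 : Ψ q = 0)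
    (hdet : (fderiv ℝ Ψ q).det ≠ 0) {Q : (Fin N → ℝ) → ℝ} {H : ℝ → ℝ} (hQ : IsModel volume Q H)
    (hV : ∀ᶠ x in 𝓝 q, V x = Q (WithLp.ofLp (Ψ x))) :
    ∃ ψ : E → ℝ, ContDiff ℝ m ψ ∧ HasCompactSupport ψ ∧ tsupport ψ ⊆ O ∧
      ψ q = |(fderiv ℝ Ψ q).det| ∧ ∃ S : ℝ → ℝ, ContDiff ℝ ∞ S ∧
        ∀ᶠ v in 𝓝[≠] (0 : ℝ), sublevelIntegral (volume.restrict G) V ψ v = H v + S v := by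
  classical
  have hd : HasFDerivAt Ψ (((fderiv ℝ Ψ q).toContinuousLinearEquivOfDetNeZero hdet : E ≃L[ℝ] E) :
      E →L[ℝ] E) q := by
    rw [ContinuousLinearMap.coe_toContinuousLinearEquivOfDetNeZero]
    exact (hΨ.differentiableAt (by simp)).hasFDerivAt
  let e := hΨ.toOpenPartialHomeomorph Ψ hd (by simp)
  have he : ∀ x, e x = Ψ x := fun x => rfl
  have hqe : q ∈ e.source := hΨ.mem_toOpenPartialHomeomorph_source hd (by simp)
  -- Only a finite order of smoothness at q passes to a neighbourhood, so the weight is obtained to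
  -- a prescribed order m; the Jacobian costs one more derivative.
  have hΨm : ContDiffAt ℝ ((m + 1 : ℕ) : ℕ∞ω) Ψ q := hΨ.of_le (by exact_mod_cast le_top)
  have hdetc : ContinuousAt (fun x => (fderiv ℝ Ψ x).det) q :=
    contDiff_det.continuous.continuousAt.comp
      (hΨ.fderiv_right (m := 0) (by simp)).continuousAt
  obtain ⟨A, hA, hAo, hqA⟩ := eventually_nhds_iff.1 ((((e.open_source.eventually_mem hqe).and
    (eventually_mem_nhds_iff.2 hG)).and (eventually_mem_nhds_iff.2 hO)).and
    (hV.and ((hΨm.eventually (by simp)).and (hdetc.eventually_ne hdet))))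
  have hAs : A ⊆ e.source := fun x hx => (hA x hx).1.1.1
  have hAG : A ⊆ G := fun x hx => mem_of_mem_nhds (hA x hx).1.1.2
  have hAO : A ⊆ O := fun x hx => mem_of_mem_nhds (hA x hx).1.2
  have hB : IsOpen (e '' A) := e.isOpen_image_of_subset_source hAo hAs
  let U : Set (Fin N → ℝ) := WithLp.toLp 2 ⁻¹' (e '' A)
  have hU : U ∈ 𝓝 0 := by
    refine (hB.preimage (PiLp.continuous_toLp 2 _)).mem_nhds ⟨q, hqA, ?_⟩
    rw [he, hΨ0]; rfl
  obtain ⟨ψ₀, hψ₀, hcs, hsupp, hone, S, hS, hSv⟩ := hQ.2 U hU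
  let ψ : E → ℝ := A.indicator fun x => ψ₀ (WithLp.ofLp (Ψ x)) * |(fderiv ℝ Ψ x).det|
  let K : Set E := e.symm '' (WithLp.toLp 2 '' tsupport ψ₀)
  have hKt : WithLp.toLp 2 '' tsupport ψ₀ ⊆ e '' A := by
    rintro _ ⟨z, hz, rfl⟩
    exact hsupp hz
  have hBt : e '' A ⊆ e.target := by
    rintro _ ⟨x, hx, rfl⟩
    exact e.map_source (hAs hx)
  have hK : IsCompact K := (hcs.isCompact.image (PiLp.continuous_toLp 2 _)).image_of_continuousOn
    (e.continuousOn_symm.mono (hKt.trans hBt))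
  have hKA : K ⊆ A := by
    rintro _ ⟨y, hy, rfl⟩
    obtain ⟨x, hx, rfl⟩ := hKt hy
    rwa [e.left_inv (hAs hx)]
  have hψK : ∀ x, x ∉ K → ψ x = 0 := by
    intro x hx
    by_cases hxA : x ∈ A
    · simp only [ψ, Set.indicator_of_mem hxA]
      rw [image_eq_zero_of_notMem_tsupport (f := ψ₀), zero_mul]
      intro h
      exact hx ⟨Ψ x, ⟨_, h, rfl⟩, e.left_inv (hAs hxA)⟩
    · exact Set.indicator_of_notMem hxA _
  have htK : tsupport ψ ⊆ K := by
    refine closure_minimal (fun x hx => ?_) hK.isClosed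
    by_contra h
    exact hx (hψK x h)
  refine ⟨ψ, ?_, HasCompactSupport.intro hK hψK, htK.trans (hKA.trans hAO), ?_, S, hS, ?_⟩
  · refine contDiff_of_contDiffAt_tsupport fun x hx => ?_
    have hxA := hKA (htK hx)
    have hx' := (hA x hxA).2.2
    have hmul : ContDiffAt ℝ m (fun x => ψ₀ (WithLp.ofLp (Ψ x)) * |(fderiv ℝ Ψ x).det|) x := by
      refine ContDiffAt.mul ?_ ?_
      · have h1 : ContDiffAt ℝ m Ψ x := hx'.1.of_le (by exact_mod_cast Nat.le_succ m)
        have h2 : ContDiff ℝ m (fun y : E => ψ₀ (WithLp.ofLp y)) :=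
          (hψ₀.of_le (by exact_mod_cast le_top)).comp
            (PiLp.continuousLinearEquiv 2 ℝ (fun _ : Fin N => ℝ)).contDiff
        exact h2.contDiffAt.comp x h1
      · refine ContDiffAt.abs ?_ hx'.2
        exact (contDiff_det.of_le (by exact_mod_cast le_top)).contDiffAt.comp x
          (hx'.1.fderiv_right (by norm_cast))
    refine hmul.congr_of_eventuallyEq ?_
    filter_upwards [hAo.mem_nhds hxA] with y hy
    exact Set.indicator_of_mem hy _
  · simp only [ψ, Set.indicator_of_mem hqA, hΨ0]
    erw [hone, one_mul]
  · filter_upwards [hSv] with v hv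
    rw [← hv]
    unfold sublevelIntegral
    rw [setIntegral_eq_of_subset_of_forall_sdiff_eq_zero hGm hAG fun x hx => by
      simp only [ψ, Set.indicator_of_notMem hx.2, mul_zero]]
    let g : E → ℝ := fun y => heaviside (v - Q (WithLp.ofLp y)) * ψ₀ (WithLp.ofLp y)
    have h1 : ∫ x in A, heaviside (v - V x) * ψ x =
        ∫ x in A, |(fderiv ℝ Ψ x).det| • g (Ψ x) := by
      refine setIntegral_congr_fun hAo.measurableSet fun x hx => ?_
      simp only [ψ, Set.indicator_of_mem hx, g, smul_eq_mul, (hA x hx).2.1]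
      ring
    rw [h1, ← integral_image_eq_integral_abs_det_fderiv_smul volume hAo.measurableSet
      (fun x hx => (((hA x hx).2.2.1.differentiableAt (by simp)).hasFDerivAt).hasFDerivWithinAt)
      (e.injOn.mono hAs) g, setIntegral_eq_integral_of_forall_compl_eq_zero fun y hy => ?_]
    · exact (PiLp.volume_preserving_ofLp (Fin N)).integral_comp
        (MeasurableEquiv.toLp 2 (Fin N → ℝ)).symm.measurableEmbedding
        fun z => heaviside (v - Q z) * ψ₀ z
    · simp only [g]
      rw [image_eq_zero_of_notMem_tsupport (f := ψ₀), mul_zero]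
      intro h
      exact hy (hsupp h)

end Transfer

/-! ### Integration by parts up to a boundary -/

section IntegrationByParts

variable {N : ℕ}

local notation "E" => EuclideanSpace ℝ (Fin N)

/-- The divergence of a vector field on Euclidean space. -/
def divergence (θ : E → E) (x : E) : ℝ :=
  ∑ i, fderiv ℝ (fun y => θ y i) x (EuclideanSpace.single i 1)

theorem tsupport_coord_subset (θ : E → E) (i : Fin N) : tsupport (fun y => θ y i) ⊆ tsupport θ :=
  tsupport_comp_subset (g := fun z : E => z i) rfl θ

theorem contDiff_divergence {θ : E → E} {m : ℕ} (hθ : ContDiff ℝ (m + 1) θ) :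
    ContDiff ℝ m (divergence θ) := by
  refine ContDiff.sum fun i _ => ?_
  have : ContDiff ℝ (m + 1) fun y => θ y i := (contDiff_euclidean.1 hθ) i
  exact (this.fderiv_right le_rfl).clm_apply contDiff_const

theorem tsupport_divergence_subset (θ : E → E) : tsupport (divergence θ) ⊆ tsupport θ := by
  refine closure_minimal (fun x hx => ?_) (isClosed_tsupport θ)
  by_contra h
  refine hx (Finset.sum_eq_zero fun i _ => ?_)
  have h2 : x ∉ tsupport (fderiv ℝ fun y => θ y i) := fun h3 =>
    h (tsupport_coord_subset θ i (tsupport_fderiv_subset ℝ h3))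
  rw [image_eq_zero_of_notMem_tsupport h2, zero_apply]

theorem sum_smul_single (z : E) : ∑ i, z i • EuclideanSpace.single i (1 : ℝ) = z := by
  ext k; simp [Pi.single_apply]

/-- The divergence theorem without boundary, for a field supported where `f` is `C¹`. -/
theorem integral_mul_divergence {f : E → ℝ} {θ : E → E} {O : Set E} (hO : IsOpen O)
    (hf : ContDiffOn ℝ 1 f O) (hθ : ContDiff ℝ 1 θ) (hc : HasCompactSupport θ)
    (hs : tsupport θ ⊆ O) :
    ∫ x, f x * divergence θ x = -∫ x, fderiv ℝ f x (θ x) := by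
  have hfO : ∀ x ∈ O, ContDiffAt ℝ 1 f x := fun x hx => hf.contDiffAt (hO.mem_nhds hx)
  have hf' : ∀ x ∈ O, ContinuousAt (fderiv ℝ f) x := fun x hx =>
    ((hfO x hx).fderiv_right (m := 0) (by simp)).continuousAt
  have hθi : ∀ i, ContDiff ℝ 1 fun y => θ y i := contDiff_euclidean.1 hθ
  have hθc : ∀ i, HasCompactSupport fun y => θ y i := fun i =>
    hc.comp_left (g := fun z : E => z i) rfl
  have hsi : ∀ i, tsupport (fun y => θ y i) ⊆ O := fun i => (tsupport_coord_subset θ i).trans hs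
  have hdc : ∀ i, Continuous fun x => fderiv ℝ (fun y => θ y i) x (EuclideanSpace.single i 1) :=
    fun i => ((hθi i).continuous_fderiv one_ne_zero).clm_apply continuous_const
  have hdsupp : ∀ i, tsupport (fun x => fderiv ℝ (fun y => θ y i) x (EuclideanSpace.single i 1)) ⊆
      tsupport (fun y => θ y i) := fun i => tsupport_fderiv_apply_subset ℝ _
  have hdcs : ∀ i, HasCompactSupport
      fun x => fderiv ℝ (fun y => θ y i) x (EuclideanSpace.single i 1) :=
    fun i => (hθc i).fderiv_apply ℝ _
  have i1 : ∀ i, Integrable fun x => fderiv ℝ f x (EuclideanSpace.single i 1) * θ x i := by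
    intro i
    refine Continuous.integrable_of_hasCompactSupport (continuous_of_tsupport fun x hx => ?_)
      (hθc i).mul_left
    have hx' := hsi i (tsupport_mul_subset_right hx)
    exact ((hf' x hx').clm_apply continuousAt_const).mul (hθi i).continuous.continuousAt
  have i2 : ∀ i, Integrable
      fun x => f x * fderiv ℝ (fun y => θ y i) x (EuclideanSpace.single i 1) := by
    intro i
    refine Continuous.integrable_of_hasCompactSupport (continuous_of_tsupport fun x hx => ?_)
      (hdcs i).mul_left
    have hx' := hsi i (hdsupp i (tsupport_mul_subset_right hx))
    exact (hfO x hx').continuousAt.mul (hdc i).continuousAt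
  have i3 : ∀ i, Integrable fun x => f x * θ x i := by
    intro i
    refine Continuous.integrable_of_hasCompactSupport (continuous_of_tsupport fun x hx => ?_)
      (hθc i).mul_left
    have hx' := hsi i (tsupport_mul_subset_right hx)
    exact (hfO x hx').continuousAt.mul (hθi i).continuous.continuousAt
  have key : ∀ i, ∫ x, f x * fderiv ℝ (fun y => θ y i) x (EuclideanSpace.single i 1) =
      -∫ x, fderiv ℝ f x (EuclideanSpace.single i 1) * θ x i := fun i =>
    integral_mul_fderiv_eq_neg_fderiv_mul_of_integrable (i1 i) (i2 i) (i3 i)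
      (fun x hx => (hfO x (hsi i hx)).differentiableAt one_ne_zero)
      (fun x _ => (hθi i).differentiable one_ne_zero x)
  simp only [divergence, Finset.mul_sum]
  rw [integral_finsetSum _ fun i _ => i2 i, Finset.sum_congr rfl fun i _ => key i,
    Finset.sum_neg_distrib, ← integral_finsetSum _ fun i _ => i1 i]
  congr 2
  funext x
  conv_rhs => rw [← sum_smul_single (θ x)]
  simp [mul_comm]

/-- Integration by parts on `{ρ < 0}` against a field tangent to the level sets of `ρ`. -/
theorem setIntegral_deriv_comp_mul {V W ρ ψ : E → ℝ} {θ : E → E} {G O : Set E} (hO : IsOpen O)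
    (hG : MeasurableSet G) (hW : ContDiffOn ℝ 1 W O) (hρ : ContDiffOn ℝ 1 ρ O)
    (hθ : ContDiff ℝ 1 θ) (hc : HasCompactSupport θ) (hs : tsupport θ ⊆ O)
    (hGρ : ∀ x ∈ O, x ∈ G ↔ ρ x < 0) (hVW : ∀ x ∈ O, x ∈ G → V x = W x)
    (hρθ : ∀ x ∈ O, fderiv ℝ ρ x (θ x) = 0) (hψ : ∀ x, ψ x = fderiv ℝ W x (θ x))
    {φ : ℝ → ℝ} (hφ : ContDiff ℝ ∞ φ) :
    ∫ x in G, deriv φ (V x) * ψ x = -∫ x in G, φ (V x) * divergence θ x := by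
  have hWO : ∀ x ∈ O, ContDiffAt ℝ 1 W x := fun x hx => hW.contDiffAt (hO.mem_nhds hx)
  have hρO : ∀ x ∈ O, ContDiffAt ℝ 1 ρ x := fun x hx => hρ.contDiffAt (hO.mem_nhds hx)
  have hφ1 : ContDiff ℝ 1 φ := hφ.of_le (by norm_cast)
  have hθ0 : ∀ x, x ∉ O → θ x = 0 := fun x hx =>
    image_eq_zero_of_notMem_tsupport fun h => hx (hs h)
  have hψs : tsupport ψ ⊆ tsupport θ := by
    refine closure_mono fun x hx h => hx ?_
    rw [hψ, h, map_zero]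
  have hψc : HasCompactSupport ψ := hc.mono fun x hx h => hx (by rw [hψ, h, map_zero])
  have hψcont : Continuous ψ := continuous_of_tsupport fun x hx => by
    have hx' := hs (hψs hx)
    have h1 : ContinuousAt (fun x => fderiv ℝ W x (θ x)) x :=
      (((hWO x hx').fderiv_right (m := 0) (by simp)).continuousAt).clm_apply
        hθ.continuous.continuousAt
    rwa [← funext hψ] at h1
  have hdivc : Continuous (divergence θ) :=
    (contDiff_divergence (m := 0) (by simpa using hθ)).continuous
  have hdivcs : HasCompactSupport (divergence θ) :=
    IsCompact.of_isClosed_subset hc (isClosed_tsupport _) (tsupport_divergence_subset θ)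
  -- These functions of ρ tend pointwise to the indicator of {ρ < 0}. Their derivative along θ
  -- vanishes because θ is tangent to the levels of ρ, so no boundary term arises.
  let s : ℕ → E → ℝ := fun n x => Real.smoothTransition (-(n * ρ x))
  have hsO : ∀ n, ∀ x ∈ O, ContDiffAt ℝ 1 (s n) x := fun n x hx =>
    Real.smoothTransition.contDiffAt.comp x (contDiffAt_const.mul (hρO x hx)).neg
  have hlim : ∀ κ : ℝ → ℝ, Continuous κ → ∀ h : E → ℝ, Continuous h → HasCompactSupport h →
      tsupport h ⊆ O → Tendsto (fun n => ∫ x, s n x * (κ (W x) * h x)) atTop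
        (𝓝 (∫ x in G, κ (V x) * h x)) := by
    intro κ hκ h hh hhc hhs
    have h0 : ∀ x, x ∉ O → h x = 0 := fun x hx =>
      image_eq_zero_of_notMem_tsupport fun h => hx (hhs h)
    have hgc : Continuous fun x => κ (W x) * h x := continuous_of_tsupport fun x hx => by
      have hx' := hhs (tsupport_mul_subset_right hx)
      exact (hκ.continuousAt.comp (hWO x hx').continuousAt).mul hh.continuousAt
    have hsc : ∀ n, Continuous fun x => s n x * (κ (W x) * h x) := fun n =>
      continuous_of_tsupport fun x hx => by
        have hx' := hhs (tsupport_mul_subset_right (tsupport_mul_subset_right hx))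
        exact (hsO n x hx').continuousAt.mul hgc.continuousAt
    have hgi : Integrable fun x => κ (W x) * h x :=
      hgc.integrable_of_hasCompactSupport hhc.mul_left
    have e : ∫ x in G, κ (V x) * h x = ∫ x, G.indicator (fun x => κ (W x) * h x) x := by
      rw [integral_indicator hG]
      refine setIntegral_congr_fun hG fun x hx => ?_
      by_cases hxO : x ∈ O
      · simp only [hVW x hxO hx]
      · simp only [h0 x hxO, mul_zero]
    rw [e]
    refine tendsto_integral_of_dominated_convergence (fun x => ‖κ (W x) * h x‖)
      (fun n => (hsc n).aestronglyMeasurable) hgi.norm (fun n => ae_of_all _ fun x => ?_)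
      (ae_of_all _ fun x => ?_)
    · rw [norm_mul]
      refine mul_le_of_le_one_left (norm_nonneg _) ?_
      rw [Real.norm_of_nonneg (Real.smoothTransition.nonneg _)]
      exact Real.smoothTransition.le_one _
    · by_cases hxO : x ∈ O
      · by_cases hxG : x ∈ G
        · rw [Set.indicator_of_mem hxG]
          have hneg := (hGρ x hxO).1 hxG
          have ht : Tendsto (fun n : ℕ => -(n * ρ x)) atTop atTop := by
            have := (tendsto_natCast_atTop_atTop (R := ℝ)).atTop_mul_const (neg_pos.2 hneg)
            simpa using this
          refine tendsto_const_nhds.congr' ?_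
          filter_upwards [ht.eventually_ge_atTop 1] with n hn
          simp only [s, Real.smoothTransition.one_of_one_le hn, one_mul]
        · rw [Set.indicator_of_notMem hxG]
          have hnn : 0 ≤ ρ x := not_lt.1 fun h => hxG ((hGρ x hxO).2 h)
          refine tendsto_const_nhds.congr fun n => ?_
          simp only [s]
          rw [Real.smoothTransition.zero_of_nonpos (neg_nonpos.2 (by positivity)), zero_mul]
      · have : G.indicator (fun x => κ (W x) * h x) x = 0 := by
          by_cases hxG : x ∈ G
          · rw [Set.indicator_of_mem hxG, h0 x hxO, mul_zero]
          · exact Set.indicator_of_notMem hxG _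
        rw [this]
        simp only [h0 x hxO, mul_zero]
        exact tendsto_const_nhds
  have key : ∀ n, ∫ x, s n x * (deriv φ (W x) * ψ x) =
      -∫ x, s n x * (φ (W x) * divergence θ x) := by
    intro n
    have hf : ContDiffOn ℝ 1 (fun x => s n x * φ (W x)) O := fun x hx =>
      ((hsO n x hx).mul (hφ1.contDiffAt.comp x (hWO x hx))).contDiffWithinAt
    have h1 := integral_mul_divergence hO hf hθ hc hs
    simp only [mul_assoc] at h1
    rw [h1, neg_neg]
    refine integral_congr_ae (ae_of_all _ fun x => ?_)
    show s n x * (deriv φ (W x) * ψ x) = fderiv ℝ (fun x => s n x * φ (W x)) x (θ x)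
    by_cases hx : x ∈ O
    · have hdρ := ((hρO x hx).differentiableAt one_ne_zero).hasFDerivAt
      have hdW := ((hWO x hx).differentiableAt one_ne_zero).hasFDerivAt
      have hds : HasFDerivAt (s n) (deriv Real.smoothTransition (-(n * ρ x)) •
          -((n : ℝ) • fderiv ℝ ρ x)) x :=
        ((Real.smoothTransition.contDiff (n := 1)).differentiable
          (by simp) _).hasDerivAt.comp_hasFDerivAt x (hdρ.const_mul (n : ℝ)).neg
      have hdφ : HasFDerivAt (fun x => φ (W x)) (deriv φ (W x) • fderiv ℝ W x) x :=
        (hφ1.differentiable one_ne_zero _).hasDerivAt.comp_hasFDerivAt x hdW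
      have hd : HasFDerivAt (fun x => s n x * φ (W x)) _ x := hds.mul hdφ
      rw [hd.fderiv, hψ x]
      simp only [add_apply, smul_apply, neg_apply, smul_eq_mul, hρθ x hx]
      ring
    · rw [hψ, hθ0 x hx, map_zero, map_zero, mul_zero, mul_zero]
  have l1 := hlim (deriv φ) (hφ1.continuous_deriv le_rfl) ψ hψcont hψc (hψs.trans hs)
  have l2 := (hlim φ hφ.continuous _ hdivc hdivcs ((tsupport_divergence_subset θ).trans hs)).neg
  simp only [key] at l1
  exact tendsto_nhds_unique l1 l2

end IntegrationByParts

/-! ### Removing weights that vanish at the critical point -/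

section Reduction

variable {N : ℕ}

local notation "E" => EuclideanSpace ℝ (Fin N)

open Manifold in
theorem exists_cutoff {K O : Set E} (hK : IsCompact K) (hO : IsOpen O) (hKO : K ⊆ O) :
    ∃ χ : E → ℝ, ContDiff ℝ ∞ χ ∧ HasCompactSupport χ ∧ tsupport χ ⊆ O ∧
      (∀ᶠ x in 𝓝ˢ K, χ x = 1) ∧ ∀ x, χ x ∈ Set.Icc (0 : ℝ) 1 := by
  obtain ⟨L, hL, hKL, hLO⟩ := exists_compact_between hK hO hKO
  obtain ⟨f, hf1, hf0, hf⟩ :=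
    exists_contMDiffMap_one_nhds_of_subset_interior (n := ⊤) 𝓘(ℝ, E) hK.isClosed hKL
  have hs : tsupport f ⊆ L := closure_minimal
    (fun x hx => by by_contra h; exact hx (hf0 x h)) hL.isClosed
  exact ⟨f, f.contMDiff.contDiff, IsCompact.of_isClosed_subset hL (isClosed_tsupport _) hs,
    hs.trans hLO, hf1, hf⟩

/-- `ψ` can be integrated by parts against every derivative of a function of `V`. -/
def IsPartsPair (V : E → ℝ) (G : Set E) (ψ ψ₁ : E → ℝ) : Prop :=
  ∀ φ : ℝ → ℝ, ContDiff ℝ ∞ φ →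
    ∫ x in G, deriv φ (V x) * ψ x = -∫ x in G, φ (V x) * ψ₁ x

/-- On `O`, weights vanishing at `q` can be integrated by parts, at the cost of two derivatives. -/
def IsReducible (M : ℕ) (V : E → ℝ) (G : Set E) (q : E) (O : Set E) : Prop :=
  IsOpen O ∧ (∃ C, ∀ x ∈ G, x ∈ O → |V x| ≤ C) ∧
    ∀ m ≤ M, ∀ ψ : E → ℝ, ContDiff ℝ (m + 1 + 1 : ℕ) ψ → HasCompactSupport ψ → tsupport ψ ⊆ O →
      ψ q = 0 → ∃ ψ₁ : E → ℝ, ContDiff ℝ m ψ₁ ∧ HasCompactSupport ψ₁ ∧ tsupport ψ₁ ⊆ O ∧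
        IsPartsPair V G ψ ψ₁

theorem integrableOn_comp_mul {V h : E → ℝ} {G O : Set E} (hG : IsOpen G) (hV : ContinuousOn V G)
    {C : ℝ} (hC : ∀ x ∈ G, x ∈ O → |V x| ≤ C) {κ : ℝ → ℝ} (hκ : Continuous κ) (hh : Continuous h)
    (hc : HasCompactSupport h) (hs : tsupport h ⊆ O) :
    IntegrableOn (fun x => κ (V x) * h x) G := by
  obtain ⟨B, hB⟩ := (isCompact_Icc (a := -C) (b := C)).exists_bound_of_continuousOn hκ.continuousOn
  have hi : IntegrableOn (fun x => B * ‖h x‖) G :=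
    ((hh.integrable_of_hasCompactSupport hc).norm.const_mul B).integrableOn
  refine Integrable.mono' hi
    (((hκ.comp_continuousOn hV).mul hh.continuousOn).aestronglyMeasurable hG.measurableSet) ?_
  filter_upwards [ae_restrict_mem hG.measurableSet] with x hx
  by_cases hxO : x ∈ O
  · rw [norm_mul]
    exact mul_le_mul_of_nonneg_right (hB _ (abs_le.1 (hC x hx hxO))) (norm_nonneg _)
  · rw [image_eq_zero_of_notMem_tsupport (f := h) fun h' => hxO (hs h')]
    simp

/-- A cutoff splits the weight into pieces supported in the two sets, each still vanishing at q. The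
bound on V makes every integrand integrable, so the two identities may be added. -/
theorem IsReducible.union {M : ℕ} {V : E → ℝ} {G : Set E} {q : E} {O₁ O₂ : Set E}
    (hG : IsOpen G) (hV : ContinuousOn V G)
    (h₁ : IsReducible M V G q O₁) (h₂ : IsReducible M V G q O₂) :
    IsReducible M V G q (O₁ ∪ O₂) := by
  obtain ⟨ho₁, ⟨C₁, hC₁⟩, h₁⟩ := h₁
  obtain ⟨ho₂, ⟨C₂, hC₂⟩, h₂⟩ := h₂
  have hC : ∀ x ∈ G, x ∈ O₁ ∪ O₂ → |V x| ≤ max C₁ C₂ := by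
    rintro x hx (h | h)
    · exact (hC₁ x hx h).trans (le_max_left _ _)
    · exact (hC₂ x hx h).trans (le_max_right _ _)
  refine ⟨ho₁.union ho₂, ⟨_, hC⟩, fun m hm ψ hψ hc hs hq => ?_⟩
  have hK : IsCompact (tsupport ψ \ O₂) := IsCompact.diff hc ho₂
  have hKO : tsupport ψ \ O₂ ⊆ O₁ := fun x hx => (hs hx.1).resolve_right hx.2
  obtain ⟨χ, hχ, -, hχs, hχ1, -⟩ := exists_cutoff hK ho₁ hKO
  have hχ' : ContDiff ℝ (m + 1 + 1 : ℕ) χ := hχ.of_le (by exact_mod_cast le_top)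
  have hc₁ : ContDiff ℝ (m + 1 + 1 : ℕ) fun x => χ x * ψ x := hχ'.mul hψ
  have hc₂ : ContDiff ℝ (m + 1 + 1 : ℕ) fun x => (1 - χ x) * ψ x :=
    (contDiff_const.sub hχ').mul hψ
  obtain ⟨u₁, hu₁, huc₁, hus₁, hup₁⟩ := h₁ m hm _ hc₁ hc.mul_left
    (tsupport_mul_subset_left.trans hχs) (by simp [hq])
  obtain ⟨u₂, hu₂, huc₂, hus₂, hup₂⟩ := h₂ m hm (fun x => (1 - χ x) * ψ x) hc₂ hc.mul_left
    (fun x hx => by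
      by_contra hxO
      have hx1 : x ∈ tsupport ψ := tsupport_mul_subset_right hx
      have hx2 : ∀ᶠ y in 𝓝 x, χ y = 1 :=
        (eventually_nhdsSet_iff_forall.1 hχ1) x ⟨hx1, hxO⟩
      refine notMem_tsupport_iff_eventuallyEq.2 ?_ hx
      filter_upwards [hx2] with y hy
      simp [hy]) (by simp [hq])
  have hs₁ : tsupport u₁ ⊆ O₁ ∪ O₂ := hus₁.trans Set.subset_union_left
  have hs₂ : tsupport u₂ ⊆ O₁ ∪ O₂ := hus₂.trans Set.subset_union_right
  refine ⟨fun x => u₁ x + u₂ x, hu₁.add hu₂, huc₁.add huc₂,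
    (tsupport_add u₁ u₂).trans (Set.union_subset hs₁ hs₂), fun φ hφ => ?_⟩
  have hφ1 : ContDiff ℝ 1 φ := hφ.of_le (by norm_cast)
  have hφ' := hφ1.continuous_deriv le_rfl
  have i : ∀ {κ : ℝ → ℝ} {h : E → ℝ}, Continuous κ → Continuous h → HasCompactSupport h →
      tsupport h ⊆ O₁ ∪ O₂ → IntegrableOn (fun x => κ (V x) * h x) G :=
    fun hκ hh hc hs => integrableOn_comp_mul hG hV hC hκ hh hc hs
  have e₁ : ∀ x, deriv φ (V x) * ψ x =
      deriv φ (V x) * (χ x * ψ x) + deriv φ (V x) * ((1 - χ x) * ψ x) := fun x => by ring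
  simp only [e₁, mul_add]
  rw [integral_add (i hφ' hc₁.continuous hc.mul_left (tsupport_mul_subset_right.trans hs))
    (i hφ' hc₂.continuous hc.mul_left (tsupport_mul_subset_right.trans hs)),
    integral_add (i hφ.continuous hu₁.continuous huc₁ hs₁)
      (i hφ.continuous hu₂.continuous huc₂ hs₂), hup₁ φ hφ, hup₂ φ hφ]
  ring

theorem isReducible_empty (M : ℕ) (V : E → ℝ) (G : Set E) (q : E) : IsReducible M V G q ∅ := by
  refine ⟨isOpen_empty, ⟨0, fun x _ h => h.elim⟩, fun m _ ψ _ _ hs _ =>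
    ⟨0, contDiff_const, HasCompactSupport.zero, by simp, fun φ _ => ?_⟩⟩
  have : ψ = 0 := tsupport_eq_empty_iff.1 (Set.subset_empty_iff.1 hs)
  simp [this]

/-- Reducibility where there is a field transverse to the levels of `V` and tangent to the
boundary of `G`. -/
theorem isReducible_of_field {M : ℕ} {V W ρ : E → ℝ} {X : E → E} {G O : Set E} {q : E}
    (hO : IsOpen O) (hG : MeasurableSet G) (hC : ∃ C, ∀ x ∈ G, x ∈ O → |V x| ≤ C)
    (hW : ContDiffOn ℝ 1 W O) (hρ : ContDiffOn ℝ 1 ρ O) (hX : ContDiffOn ℝ (M + 1 : ℕ) X O)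
    (hGρ : ∀ x ∈ O, x ∈ G ↔ ρ x < 0) (hVW : ∀ x ∈ O, x ∈ G → V x = W x)
    (hρX : ∀ x ∈ O, fderiv ℝ ρ x (X x) = 0) (hWX : ∀ x ∈ O, fderiv ℝ W x (X x) = 1) :
    IsReducible M V G q O := by
  refine ⟨hO, hC, fun m hm ψ hψ hc hs _ => ?_⟩
  have hψ0 : ∀ x, x ∉ O → ψ x = 0 := fun x hx =>
    image_eq_zero_of_notMem_tsupport fun h => hx (hs h)
  have hθs : tsupport (fun x => ψ x • X x) ⊆ tsupport ψ := tsupport_smul_subset_left ψ X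
  have hθ : ContDiff ℝ (m + 1 : ℕ) fun x => ψ x • X x :=
    contDiff_of_contDiffAt_tsupport fun x hx =>
      (hψ.of_le (by exact_mod_cast Nat.le_succ _)).contDiffAt.smul
        ((hX.contDiffAt (hO.mem_nhds (hs (hθs hx)))).of_le (by
          exact_mod_cast Nat.add_le_add_right hm 1))
  have hθc : HasCompactSupport fun x => ψ x • X x := hc.smul_right
  refine ⟨divergence fun x => ψ x • X x, contDiff_divergence hθ,
    IsCompact.of_isClosed_subset hθc (isClosed_tsupport _) (tsupport_divergence_subset _),
    (tsupport_divergence_subset _).trans (hθs.trans hs), fun φ hφ => ?_⟩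
  refine setIntegral_deriv_comp_mul hO hG hW hρ (hθ.of_le (by norm_cast; omega)) hθc
    (hθs.trans hs) hGρ hVW (fun x hx => ?_) (fun x => ?_) hφ
  · rw [map_smul, hρX x hx, smul_zero]
  · by_cases hx : x ∈ O
    · rw [map_smul, hWX x hx, smul_eq_mul, mul_one]
    · simp [hψ0 x hx]

/-- Reducibility near a nondegenerate critical point. -/
theorem exists_isReducible_critical (M : ℕ) {V : E → ℝ} {G : Set E} {q : E} (hG : IsOpen G)
    (hV : ContDiffOn ℝ ∞ V G) (hq : q ∈ G) (h1 : fderiv ℝ V q = 0)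
    (hH : Function.Injective (fderiv ℝ (fderiv ℝ V) q)) :
    ∃ O, q ∈ O ∧ IsReducible M V G q O := by
  obtain ⟨g, hg, hgV⟩ := exists_contDiff_eventuallyEq hG hV hq
  have hd1 : fderiv ℝ g =ᶠ[𝓝 q] fderiv ℝ V := hgV.fderiv
  have hd2 : fderiv ℝ (fderiv ℝ g) q = fderiv ℝ (fderiv ℝ V) q := hd1.fderiv_eq
  have hg' : ContDiff ℝ ∞ (fderiv ℝ g) := hg.fderiv_right (by simp)
  obtain ⟨b, hb, hgb, hb0⟩ := exists_hadamard (n := ⊤) (by simpa using hg') q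
  have hrank : Module.finrank ℝ E = Module.finrank ℝ (E →L[ℝ] ℝ) := by
    rw [← LinearMap.toContinuousLinearMap.finrank_eq, Module.finrank_linearMap,
      Module.finrank_self, mul_one]
  have hflip : Function.Injective (b q).flip := by
    rw [hb0, hd2]
    have hs : IsSymmSndFDerivAt ℝ V q := ContDiffAt.isSymmSndFDerivAt
      ((hV.contDiffAt (hG.mem_nhds hq)).of_le (m := 2) (by norm_cast)) (by simp)
    have : (fderiv ℝ (fderiv ℝ V) q).flip = fderiv ℝ (fderiv ℝ V) q := by
      ext u w
      rw [ContinuousLinearMap.flip_apply, hs]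
    rwa [this]
  let He : E ≃L[ℝ] (E →L[ℝ] ℝ) := (LinearEquiv.ofInjectiveOfFinrankEq
    ((b q).flip : E →ₗ[ℝ] E →L[ℝ] ℝ) hflip hrank).toContinuousLinearEquiv
  have hHe : (He : E →L[ℝ] E →L[ℝ] ℝ) = (b q).flip := by ext; rfl
  have hbf : ContDiff ℝ ∞ fun x => (b x).flip := by
    rw [contDiff_clm_apply_iff]
    intro u
    rw [contDiff_clm_apply_iff]
    intro w
    exact (hb.clm_apply contDiff_const).clm_apply contDiff_const
  have hinv : ∀ᶠ x in 𝓝 q, (b x).flip ∈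
      Set.range ((↑) : (E ≃L[ℝ] (E →L[ℝ] ℝ)) → E →L[ℝ] (E →L[ℝ] ℝ)) := by
    refine hbf.continuous.continuousAt.eventually_mem ?_
    rw [← hHe]
    exact ContinuousLinearEquiv.nhds He
  have hbd : ∀ᶠ x in 𝓝 q, |V x| < |V q| + 1 :=
    ((hV.contDiffAt (hG.mem_nhds hq)).continuousAt.abs).eventually_lt continuousAt_const
      (by simp)
  obtain ⟨O, hOp, hO, hqO⟩ := eventually_nhds_iff.1
    ((hG.eventually_mem hq).and (hinv.and (hbd.and hd1)))
  refine ⟨O, hqO, hO, ⟨_, fun x _ hx => (hOp x hx).2.2.1.le⟩, fun m _ ψ hψ hc hs hψ0 => ?_⟩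
  -- Of the two derivatives lost, one goes into this factorisation and one into the divergence.
  obtain ⟨a, ha, hψa, -⟩ := exists_hadamard (n := (m + 1 : ℕ)) (by exact_mod_cast hψ) q
  obtain ⟨χ, hχ, hχc, hχs, hχ1, -⟩ := exists_cutoff hc.isCompact hO hs
  -- Near q, dV(x)w = b(x)(x - q)w and ψ(x) = a(x)(x - q). Solving (b x).flip w = a(x), possible by
  -- nondegeneracy, gives dV(x)w = ψ(x); χ is 1 on the support of ψ.
  let θ : E → E := fun x => χ x • ((b x).flip.inverse (a x))
  have hθs : tsupport θ ⊆ tsupport χ := tsupport_smul_subset_left χ _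
  have hθ : ContDiff ℝ (m + 1 : ℕ) θ := by
    refine contDiff_of_contDiffAt_tsupport fun x hx => ?_
    obtain ⟨ex, hex⟩ := (hOp x (hχs (hθs hx))).2.1
    have hi : ContDiffAt ℝ (m + 1 : ℕ) (fun x => (b x).flip.inverse) x := by
      refine ContDiffAt.comp x (g := ContinuousLinearMap.inverse) ?_
        (hbf.of_le (by exact_mod_cast le_top)).contDiffAt
      rw [← hex]
      exact contDiffAt_map_inverse ex
    exact (hχ.of_le (by exact_mod_cast le_top)).contDiffAt.smul (hi.clm_apply ha.contDiffAt)
  have hθc : HasCompactSupport θ := hχc.smul_right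
  refine ⟨divergence θ, contDiff_divergence hθ,
    IsCompact.of_isClosed_subset hθc (isClosed_tsupport _) (tsupport_divergence_subset _),
    (tsupport_divergence_subset _).trans (hθs.trans hχs), fun φ hφ => ?_⟩
  have hOG : O ⊆ G := fun x hx => (hOp x hx).1
  refine setIntegral_deriv_comp_mul (W := V) (ρ := fun _ => -1) hO hG.measurableSet
    ((hV.of_le (by norm_cast)).mono hOG) contDiffOn_const (hθ.of_le (by norm_cast; omega)) hθc
    (hθs.trans hχs) (fun x hx => by simp [hOG hx]) (fun _ _ _ => rfl) (fun x _ => by simp)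
    (fun x => ?_) hφ
  by_cases hx : x ∈ O
  · obtain ⟨ex, hex⟩ := (hOp x hx).2.1
    have h2 : fderiv ℝ V x ((b x).flip.inverse (a x)) = ψ x := by
      rw [← (hOp x hx).2.2.2, hgb x, hd1.eq_of_nhds, h1, zero_add,
        ← ContinuousLinearMap.flip_apply, hψa x, hψ0, zero_add]
      congr 1
      rw [← hex, ContinuousLinearMap.inverse_equiv]
      exact ex.apply_symm_apply (a x)
    simp only [θ, map_smul, h2, smul_eq_mul]
    by_cases hxs : x ∈ tsupport ψ
    · rw [(eventually_nhdsSet_iff_forall.1 hχ1 x hxs).self_of_nhds, one_mul]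
    · rw [image_eq_zero_of_notMem_tsupport hxs, mul_zero]
  · rw [image_eq_zero_of_notMem_tsupport (f := ψ) fun h => hx (hs h),
      image_eq_zero_of_notMem_tsupport (f := θ) fun h => hx (hχs (hθs h)), map_zero]

end Reduction

/-! ### Covering the critical level -/

section Cover

variable {N : ℕ}

local notation "E" => EuclideanSpace ℝ (Fin N)

/-- A fixed vector with nonzero derivative of V, divided by that derivative, is the transverse
field. The point is interior, so ρ = -1 expresses the absence of a boundary. -/
theorem exists_isReducible_regular (M : ℕ) {V : E → ℝ} {G : Set E} {q b : E} (hG : IsOpen G)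
    (hV : ContDiffOn ℝ ∞ V G) (hb : b ∈ G) (h1 : fderiv ℝ V b ≠ 0) :
    ∃ O, b ∈ O ∧ IsReducible M V G q O := by
  have hVG : ∀ x ∈ G, ContDiffAt ℝ ∞ V x := fun x hx => hV.contDiffAt (hG.mem_nhds hx)
  have hVG' : ∀ x ∈ G, ContDiffAt ℝ ∞ (fderiv ℝ V) x := fun x hx =>
    (hVG x hx).fderiv_right (by simp)
  obtain ⟨e, he⟩ : ∃ e, fderiv ℝ V b e ≠ 0 := by
    by_contra! h
    exact h1 (ContinuousLinearMap.ext h)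
  have hne : ∀ᶠ x in 𝓝 b, fderiv ℝ V x e ≠ 0 :=
    ((hVG' b hb).continuousAt.clm_apply continuousAt_const).eventually_ne he
  have hbd : ∀ᶠ x in 𝓝 b, |V x| < |V b| + 1 :=
    ((hVG b hb).continuousAt.abs).eventually_lt continuousAt_const (by simp)
  obtain ⟨O, hOp, hO, hbO⟩ := eventually_nhds_iff.1 ((hG.eventually_mem hb).and (hne.and hbd))
  refine ⟨O, hbO, isReducible_of_field (W := V) (ρ := fun _ => -1)
    (X := fun x => (fderiv ℝ V x e)⁻¹ • e) hO hG.measurableSet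
    ⟨_, fun x _ hx => (hOp x hx).2.2.le⟩ (fun x hx => ?_) contDiffOn_const (fun x hx => ?_)
    (fun x hx => by simp [(hOp x hx).1]) (fun _ _ _ => rfl) (fun x _ => by simp) fun x hx => ?_⟩
  · exact ((hVG x (hOp x hx).1).of_le (by norm_cast)).contDiffWithinAt
  · exact ((((hVG' x (hOp x hx).1).clm_apply contDiffAt_const).inv (hOp x hx).2.1).smul
      contDiffAt_const).contDiffWithinAt.of_le (by exact_mod_cast le_top)
  · rw [map_smul, smul_eq_mul, inv_mul_cancel₀ (hOp x hx).2.1]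

/-- Independence of dW and dρ gives two vectors on which they have nonzero 2×2 determinant D.
Cramer's rule in their span then solves dW(X) = 1, dρ(X) = 0 near b. -/
theorem exists_isReducible_transverse (M : ℕ) {V : E → ℝ} {G : Set E} {q b : E} (hG : IsOpen G)
    (h : IsTransverseAt V G b) : ∃ O, b ∈ O ∧ IsReducible M V G q O := by
  obtain ⟨W, ρ, hW, hρ, hVW, hGρ, hli⟩ := h
  rw [LinearIndependent.pair_iff] at hli
  obtain ⟨e₂, he₂⟩ : ∃ e, fderiv ℝ ρ b e ≠ 0 := by
    by_contra! h
    have := hli 0 1 (by rw [zero_smul, one_smul, zero_add]; exact ContinuousLinearMap.ext h)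
    exact one_ne_zero this.2
  obtain ⟨e₁, he₁⟩ : ∃ e, fderiv ℝ W b e * fderiv ℝ ρ b e₂ - fderiv ℝ W b e₂ * fderiv ℝ ρ b e
      ≠ 0 := by
    by_contra! h
    refine he₂ (hli (fderiv ℝ ρ b e₂) (-fderiv ℝ W b e₂) (ContinuousLinearMap.ext fun e => ?_)).1
    simp only [add_apply, smul_apply, smul_eq_mul, zero_apply]
    linarith [h e]
  let D : E → ℝ := fun x =>
    fderiv ℝ W x e₁ * fderiv ℝ ρ x e₂ - fderiv ℝ W x e₂ * fderiv ℝ ρ x e₁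
  have hWm : ContDiffAt ℝ ((M + 1 + 1 : ℕ) : ℕ∞ω) W b := hW.of_le (by exact_mod_cast le_top)
  have hρm : ContDiffAt ℝ ((M + 1 + 1 : ℕ) : ℕ∞ω) ρ b := hρ.of_le (by exact_mod_cast le_top)
  have hW'b : ContinuousAt (fderiv ℝ W) b := (hW.fderiv_right (m := 0) (by simp)).continuousAt
  have hρ'b : ContinuousAt (fderiv ℝ ρ) b := (hρ.fderiv_right (m := 0) (by simp)).continuousAt
  have hD : ∀ᶠ x in 𝓝 b, D x ≠ 0 := ContinuousAt.eventually_ne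
    (((hW'b.clm_apply continuousAt_const).mul (hρ'b.clm_apply continuousAt_const)).sub
      ((hW'b.clm_apply continuousAt_const).mul (hρ'b.clm_apply continuousAt_const))) he₁
  have hbd : ∀ᶠ x in 𝓝 b, |W x| < |W b| + 1 :=
    (hW.continuousAt.abs).eventually_lt continuousAt_const (by simp)
  obtain ⟨O, hOp, hO, hbO⟩ := eventually_nhds_iff.1 (((hWm.eventually (by simp)).and
    (hρm.eventually (by simp))).and ((eventually_nhdsWithin_iff.1 hVW).and
      (hGρ.and (hD.and hbd))))
  have hW' : ∀ x ∈ O, ContDiffAt ℝ (M + 1 : ℕ) (fderiv ℝ W) x := fun x hx =>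
    (hOp x hx).1.1.fderiv_right (by norm_cast)
  have hρ' : ∀ x ∈ O, ContDiffAt ℝ (M + 1 : ℕ) (fderiv ℝ ρ) x := fun x hx =>
    (hOp x hx).1.2.fderiv_right (by norm_cast)
  refine ⟨O, hbO, isReducible_of_field (W := W) (ρ := ρ)
    (X := fun x => (D x)⁻¹ • (fderiv ℝ ρ x e₂ • e₁ - fderiv ℝ ρ x e₁ • e₂)) hO hG.measurableSet
    ⟨|W b| + 1, fun x hxG hx => ?_⟩ (fun x hx => ?_) (fun x hx => ?_) (fun x hx => ?_)
    (fun x hx => (hOp x hx).2.2.1) (fun x hx => (hOp x hx).2.1) (fun x hx => ?_) fun x hx => ?_⟩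
  · rw [(hOp x hx).2.1 hxG]
    exact (hOp x hx).2.2.2.2.le
  · exact ((hOp x hx).1.1.of_le (by norm_cast; omega)).contDiffWithinAt
  · exact ((hOp x hx).1.2.of_le (by norm_cast; omega)).contDiffWithinAt
  · have c := fun e => (hW' x hx).clm_apply (contDiffAt_const (c := e))
    have d := fun e => (hρ' x hx).clm_apply (contDiffAt_const (c := e))
    exact ((((c e₁).mul (d e₂)).sub ((c e₂).mul (d e₁))).inv (hOp x hx).2.2.2.1).smul
      (((d e₂).smul contDiffAt_const).sub ((d e₁).smul contDiffAt_const)) |>.contDiffWithinAt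
  · simp only [map_smul, map_sub, smul_eq_mul]
    ring
  · have : D x ≠ 0 := (hOp x hx).2.2.2.1
    simp only [map_smul, map_sub, smul_eq_mul]
    rw [inv_mul_eq_one₀ this]
    simp only [D]
    ring

/-- The points at which levels of `V` near zero accumulate. -/
theorem exists_isCompact_cluster {V : E → ℝ} {G : Set E} {δ : ℝ} (hδ : 0 < δ)
    (hb : Bornology.IsBounded {q ∈ G | |V q| ≤ δ}) :
    ∃ K : Set E, IsCompact K ∧ (∀ x ∈ G, V x = 0 → x ∈ K) ∧
      (∀ b ∈ K, MapClusterPt 0 (𝓝[G] b) V) ∧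
      ∀ O, IsOpen O → K ⊆ O → ∃ ε > 0, {x ∈ G | |V x| < ε} ⊆ O := by
  -- K is the intersection of these decreasing compact sets, so any open set containing K already
  -- contains one of them.
  let A : ℕ → Set E := fun n => closure {x ∈ G | |V x| < δ / (n + 1)}
  have hanti : Antitone A := by
    intro n m hnm
    refine closure_mono fun x hx => ⟨hx.1, hx.2.trans_le ?_⟩
    gcongr
  have hAc : ∀ n, IsCompact (A n) := fun n =>
    (hb.subset fun x hx => ⟨hx.1, hx.2.le.trans (div_le_self hδ.le (by
      have := n.cast_nonneg (α := ℝ); linarith))⟩).isCompact_closure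
  refine ⟨⋂ n, A n, (hAc 0).of_isClosed_subset (isClosed_iInter fun n => isClosed_closure)
    (Set.iInter_subset A 0), fun x hx h0 => Set.mem_iInter.2 fun n => subset_closure ⟨hx, ?_⟩,
    fun b hbK => ?_, fun O hO hK => ?_⟩
  · rw [h0, abs_zero]; positivity
  · rw [mapClusterPt_iff_frequently]
    intro s hs
    obtain ⟨ε, hε, hεs⟩ := Metric.mem_nhds_iff.1 hs
    obtain ⟨n, hn⟩ := exists_nat_gt (δ / ε)
    have hn1 : δ / (n + 1) < ε := by
      rw [div_lt_iff₀ (by positivity)]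
      rw [div_lt_iff₀ hε] at hn
      nlinarith
    have h1 : b ∈ closure {x ∈ G | |V x| < δ / (n + 1)} := Set.mem_iInter.1 hbK n
    rw [mem_closure_iff_frequently] at h1
    rw [frequently_nhdsWithin_iff]
    refine h1.mono fun x hx => ⟨hεs ?_, hx.1⟩
    rw [Metric.mem_ball, dist_zero_right, Real.norm_eq_abs]
    exact hx.2.trans hn1
  · obtain ⟨n, hn⟩ := exists_subset_nhds_of_isCompact' (directed_of_isDirected_le hanti) hAc
      (fun n => isClosed_closure) fun x hx => hO.mem_nhds (hK hx)
    exact ⟨δ / (n + 1), by positivity, subset_closure.trans hn⟩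

/-- Compact induction over the three kinds of point: the critical point, regular interior points,
and boundary points approached by levels near zero, where transversality is assumed. -/
theorem exists_isReducible_cover (M : ℕ) {V : E → ℝ} {G : Set E} {q : E} (hG : IsOpen G)
    (hV : ContDiffOn ℝ ∞ V G) (hq : q ∈ G) (hcrit : ∀ x ∈ G, fderiv ℝ V x = 0 ↔ x = q)
    (hdet : (hessian V q).det ≠ 0)
    (hreg : ∀ b ∈ frontier G, MapClusterPt 0 (𝓝[G] b) V → IsTransverseAt V G b)
    {K : Set E} (hK : IsCompact K) (hKc : ∀ b ∈ K, MapClusterPt 0 (𝓝[G] b) V) :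
    ∃ O, K ⊆ O ∧ IsReducible M V G q O := by
  refine hK.induction_on (p := fun s => ∃ O, s ⊆ O ∧ IsReducible M V G q O)
    ⟨∅, subset_rfl, isReducible_empty M V G q⟩ ?_ ?_ fun b hb => ?_
  · rintro s t hst ⟨O, htO, hO⟩
    exact ⟨O, hst.trans htO, hO⟩
  · rintro s t ⟨O₁, hs, h₁⟩ ⟨O₂, ht, h₂⟩
    exact ⟨O₁ ∪ O₂, Set.union_subset_union hs ht, h₁.union hG hV.continuousOn h₂⟩
  · obtain ⟨O, hbO, hO⟩ : ∃ O, b ∈ O ∧ IsReducible M V G q O := by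
      by_cases hbG : b ∈ G
      · by_cases hbq : fderiv ℝ V b = 0
        · rw [hcrit b hbG] at hbq
          subst hbq
          exact exists_isReducible_critical M hG hV hbG ((hcrit b hbG).2 rfl)
            (injective_fderiv_fderiv ((hV.contDiffAt (hG.mem_nhds hbG)).of_le (by norm_cast)) hdet)
        · exact exists_isReducible_regular M hG hV hbG hbq
      · refine exists_isReducible_transverse M hG (hreg b ⟨?_, ?_⟩ (hKc b hb))
        · rw [mem_closure_iff_nhdsWithin_neBot]
          exact (hKc b hb).neBot.mono inf_le_right |>.of_map
        · rwa [hG.interior_eq]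
    exact ⟨O, mem_nhdsWithin_of_mem_nhds (hO.1.mem_nhds hbO), O, subset_rfl, hO⟩

end Cover

/-! ### Derivatives of sublevel integrals -/

section SublevelDerivative

variable {M : Type*} [MeasurableSpace M] {μ : Measure M} {Q ψ ψ₁ : M → ℝ}

theorem tendsto_smoothTransition_heaviside (t : ℝ) :
    Tendsto (fun n : ℕ => Real.smoothTransition (n * t)) atTop (𝓝 (heaviside t)) := by
  rcases le_or_gt t 0 with h | h
  · rw [heaviside_of_nonpos h]
    refine tendsto_const_nhds.congr fun n => ?_
    rw [Real.smoothTransition.zero_of_nonpos (mul_nonpos_of_nonneg_of_nonpos n.cast_nonneg h)]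
  · rw [heaviside_of_pos h]
    refine tendsto_const_nhds.congr' ?_
    filter_upwards [((tendsto_natCast_atTop_atTop (R := ℝ)).atTop_mul_const h).eventually_ge_atTop
      1] with n hn
    rw [Real.smoothTransition.one_of_one_le hn]

theorem abs_smoothTransition_le (t : ℝ) : |Real.smoothTransition t| ≤ 1 := by
  rw [abs_of_nonneg (Real.smoothTransition.nonneg _)]
  exact Real.smoothTransition.le_one _

theorem intervalIntegrable_sublevelIntegral [SFinite μ] (hQ : AEMeasurable Q μ)
    (hψ : Integrable ψ μ) (u v : ℝ) :
    IntervalIntegrable (sublevelIntegral μ Q ψ) volume u v := by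
  refine (intervalIntegrable_const (c := ∫ x, |ψ x| ∂μ)).mono_fun
    (measurable_sublevelIntegral hQ hψ.aestronglyMeasurable).aestronglyMeasurable
    (ae_of_all _ fun t => ?_)
  exact (abs_sublevelIntegral_le hψ t).trans (le_abs_self _)

theorem intervalIntegral_sublevelIntegral [SFinite μ] (hQ : AEMeasurable Q μ)
    (hψ : Integrable ψ μ) (u v : ℝ) :
    ∫ t in u..v, sublevelIntegral μ Q ψ t =
      ∫ x, (∫ t in u..v, heaviside (t - Q x)) * ψ x ∂μ := by
  unfold sublevelIntegral
  rw [intervalIntegral_integral_swap]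
  · simp only [intervalIntegral.integral_mul_const]
  · have : IsFiniteMeasure (volume.restrict (Set.uIoc u v)) := by
      unfold Set.uIoc; infer_instance
    have h1 : Integrable (fun z : ℝ × M => (1 : ℝ) * ψ z.2)
        ((volume.restrict (Set.uIoc u v)).prod μ) := (integrable_const (1 : ℝ)).mul_prod hψ
    simp only [one_mul] at h1
    refine h1.bdd_mul (c := 1) ?_ (ae_of_all _ fun z => abs_heaviside_le _)
    exact (measurable_heaviside.comp_aemeasurable
      (measurable_fst.aemeasurable.sub hQ.comp_snd)).aestronglyMeasurable

/-- If `ψ` can be integrated by parts into `ψ₁`, then `ψ₁` gives the derivative of the sublevel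
integrals of `ψ`. -/
theorem sublevelIntegral_sub_eq [SFinite μ] (hQ : AEMeasurable Q μ) (hψ : Integrable ψ μ)
    (hψ₁ : Integrable ψ₁ μ)
    (h : ∀ φ : ℝ → ℝ, ContDiff ℝ ∞ φ →
      ∫ x, deriv φ (Q x) * ψ x ∂μ = -∫ x, φ (Q x) * ψ₁ x ∂μ) (u v : ℝ) :
    sublevelIntegral μ Q ψ v - sublevelIntegral μ Q ψ u =
      ∫ t in u..v, sublevelIntegral μ Q ψ₁ t := by
  let s : ℕ → ℝ → ℝ := fun n t => Real.smoothTransition (n * t)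
  have hs : ∀ n, ContDiff ℝ ∞ (s n) := fun n =>
    Real.smoothTransition.contDiff.comp (contDiff_const.mul contDiff_id)
  choose S hS hSd using fun n => exists_contDiff_primitive (hs n)
  -- φ_n' tends to Θ(v - t) - Θ(u - t), while -φ_n(t) is the integral of the smoothed step Θ(τ - t)
  -- over τ from u to v. The parts identity for φ_n passes to the limit on both sides.
  let φ : ℕ → ℝ → ℝ := fun n t => S n (u - t) - S n (v - t)
  have hφ : ∀ n, ContDiff ℝ ∞ (φ n) := fun n =>
    ((hS n).comp (contDiff_const.sub contDiff_id)).sub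
      ((hS n).comp (contDiff_const.sub contDiff_id))
  have hφd : ∀ n t, deriv (φ n) t = s n (v - t) - s n (u - t) := by
    intro n t
    have h1 : ∀ c, HasDerivAt (fun t => S n (c - t)) (-s n (c - t)) t := fun c =>
      ((hSd n (c - t)).comp t ((hasDerivAt_id t).const_sub c)).congr_deriv (by simp)
    have h2 : HasDerivAt (φ n) _ t := (h1 u).sub (h1 v)
    rw [h2.deriv]; ring
  have hφi : ∀ n t, -φ n t = ∫ τ in u..v, s n (τ - t) := by
    intro n t
    rw [intervalIntegral.integral_eq_sub_of_hasDerivAt (f := fun τ => S n (τ - t))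
      (f' := fun τ => s n (τ - t)) (fun τ _ => ((hSd n (τ - t)).comp τ ((hasDerivAt_id τ).sub_const t)).congr_deriv (by simp))
      (((hs n).continuous.comp (continuous_id.sub continuous_const)).intervalIntegrable _ _)]
    simp only [φ]; ring
  have hm : ∀ c : ℝ, AEMeasurable (fun x => c - Q x) μ := fun c => hQ.const_sub c
  have l1 : Tendsto (fun n => ∫ x, deriv (φ n) (Q x) * ψ x ∂μ) atTop
      (𝓝 (sublevelIntegral μ Q ψ v - sublevelIntegral μ Q ψ u)) := by
    have e : sublevelIntegral μ Q ψ v - sublevelIntegral μ Q ψ u =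
        ∫ x, (heaviside (v - Q x) - heaviside (u - Q x)) * ψ x ∂μ := by
      simp only [sub_mul]
      rw [integral_sub (integrable_heaviside_mul hQ hψ v) (integrable_heaviside_mul hQ hψ u)]
      rfl
    rw [e]
    simp only [hφd]
    refine tendsto_integral_of_dominated_convergence (fun x => 2 * |ψ x|) (fun n => ?_)
      (hψ.abs.const_mul 2) (fun n => ae_of_all _ fun x => ?_) (ae_of_all _ fun x => ?_)
    · exact (((hs n).continuous.measurable.comp_aemeasurable (hm v)).sub
        ((hs n).continuous.measurable.comp_aemeasurable (hm u))).aestronglyMeasurable.mul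
          hψ.aestronglyMeasurable
    · rw [norm_mul, Real.norm_eq_abs, Real.norm_eq_abs]
      refine mul_le_mul_of_nonneg_right ?_ (abs_nonneg _)
      have := abs_sub (s n (v - Q x)) (s n (u - Q x))
      have h1 := abs_smoothTransition_le (n * (v - Q x))
      have h2 := abs_smoothTransition_le (n * (u - Q x))
      simp only [s] at this ⊢
      linarith
    · exact ((tendsto_smoothTransition_heaviside _).sub
        (tendsto_smoothTransition_heaviside _)).mul_const _
  have l2 : Tendsto (fun n => -∫ x, φ n (Q x) * ψ₁ x ∂μ) atTop
      (𝓝 (∫ t in u..v, sublevelIntegral μ Q ψ₁ t)) := by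
    rw [intervalIntegral_sublevelIntegral hQ hψ₁]
    simp only [← integral_neg, ← neg_mul]
    refine tendsto_integral_of_dominated_convergence (fun x => |v - u| * |ψ₁ x|) (fun n => ?_)
      (hψ₁.abs.const_mul _) (fun n => ae_of_all _ fun x => ?_) (ae_of_all _ fun x => ?_)
    · exact ((hφ n).continuous.neg.measurable.comp_aemeasurable hQ).aestronglyMeasurable.mul
        hψ₁.aestronglyMeasurable
    · rw [norm_mul, Real.norm_eq_abs, Real.norm_eq_abs, hφi]
      refine mul_le_mul_of_nonneg_right ?_ (abs_nonneg _)
      have := intervalIntegral.norm_integral_le_of_norm_le_const (a := u) (b := v) (C := 1)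
        (f := fun τ => s n (τ - Q x)) fun τ _ => abs_smoothTransition_le _
      simpa using this
    · simp only [hφi]
      refine Tendsto.mul_const _ ?_
      refine intervalIntegral.tendsto_integral_filter_of_dominated_convergence (fun _ => 1)
        (Eventually.of_forall fun n => ?_) (Eventually.of_forall fun n => ae_of_all _ fun τ _ =>
          abs_smoothTransition_le _) intervalIntegrable_const (ae_of_all _ fun τ _ =>
          tendsto_smoothTransition_heaviside _)
      exact ((hs n).continuous.comp (continuous_id.sub continuous_const)).aestronglyMeasurable
  have key : ∀ n, ∫ x, deriv (φ n) (Q x) * ψ x ∂μ = -∫ x, φ n (Q x) * ψ₁ x ∂μ := fun n =>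
    h _ (hφ n)
  simp only [key] at l1
  exact tendsto_nhds_unique l1 l2

theorem sublevelIntegral_add_const_mul {φ : M → ℝ} (hQ : AEMeasurable Q μ) (hψ : Integrable ψ μ)
    (hφ : Integrable φ μ) (c v : ℝ) :
    sublevelIntegral μ Q (fun x => ψ x + c * φ x) v =
      sublevelIntegral μ Q ψ v + c * sublevelIntegral μ Q φ v := by
  unfold sublevelIntegral
  rw [← integral_const_mul, ← integral_add (integrable_heaviside_mul hQ hψ v)
    ((integrable_heaviside_mul hQ hφ v).const_mul c)]
  congr 1; funext x; ring

theorem continuous_sublevelIntegral_of_sub_eq [SFinite μ] (hQ : AEMeasurable Q μ)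
    (hψ₁ : Integrable ψ₁ μ)
    (h : ∀ u v, sublevelIntegral μ Q ψ v - sublevelIntegral μ Q ψ u =
      ∫ t in u..v, sublevelIntegral μ Q ψ₁ t) : Continuous (sublevelIntegral μ Q ψ) := by
  have e : sublevelIntegral μ Q ψ = fun v =>
      (∫ t in (0)..v, sublevelIntegral μ Q ψ₁ t) + sublevelIntegral μ Q ψ 0 := by
    funext v; rw [← h]; ring
  rw [e]
  exact (intervalIntegral.continuous_primitive
    (fun a b => intervalIntegrable_sublevelIntegral hQ hψ₁ a b) 0).add continuous_const

theorem hasDerivAt_sublevelIntegral_of_sub_eq [SFinite μ] (hQ : AEMeasurable Q μ)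
    (hψ₁ : Integrable ψ₁ μ)
    (h : ∀ u v, sublevelIntegral μ Q ψ v - sublevelIntegral μ Q ψ u =
      ∫ t in u..v, sublevelIntegral μ Q ψ₁ t) {v : ℝ}
    (hc : ContinuousAt (sublevelIntegral μ Q ψ₁) v) :
    HasDerivAt (sublevelIntegral μ Q ψ) (sublevelIntegral μ Q ψ₁ v) v := by
  have e : sublevelIntegral μ Q ψ = fun v =>
      (∫ t in (0)..v, sublevelIntegral μ Q ψ₁ t) + sublevelIntegral μ Q ψ 0 := by
    funext v; rw [← h]; ring
  rw [e]
  exact (intervalIntegral.integral_hasDerivAt_right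
    (intervalIntegrable_sublevelIntegral hQ hψ₁ 0 v)
    ((measurable_sublevelIntegral hQ hψ₁.aestronglyMeasurable).stronglyMeasurable
      |>.stronglyMeasurableAtFilter) hc).add_const _

end SublevelDerivative

/-! ### Orders of the explicit singularities -/

theorem polyBigO_singPow {a : ℝ} (ha : 0 ≤ a) : PolyBigO a (singPow a) := by
  refine PolyBigO.of_isBigO fun ε hε => ?_
  have h : singPow a =O[𝓝[≠] (0 : ℝ)] fun v : ℝ => |v| ^ a := by
    refine Asymptotics.IsBigO.of_bound |Real.Gamma (a + 1)|⁻¹ (Eventually.of_forall fun v => ?_)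
    rw [singPow, Real.norm_eq_abs, abs_mul, abs_div, Real.norm_of_nonneg (by positivity),
      div_eq_inv_mul, ← mul_assoc]
    refine mul_le_mul ?_ (Real.abs_rpow_le_abs_rpow v a) (abs_nonneg _) (by positivity)
    exact mul_le_of_le_one_left (by positivity) (abs_heaviside_le v)
  exact h.trans (isBigO_rpow_of_le (by linarith))

theorem isBigO_log_abs {ε : ℝ} (hε : 0 < ε) :
    (fun v : ℝ => Real.log |v|) =O[𝓝[≠] (0 : ℝ)] fun v : ℝ => |v| ^ (-ε) := by
  have h := (isLittleO_abs_log_rpow_rpow_nhdsGT_zero (s := -ε) 1 (by linarith)).isBigO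
  have ht : Tendsto (fun v : ℝ => |v|) (𝓝[≠] 0) (𝓝[>] 0) := by
    refine tendsto_nhdsWithin_of_tendsto_nhds_of_eventually_within _ ?_ ?_
    · have : Tendsto (fun v : ℝ => |v|) (𝓝 0) (𝓝 |0|) := continuous_abs.tendsto 0
      rw [abs_zero] at this
      exact this.mono_left nhdsWithin_le_nhds
    · filter_upwards [self_mem_nhdsWithin] with v hv
      exact abs_pos.2 hv
  have h2 := h.comp_tendsto ht
  refine (Asymptotics.IsBigO.of_norm_left ?_)
  simpa [Function.comp_def] using h2

/-- The logarithm costs an arbitrarily small power; this is what the ε in the error allows for. -/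
theorem polyBigO_singLog (a : ℝ) : PolyBigO a (singLog a) := by
  refine PolyBigO.of_isBigO fun ε hε => ?_
  have h1 : (fun v : ℝ => v ^ a) =O[𝓝[≠] (0 : ℝ)] fun v : ℝ => |v| ^ a := by
    refine Asymptotics.IsBigO.of_bound 1 (Eventually.of_forall fun v => ?_)
    rw [one_mul, Real.norm_of_nonneg (by positivity : (0 : ℝ) ≤ |v| ^ a)]
    exact Real.abs_rpow_le_abs_rpow v a
  have h2 := (h1.mul (isBigO_log_abs hε)).const_mul_left (Real.pi⁻¹ / Real.Gamma (a + 1))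
  refine (h2.congr_left fun v => ?_).congr' EventuallyEq.rfl ?_
  · simp only [singLog]; ring
  · filter_upwards [self_mem_nhdsWithin] with v hv
    rw [← Real.rpow_add (abs_pos.2 hv), sub_eq_add_neg]

theorem polyBigO_modelSing (p k : ℕ) : PolyBigO (((p : ℝ) + k) / 2) (modelSing p k) := by
  have ha : 0 ≤ ((p : ℝ) + k) / 2 := by positivity
  unfold modelSing
  split_ifs
  · exact (polyBigO_singPow ha).const_mul _
  · have := ((polyBigO_singPow ha).comp_mul (c := -1) (by norm_num))
    simp only [neg_one_mul] at this
    exact this.const_mul _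
  · exact (polyBigO_singLog _).const_mul _

/-! ### Comparison with one reference weight -/

section Expansion

variable {N : ℕ}

local notation "E" => EuclideanSpace ℝ (Fin N)

variable {V : EuclideanSpace ℝ (Fin N) → ℝ} {G O : Set (EuclideanSpace ℝ (Fin N))}
  {q : EuclideanSpace ℝ (Fin N)} {M : ℕ}

theorem IsReducible.exists_sub_eq (hG : IsOpen G) (hV : ContinuousOn V G)
    (hO : IsReducible M V G q O) {m : ℕ} (hm : m ≤ M) {ψ : E → ℝ}
    (hψ : ContDiff ℝ (m + 1 + 1 : ℕ) ψ) (hc : HasCompactSupport ψ) (hs : tsupport ψ ⊆ O)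
    (hq : ψ q = 0) :
    ∃ ψ₁ : E → ℝ, ContDiff ℝ m ψ₁ ∧ HasCompactSupport ψ₁ ∧ tsupport ψ₁ ⊆ O ∧
      ∀ u v, sublevelIntegral (volume.restrict G) V ψ v -
        sublevelIntegral (volume.restrict G) V ψ u =
        ∫ t in u..v, sublevelIntegral (volume.restrict G) V ψ₁ t := by
  obtain ⟨ψ₁, h1, h2, h3, h4⟩ := hO.2.2 m hm ψ hψ hc hs hq
  exact ⟨ψ₁, h1, h2, h3, fun u v => sublevelIntegral_sub_eq (hV.aemeasurable hG.measurableSet)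
    (hψ.continuous.integrable_of_hasCompactSupport hc).restrict
    (h1.continuous.integrable_of_hasCompactSupport h2).restrict h4 u v⟩

theorem sublevelIntegral_sub_const_mul (hG : IsOpen G) (hV : ContinuousOn V G) {ψ φ : E → ℝ}
    (hψ : Continuous ψ) (hψc : HasCompactSupport ψ) (hφ : Continuous φ)
    (hφc : HasCompactSupport φ) (c v : ℝ) :
    sublevelIntegral (volume.restrict G) V ψ v =
      sublevelIntegral (volume.restrict G) V (fun x => ψ x + -c * φ x) v +
        c * sublevelIntegral (volume.restrict G) V φ v := by
  rw [sublevelIntegral_add_const_mul (hV.aemeasurable hG.measurableSet)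
    (hψ.integrable_of_hasCompactSupport hψc).restrict
    (hφ.integrable_of_hasCompactSupport hφc).restrict]
  ring

/-- Weights supported where weights vanishing at `q` are reducible have sublevel integrals with
the same expansion as a single one not vanishing at `q`. -/
theorem IsReducible.polyBigO (hG : IsOpen G) (hV : ContinuousOn V G) (hO : IsReducible M V G q O)
    {ψ₀ : E → ℝ} (h₀ : ContDiff ℝ (M + 1 + 1 : ℕ) ψ₀) (h₀c : HasCompactSupport ψ₀)
    (h₀s : tsupport ψ₀ ⊆ O) (h₀q : ψ₀ q ≠ 0) {s : ℝ} (hs : 0 ≤ s)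
    (hF : PolyBigO s (sublevelIntegral (volume.restrict G) V ψ₀))
    (hF' : ∀ᶠ v in 𝓝[≠] (0 : ℝ), ContinuousAt (sublevelIntegral (volume.restrict G) V ψ₀) v)
    (j : ℕ) (hj : 2 * j ≤ M) {ψ : E → ℝ} (hψ : ContDiff ℝ (2 * j + 1 + 1 : ℕ) ψ)
    (hψc : HasCompactSupport ψ) (hψs : tsupport ψ ⊆ O) :
    PolyBigO (min j s) (sublevelIntegral (volume.restrict G) V ψ) ∧
      ∀ᶠ v in 𝓝[≠] (0 : ℝ), ContinuousAt (sublevelIntegral (volume.restrict G) V ψ) v := by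
  have hVm : AEMeasurable V (volume.restrict G) := hV.aemeasurable hG.measurableSet
  induction j generalizing ψ with
  | zero =>
    obtain ⟨ψ₁, h1, h2, -, h4⟩ := hO.exists_sub_eq hG hV hj
      -- The coefficient makes the weight vanish at q. One integration by parts already gives a
      -- continuous sublevel integral, that is, order 0.
      (ψ := fun x => ψ x + -(ψ q / ψ₀ q) * ψ₀ x)
      (hψ.add (contDiff_const.mul (h₀.of_le (by exact_mod_cast by omega))))
      (hψc.add h₀c.mul_left) ((tsupport_add _ _).trans
        (Set.union_subset hψs (tsupport_mul_subset_right.trans h₀s))) (by field_simp; ring)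
    have hcont := continuous_sublevelIntegral_of_sub_eq hVm
      (h1.continuous.integrable_of_hasCompactSupport h2).restrict h4
    rw [funext (sublevelIntegral_sub_const_mul hG hV hψ.continuous hψc h₀.continuous h₀c
      (ψ q / ψ₀ q))]
    refine ⟨((PolyBigO.of_continuousAt hcont.continuousAt).mono (by simp)).add
      ((hF.mono (min_le_right _ _)).const_mul _), ?_⟩
    filter_upwards [hF'] with v hv
    exact hcont.continuousAt.add (continuousAt_const.mul hv)
  | succ j ih =>
    obtain ⟨ψ₁, h1, h2, h3, h4⟩ := hO.exists_sub_eq hG hV hj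
      (ψ := fun x => ψ x + -(ψ q / ψ₀ q) * ψ₀ x)
      (hψ.add (contDiff_const.mul (h₀.of_le (by exact_mod_cast by omega))))
      (hψc.add h₀c.mul_left) ((tsupport_add _ _).trans
        (Set.union_subset hψs (tsupport_mul_subset_right.trans h₀s))) (by field_simp; ring)
    have hi := (h1.continuous.integrable_of_hasCompactSupport (μ := volume) h2).restrict (s := G)
    have hcont := continuous_sublevelIntegral_of_sub_eq hVm hi h4
    obtain ⟨i1, i2⟩ := ih (by omega) h1 h2 h3
    rw [funext (sublevelIntegral_sub_const_mul hG hV hψ.continuous hψc h₀.continuous h₀c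
      (ψ q / ψ₀ q))]
    constructor
    -- Integration lifts min(j, s) to min(j, s) + 1, which is at least min(j + 1, s); the multiple
    -- of ψ₀ caps the order at s.
    · refine PolyBigO.add ((PolyBigO.integrate ?_ i1 hcont.continuousAt ?_).mono ?_)
        ((hF.mono (min_le_right _ _)).const_mul _)
      · have : (0 : ℝ) ≤ min (j : ℝ) s := le_min j.cast_nonneg hs
        linarith
      · filter_upwards [i2] with v hv
        exact hasDerivAt_sublevelIntegral_of_sub_eq hVm hi h4 hv
      · push_cast
        rw [← min_add_add_right]
        exact min_le_min le_rfl (by linarith)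
    · filter_upwards [hF'] with v hv
      exact hcont.continuousAt.add (continuousAt_const.mul hv)

/-- The density needs a derivative, which would cost an order if taken of the expansion. Instead,
the derivative of the difference is itself a sublevel integral, and its expansion has the full order
s. -/
theorem IsReducible.exists_hasDerivAt (hG : IsOpen G) (hV : ContinuousOn V G)
    (hO : IsReducible M V G q O)
    {ψ₀ : E → ℝ} (h₀ : ContDiff ℝ (M + 1 + 1 : ℕ) ψ₀) (h₀c : HasCompactSupport ψ₀)
    (h₀s : tsupport ψ₀ ⊆ O) (h₀q : ψ₀ q ≠ 0) {s : ℝ} (hs : 0 ≤ s)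
    (hF : PolyBigO s (sublevelIntegral (volume.restrict G) V ψ₀))
    (hF' : ∀ᶠ v in 𝓝[≠] (0 : ℝ), ContinuousAt (sublevelIntegral (volume.restrict G) V ψ₀) v)
    (hM : 2 * s + 4 ≤ M) {χ : E → ℝ} (hχ : ContDiff ℝ ∞ χ)
    (hχc : HasCompactSupport χ) (hχs : tsupport χ ⊆ O) :
    ∃ f, PolyBigO s f ∧ ∀ᶠ v in 𝓝[≠] (0 : ℝ),
      HasDerivAt (fun v => sublevelIntegral (volume.restrict G) V χ v -
        χ q / ψ₀ q * sublevelIntegral (volume.restrict G) V ψ₀ v) (f v) v := by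
  have hVm : AEMeasurable V (volume.restrict G) := hV.aemeasurable hG.measurableSet
  -- j = ⌈s⌉ rounds reach order s. They use two derivatives each, and two more go into the first
  -- reduction.
  obtain ⟨j, hj1, hj2⟩ : ∃ j : ℕ, s ≤ j ∧ 2 * j + 2 ≤ M := by
    refine ⟨⌈s⌉₊, Nat.le_ceil s, ?_⟩
    have := Nat.ceil_lt_add_one hs
    have h : ((2 * ⌈s⌉₊ + 2 : ℕ) : ℝ) ≤ M := by push_cast; linarith
    exact_mod_cast h
  obtain ⟨ψ₁, h1, h2, h3, h4⟩ := hO.exists_sub_eq hG hV hj2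
    (ψ := fun x => χ x + -(χ q / ψ₀ q) * ψ₀ x)
    ((contDiff_infty.1 hχ _).add
      (contDiff_const.mul (h₀.of_le (by exact_mod_cast by omega))))
    (hχc.add h₀c.mul_left) ((tsupport_add _ _).trans
      (Set.union_subset hχs (tsupport_mul_subset_right.trans h₀s))) (by field_simp; ring)
  have hi := (h1.continuous.integrable_of_hasCompactSupport (μ := volume) h2).restrict (s := G)
  obtain ⟨i1, i2⟩ := hO.polyBigO hG hV h₀ h₀c h₀s h₀q hs hF hF' j (by omega) h1 h2 h3
  rw [min_eq_right hj1] at i1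
  refine ⟨_, i1, ?_⟩
  filter_upwards [i2] with v hv
  have := hasDerivAt_sublevelIntegral_of_sub_eq hVm hi h4 hv
  refine this.congr_of_eventuallyEq (Eventually.of_forall fun t => ?_)
  simp only
  rw [sublevelIntegral_sub_const_mul hG hV hχ.continuous hχc h₀.continuous h₀c (χ q / ψ₀ q)]
  ring

end Expansion

/-! ### From sublevel integrals to the density of states -/

/-- The derivative of the model singularity is the universal function, up to a polynomial. -/
theorem exists_hasDerivAt_modelSing {N p k : ℕ} (hN : 0 < N) (hp : p + k = N) :
    ∃ P : Polynomial ℝ, ∀ v : ℝ, v ≠ 0 →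
      HasDerivAt (fun t => (2 * Real.pi) ^ (((p : ℝ) + k) / 2) * modelSing p k t)
        (hUniv N k v + P.eval v) (N * v) := by
  have hN0 : (0 : ℝ) < N := by exact_mod_cast hN
  have hpk : ((p : ℝ) + k) / 2 = ((N : ℝ) - 2) / 2 + 1 := by rw [← hp]; push_cast; ring
  set a : ℝ := ((N : ℝ) - 2) / 2 with ha
  have ha2 : (N : ℝ) / 2 = a + 1 := by rw [ha]; ring
  have ha1 : a + 1 ≠ 0 := by rw [← ha2]; positivity
  have hc : (2 * Real.pi * N) ^ (a + 1) / (N * Real.Gamma (a + 1)) =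
      (2 * Real.pi) ^ (a + 1) * ((N : ℝ) ^ a / Real.Gamma (a + 1)) := by
    rw [Real.mul_rpow (by positivity) hN0.le, Real.rpow_add_one hN0.ne']
    field_simp
  have hheav : ∀ v : ℝ, heaviside (N * v) = heaviside v := by
    intro v
    unfold heaviside
    simp only [mul_pos_iff_of_pos_left hN0]
  have hsp : ∀ v : ℝ, singPow a (N * v) =
      N ^ a / Real.Gamma (a + 1) * (v ^ a * heaviside v) := by
    intro v
    rw [singPow, hheav]
    rcases le_or_gt v 0 with h | h
    · rw [heaviside_of_nonpos h]; ring
    · rw [Real.mul_rpow hN0.le h.le]; ring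
  unfold hUniv
  simp only [ha2, ← ha, hpk]
  rw [hc]
  by_cases hk : Even k
  · refine ⟨0, fun v hv => ?_⟩
    have hv' : (N : ℝ) * v ≠ 0 := mul_ne_zero hN0.ne' hv
    have e : modelSing p k = fun t => (-1) ^ (k / 2) * singPow (a + 1) t := by
      funext t; rw [modelSing, if_pos hk, hpk]
    rw [e, if_pos hk]
    refine (((hasDerivAt_singPow ha1 hv').const_mul _).const_mul _).congr_deriv ?_
    rw [hsp, Polynomial.eval_zero]; ring
  by_cases hpe : Even p
  · refine ⟨0, fun v hv => ?_⟩
    have hv' : (N : ℝ) * v ≠ 0 := mul_ne_zero hN0.ne' hv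
    have e : modelSing p k = fun t => (-1) ^ (p / 2 + 1) * singPow (a + 1) (-t) := by
      funext t; rw [modelSing, if_neg hk, if_pos hpe, hpk]
    have hodd : Odd N := by
      rw [← hp]; exact hpe.add_odd (Nat.not_even_iff_odd.1 hk)
    rw [e, if_neg hk, if_pos hodd, show N - k = p by omega]
    have h1 : HasDerivAt (fun t => singPow (a + 1) (-t)) _ (N * v) :=
      (hasDerivAt_singPow ha1 (neg_ne_zero.2 hv')).comp _ (hasDerivAt_neg _)
    refine ((h1.const_mul _).const_mul _).congr_deriv ?_
    rw [← mul_neg, hsp, Polynomial.eval_zero]; ring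
  · have heven : Even N := by
      rw [← hp]; exact (Nat.not_even_iff_odd.1 hpe).add_odd (Nat.not_even_iff_odd.1 hk)
    obtain ⟨n, hn⟩ := heven
    have han : a = (n - 1 : ℕ) := by
      rw [ha, hn, Nat.cast_sub (by omega)]; push_cast; ring
    -- With N even the exponent is the integer n - 1. The monomial gathers log N, from log |N v| =
    -- log N + log |v|, and the pure power left by differentiating the logarithm.
    refine ⟨Polynomial.C ((2 * Real.pi) ^ (a + 1) * ((-1) ^ ((k + 1) / 2) *
      (N ^ a * (Real.pi⁻¹ * Real.log N / Real.Gamma (a + 1) +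
        Real.pi⁻¹ / Real.Gamma (a + 1 + 1))))) * Polynomial.X ^ (n - 1), fun v hv => ?_⟩
    have hv' : (N : ℝ) * v ≠ 0 := mul_ne_zero hN0.ne' hv
    have e : modelSing p k = fun t => (-1) ^ ((k + 1) / 2) * singLog (a + 1) t := by
      funext t; rw [modelSing, if_neg hk, if_neg hpe, hpk]
    rw [e, if_neg hk, if_neg (by rw [Nat.not_odd_iff_even]; exact ⟨n, hn⟩)]
    refine (((hasDerivAt_singLog ha1 hv').const_mul _).const_mul _).congr_deriv ?_
    have hpow : ((N : ℝ) * v) ^ a = N ^ a * v ^ a := by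
      rw [han, Real.rpow_natCast, Real.rpow_natCast, Real.rpow_natCast, mul_pow]
    have hlog : Real.log |(N : ℝ) * v| = Real.log N + Real.log |v| := by
      rw [abs_mul, abs_of_pos hN0, Real.log_mul hN0.ne' (abs_pos.2 hv).ne']
    have hva : v ^ (n - 1) = v ^ a := by rw [han, Real.rpow_natCast]
    rw [singLog, hpow, hlog]
    simp only [Polynomial.eval_mul, Polynomial.eval_C, Polynomial.eval_pow, Polynomial.eval_X, hva]
    ring

theorem eventually_punctured_eventually {p : ℝ → Prop} (h : ∀ᶠ v in 𝓝[≠] (0 : ℝ), p v) :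
    ∀ᶠ v in 𝓝[≠] (0 : ℝ), ∀ᶠ w in 𝓝 v, p w := by
  filter_upwards [eventually_eventually_nhdsWithin.2 h, self_mem_nhdsWithin] with v hv hv0
  rwa [isOpen_compl_singleton.nhdsWithin_eq hv0] at hv

section Density

variable {N : ℕ}

local notation "E" => EuclideanSpace ℝ (Fin N)

/-- The density of states is the derivative of the sublevel integral of a cutoff. -/
theorem isDensityOfStatesAt_of_hasDerivAt {V : E → ℝ} {G : Set E} (hG : IsOpen G)
    (hV : ContinuousOn V G) {χ : E → ℝ} (hχ : Continuous χ) (hχc : HasCompactSupport χ) {ε : ℝ}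
    (hχ1 : ∀ x ∈ G, |V x| < ε → χ x = 1) {v D : ℝ} (hv : |N * v| < ε)
    (hc : ∀ᶠ t in 𝓝 ((N : ℝ) * v), ContinuousAt (sublevelIntegral (volume.restrict G) V χ) t)
    (hd : HasDerivAt (sublevelIntegral (volume.restrict G) V χ) D (N * v)) :
    0 ≤ D ∧ IsDensityOfStatesAt V G v D.toNNReal := by
  set F := sublevelIntegral (volume.restrict G) V χ with hF
  set t : ℝ := N * v
  have hVm : AEMeasurable V (volume.restrict G) := hV.aemeasurable hG.measurableSet
  have hi : Integrable χ (volume.restrict G) := (hχ.integrable_of_hasCompactSupport hχc).restrict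
  have hneg : Tendsto (fun η : ℝ => t - η) (𝓝[>] 0) (𝓝 t) := by
    have : Tendsto (fun η : ℝ => t - η) (𝓝 0) (𝓝 (t - 0)) :=
      (continuous_const.sub continuous_id).tendsto 0
    rw [sub_zero] at this
    exact this.mono_left nhdsWithin_le_nhds
  have hsmall : ∀ᶠ η in 𝓝[>] (0 : ℝ), η < ε - |t| :=
    nhdsWithin_le_nhds (eventually_lt_nhds (by linarith))
  -- F(t + η) - F(t - η) counts t - η ≤ V < t + η, where χ = 1 on the interior of that range.
  -- Continuity of F at t - η removes the lower endpoint and gives the open window exactly.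
  have hvol : ∀ᶠ η in 𝓝[>] (0 : ℝ),
      volume {q ∈ G | |V q - t| < η} = ENNReal.ofReal (F (t + η) - F (t - η)) ∧
        0 ≤ F (t + η) - F (t - η) := by
    filter_upwards [hsmall, hneg.eventually hc, self_mem_nhdsWithin] with η hη hcη hη0
    have hη0' : 0 < η := hη0
    set S := {q ∈ G | |V q - t| < η}
    have hSo : IsOpen S := by
      have : ContinuousOn (fun q => |V q - t|) G := (hV.sub continuousOn_const).abs
      exact this.isOpen_inter_preimage hG isOpen_Iio
    have hS1 : ∀ x ∈ S, χ x = 1 := fun x hx => hχ1 x hx.1 (by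
      have h1 := hx.2
      have h2 := abs_sub_abs_le_abs_sub (V x) t
      linarith)
    have hfin : volume S ≠ ⊤ := by
      refine ((measure_mono ?_).trans_lt hχc.isCompact.measure_lt_top).ne
      intro x hx
      exact subset_tsupport χ (by rw [Function.mem_support, hS1 x hx]; exact one_ne_zero)
    have e1 : F (t + η) - F (t - η) = volume.real S := by
      rw [hF, ← integral_heaviside_closed_eq hVm hi hcη, sublevelIntegral, ← integral_sub
        (integrable_heaviside_mul hVm hi _)]
      · have : ∀ x ∈ G, heaviside (t + η - V x) * χ x - (1 - heaviside (V x - (t - η))) * χ x =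
            S.indicator (fun _ => (1 : ℝ)) x := by
          intro x hx
          by_cases hxS : x ∈ S
          · have := abs_lt.1 hxS.2
            rw [Set.indicator_of_mem hxS, hS1 x hxS, heaviside_of_pos (by linarith),
              heaviside_of_pos (by linarith)]
            ring
          · rw [Set.indicator_of_notMem hxS]
            have h1 : η ≤ |V x - t| := not_lt.1 fun h => hxS ⟨hx, h⟩
            rcases le_abs.1 h1 with h2 | h2
            · rw [heaviside_of_nonpos (by linarith), heaviside_of_pos (by linarith)]; ring
            · rw [heaviside_of_pos (by linarith), heaviside_of_nonpos (by linarith)]; ring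
        rw [setIntegral_congr_fun hG.measurableSet this, setIntegral_indicator hSo.measurableSet,
          Set.inter_eq_right.2 (fun x hx => hx.1), setIntegral_const]
        simp
      · have h1 : (fun x => (1 - heaviside (V x - (t - η))) * χ x) =
            fun x => χ x - heaviside (V x - (t - η)) * χ x := by funext x; ring
        rw [h1]
        refine hi.sub (hi.bdd_mul (c := 1) ?_ (ae_of_all _ fun x => abs_heaviside_le _))
        exact (measurable_heaviside.comp_aemeasurable (hVm.sub_const _)).aestronglyMeasurable
    rw [e1]
    exact ⟨(ENNReal.ofReal_toReal hfin).symm, measureReal_nonneg⟩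
  have hlim : Tendsto (fun η : ℝ => (F (t + η) - F (t - η)) / (2 * η)) (𝓝[>] 0) (𝓝 D) := by
    have h1 : HasDerivAt (fun η : ℝ => F (t + η) - F (t - η)) (2 * D) 0 := by
      have a1 : HasDerivAt (fun η : ℝ => F (t + η)) D 0 := by
        have : HasDerivAt F D (t + 0) := by rwa [add_zero]
        exact (this.comp (0 : ℝ) ((hasDerivAt_id 0).const_add t)).congr_deriv (by simp)
      have a2 : HasDerivAt (fun η : ℝ => F (t - η)) (-D) 0 := by
        have : HasDerivAt F D (t - 0) := by rwa [sub_zero]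
        exact (this.comp (0 : ℝ) ((hasDerivAt_id 0).const_sub t)).congr_deriv (by simp)
      exact (a1.sub a2).congr_deriv (by ring)
    have h2 := h1.tendsto_slope_zero_right
    have h3 := h2.const_mul (1 / 2)
    rw [show 1 / 2 * (2 * D) = D by ring] at h3
    refine h3.congr fun η => ?_
    simp only [zero_add, add_zero, sub_zero, sub_self, smul_eq_mul]
    rw [div_eq_mul_inv _ (2 * η), mul_inv]; ring
  have hD : 0 ≤ D := by
    refine ge_of_tendsto hlim ?_
    filter_upwards [hvol, self_mem_nhdsWithin] with η hη hη0
    have hη0' : 0 < η := hη0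
    exact div_nonneg hη.2 (by linarith)
  refine ⟨hD, ?_⟩
  have h4 : Tendsto (fun η : ℝ => ENNReal.ofReal ((F (t + η) - F (t - η)) / (2 * η))) (𝓝[>] 0)
      (𝓝 (ENNReal.ofReal D)) := (ENNReal.continuous_ofReal.tendsto D).comp hlim
  refine h4.congr' ?_
  filter_upwards [hvol, self_mem_nhdsWithin] with η hη hη0
  have hη0' : 0 < η := hη0
  rw [hη.1, ENNReal.ofReal_div_of_pos (by linarith)]

end Density

/-! ### The expansion on a domain with regular boundary -/

section CriticalExpansion

variable {N : ℕ}

local notation "E" => EuclideanSpace ℝ (Fin N)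

/-- The expansion of the density of states at the level of a single nondegenerate critical point,
on a domain with boundary transverse to that level. -/
theorem hasCriticalExpansion_of_isRegularAtZeroLevel (hN : 0 < N) {G : Set E} (hG : IsOpen G)
    {V : E → ℝ} (hV : ContDiffOn ℝ ∞ V G) {q : E} (hq : q ∈ G)
    (hcrit : ∀ x ∈ G, fderiv ℝ V x = 0 ↔ x = q) (hzero : V q = 0)
    (hdet : (hessian V q).det ≠ 0) (hreg : IsRegularAtZeroLevel V G) :
    HasCriticalExpansion V G q := by
  obtain ⟨⟨δ, hδ, hbdd⟩, hreg⟩ := hreg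
  have hVc : ContinuousOn V G := hV.continuousOn
  have hN0 : (0 : ℝ) < N := by exact_mod_cast hN
  obtain ⟨K, hK, hK0, hKc, hKO⟩ := exists_isCompact_cluster hδ hbdd
  -- N + 4 is 2s + 4 for the order s = N/2.
  obtain ⟨O, hO, hOr⟩ := exists_isReducible_cover (N + 4) hG hV hq hcrit hdet hreg hK hKc
  have hqO : q ∈ O := hO (hK0 q hq hzero)
  set k := morseIndex V q
  obtain ⟨p, hp⟩ : ∃ p, p + k = N := ⟨N - k, Nat.sub_add_cancel (morseIndex_le V q)⟩
  obtain ⟨σ, hσ, hσk, hmodel⟩ := hasModel p k N hp.symm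
  obtain ⟨Ψ, hΨ, hΨ0, hΨd, hΨV⟩ :=
    exists_diagonal_morse_chart hG hV hq hzero ((hcrit q hq).2 rfl) hdet hσ hσk
  have hd0 : 0 < √|(hessian V q).det| := Real.sqrt_pos.2 (abs_pos.2 hdet)
  set d := √|(hessian V q).det|
  obtain ⟨ψ₀, h₀, h₀c, h₀s, h₀q, S, hS, hFS⟩ := exists_pullback_weight (N + 4 + 1 + 1)
    (hG.mem_nhds hq) hG.measurableSet (hOr.1.mem_nhds hqO) hΨ hΨ0
    (by rw [← abs_pos, hΨd]; exact hd0) hmodel hΨV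
  rw [hΨd] at h₀q
  have hpk : ((p : ℝ) + k) / 2 = (N : ℝ) / 2 := by rw [← hp]; push_cast; ring
  have hFS' := eventually_punctured_eventually hFS
  have hF : PolyBigO ((N : ℝ) / 2) (sublevelIntegral (volume.restrict G) V ψ₀) := by
    refine (((polyBigO_modelSing p k).const_mul _).add (PolyBigO.of_contDiff hS _)).congr
      (hFS.mono fun v hv => hv.symm) |>.mono hpk.ge
  have hF' : ∀ᶠ v in 𝓝[≠] (0 : ℝ),
      ContinuousAt (sublevelIntegral (volume.restrict G) V ψ₀) v := by
    filter_upwards [hFS', self_mem_nhdsWithin] with v hv hv0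
    exact ((continuousAt_const.mul (continuousAt_modelSing p k hv0)).add
      hS.continuous.continuousAt).congr (EventuallyEq.symm hv)
  obtain ⟨χ, hχ, hχc, hχs, hχ1, -⟩ := exists_cutoff hK hOr.1 hO
  obtain ⟨f, hf, hfd⟩ := hOr.exists_hasDerivAt hG hVc h₀ h₀c h₀s (by rw [h₀q]; exact hd0.ne')
    (s := (N : ℝ) / 2) (by positivity) hF hF' (by push_cast; linarith) hχ hχc hχs
  have hχq : χ q = 1 := (eventually_nhdsSet_iff_forall.1 hχ1 q (hK0 q hq hzero)).self_of_nhds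
  rw [hχq, h₀q] at hfd
  obtain ⟨A, hKA, hA, hAχ⟩ := mem_nhdsSet_iff_exists.1 hχ1
  obtain ⟨ε, hε, hεχ⟩ := hKO A hKA hA
  obtain ⟨P, hP⟩ := exists_hasDerivAt_modelSing hN hp
  -- The derivative of F_χ at N v: f from the reduced weight, and the derivative of F_{ψ₀} divided
  -- by ψ₀(q) = d.
  let D : ℝ → ℝ := fun v => f (N * v) + 1 / d * (hUniv N k v + P.eval v + deriv S (N * v))
  have hmul : Tendsto (fun v : ℝ => (N : ℝ) * v) (𝓝[≠] 0) (𝓝[≠] 0) := by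
    refine tendsto_nhdsWithin_of_tendsto_nhds_of_eventually_within _ ?_ ?_
    · have : Tendsto (fun v : ℝ => (N : ℝ) * v) (𝓝 0) (𝓝 (N * 0)) :=
        (continuous_const.mul continuous_id).tendsto 0
      rw [mul_zero] at this
      exact this.mono_left nhdsWithin_le_nhds
    · filter_upwards [self_mem_nhdsWithin] with v hv
      exact mul_ne_zero hN0.ne' hv
  set F := sublevelIntegral (volume.restrict G) V χ
  set F₀ := sublevelIntegral (volume.restrict G) V ψ₀
  have hFc : ∀ᶠ t in 𝓝[≠] (0 : ℝ), ContinuousAt F t := by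
    filter_upwards [hfd, hF'] with t ht ht'
    refine (ht.continuousAt.add (continuousAt_const (y := 1 / d) |>.mul ht')).congr
      (Eventually.of_forall fun x => ?_)
    exact sub_add_cancel (F x) (1 / d * F₀ x)
  have hFd : ∀ᶠ v in 𝓝[≠] (0 : ℝ), HasDerivAt F (D v) (N * v) := by
    filter_upwards [hmul.eventually hfd, hmul.eventually hFS', self_mem_nhdsWithin]
      with v h1 h2 hv
    have h3 : HasDerivAt S (deriv S (N * v)) (N * v) :=
      (hS.differentiable (by simp) _).hasDerivAt
    have h4 : HasDerivAt F₀ (hUniv N k v + P.eval v + deriv S (N * v)) (N * v) :=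
      ((hP v hv).add h3).congr_of_eventuallyEq h2
    refine (h1.add (h4.const_mul (1 / d))).congr_of_eventuallyEq (Eventually.of_forall fun x => ?_)
    simp only [Pi.add_apply]
    ring
  have hdens : ∀ᶠ v in 𝓝[≠] (0 : ℝ), 0 ≤ D v ∧ IsDensityOfStatesAt V G v (D v).toNNReal := by
    have hlt : ∀ᶠ v in 𝓝[≠] (0 : ℝ), |(N : ℝ) * v| < ε := by
      have := (hmul.mono_right nhdsWithin_le_nhds).abs
      rw [abs_zero] at this
      exact this.eventually_lt_const hε
    filter_upwards [hFd, hlt, hmul.eventually (eventually_punctured_eventually hFc)]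
      with v h1 h2 h3
    exact isDensityOfStatesAt_of_hasDerivAt hG hVc hχ.continuous hχc
      (fun x hx hxε => hAχ (hεχ ⟨hx, hxε⟩)) h2 h3 h1
  have hpoly : PolyBigO ((N : ℝ) / 2) fun v => D v - hUniv N k v / d := by
    have hS' : ContDiff ℝ ∞ (deriv S) := (contDiff_infty_iff_deriv.1 hS).2
    have h1 := (hf.comp_mul hN0.ne').add (((PolyBigO.polynomial ((N : ℝ) / 2) P).add
      ((PolyBigO.of_contDiff hS' _).comp_mul hN0.ne')).const_mul (1 / d))
    refine h1.congr (Eventually.of_forall fun v => ?_)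
    simp only [D]
    ring
  -- (N + 1)/2 is N/2 rounded up, so a degree below it is below N/2.
  have hn : (N : ℝ) / 2 ≤ ((N + 1) / 2 : ℕ) := by
    have : N ≤ 2 * ((N + 1) / 2) := by omega
    have : (N : ℝ) ≤ 2 * ((N + 1) / 2 : ℕ) := by exact_mod_cast this
    linarith
  obtain ⟨R, hR, hRO⟩ := hpoly.exists_natDegree_lt (by omega) hn
  refine ⟨fun v => (D v).toNNReal, hdens.mono fun v hv => hv.2, R, ?_, fun ε hε => ?_⟩
  · have : 2 * R.natDegree < N := by omega
    have : (2 : ℝ) * R.natDegree < N := by exact_mod_cast this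
    linarith
  · refine (hRO ε hε).congr' ?_ EventuallyEq.rfl
    filter_upwards [hdens] with v hv
    rw [Real.coe_toNNReal _ hv.1]
    ring

end CriticalExpansion

/-! ### Small balls have regular boundary -/

section SmallBalls

variable {N : ℕ}

local notation "E" => EuclideanSpace ℝ (Fin N)

/-- Near a nondegenerate critical point, the critical level is nowhere tangent to the spheres
around that point. -/
theorem eventually_fderiv_ne_smul_innerSL {V : E → ℝ} {G : Set E} (hG : IsOpen G)
    (hV : ContDiffOn ℝ ∞ V G) {q : E} (hq : q ∈ G) (h0 : V q = 0) (h1 : fderiv ℝ V q = 0)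
    (hdet : (hessian V q).det ≠ 0) :
    ∀ᶠ x in 𝓝 q, V x = 0 → x ≠ q → ∀ l : ℝ, fderiv ℝ V x ≠ l • innerSL ℝ (x - q) := by
  have hH := injective_fderiv_fderiv ((hV.contDiffAt (hG.mem_nhds hq)).of_le (by norm_cast)) hdet
  obtain ⟨g, hg, hgV⟩ := exists_contDiff_eventuallyEq hG hV hq
  have hd1 : fderiv ℝ g =ᶠ[𝓝 q] fderiv ℝ V := hgV.fderiv
  rw [← hd1.fderiv_eq] at hH
  obtain ⟨B, hB, -, hVB, hB0⟩ :=
    exists_hadamard_two hg (hgV.eq_of_nhds.trans h0) (hd1.eq_of_nhds.trans h1)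
  set H := fderiv ℝ (fderiv ℝ g) q
  obtain ⟨K, hK, hKH⟩ := (H : E →ₗ[ℝ] E →L[ℝ] ℝ).exists_antilipschitzWith
    (LinearMap.ker_eq_bot.2 hH)
  have hK0 : (0 : ℝ) < K := hK
  have hanti : ∀ y, ‖y‖ ≤ K * ‖H y‖ := fun y => by
    simpa using hKH.le_mul_norm_sub 0 y
  -- Put y = x - q. V(x) = 0 gives |H(y, y)| ≤ ε‖y‖²; with dV(x) = l⟨y, ·⟩ close to H y this forces
  -- |l| ≤ 2ε, hence ‖H y‖ ≤ 3ε‖y‖. Nondegeneracy then yields ‖y‖ ≤ 3Kε‖y‖ = (3/4)‖y‖, a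
  -- contradiction.
  set ε : ℝ := 1 / (4 * K) with hε
  have hε0 : 0 < ε := by positivity
  have hg' : ContDiff ℝ ∞ (fderiv ℝ g) := hg.fderiv_right (by simp)
  have hdiff : ∀ᶠ x in 𝓝 q, ‖fderiv ℝ g x - H (x - q)‖ ≤ ε * ‖x - q‖ := by
    have h2 := ((hg'.differentiable (by simp) q).hasFDerivAt.isLittleO).def hε0
    filter_upwards [h2] with x hx
    rwa [hd1.eq_of_nhds.trans h1, sub_zero] at hx
  have hBε : ∀ᶠ x in 𝓝 q, ‖B x - H‖ < ε := by
    filter_upwards [Metric.tendsto_nhds.1 hB.continuous.continuousAt ε hε0] with x hx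
    rwa [dist_eq_norm, hB0] at hx
  filter_upwards [hgV, hd1, hdiff, hBε] with x e0 e1 e2 e3 hx0 hxq l hl
  set y := x - q
  have hy0 : 0 < ‖y‖ := norm_pos_iff.2 (sub_ne_zero.2 hxq)
  have b1 : B x y y = 0 := by
    have := hVB x
    rw [e0, hx0] at this
    linarith
  have b2 : |H y y| ≤ ε * ‖y‖ * ‖y‖ := by
    have h2 : (B x - H) y y = -H y y := by
      rw [sub_apply, sub_apply, b1, zero_sub]
    have h3 := (B x - H).le_opNorm₂ y y
    rw [h2, norm_neg, Real.norm_eq_abs] at h3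
    refine h3.trans ?_
    gcongr
  rw [e1, hl] at e2
  have b3 : |l * ‖y‖ ^ 2 - H y y| ≤ ε * ‖y‖ * ‖y‖ := by
    have h3 := (l • innerSL ℝ y - H y).le_of_opNorm_le e2 y
    rwa [sub_apply, smul_apply, innerSL_apply_apply, real_inner_self_eq_norm_sq, smul_eq_mul,
      Real.norm_eq_abs] at h3
  have b4 : |l| * ‖y‖ ≤ 2 * ε * ‖y‖ := by
    have h3 : |l * ‖y‖ ^ 2| ≤ 2 * ε * ‖y‖ * ‖y‖ := by
      have := abs_add_le (l * ‖y‖ ^ 2 - H y y) (H y y)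
      rw [sub_add_cancel] at this
      linarith
    rw [abs_mul, abs_of_nonneg (by positivity : 0 ≤ ‖y‖ ^ 2)] at h3
    refine le_of_mul_le_mul_right ?_ hy0
    linarith
  have b5 : ‖H y‖ ≤ 3 * ε * ‖y‖ := by
    have h3 : ‖l • innerSL ℝ y‖ = |l| * ‖y‖ := by
      rw [norm_smul, innerSL_apply_norm, Real.norm_eq_abs]
    have h4 := norm_sub_norm_le (H y) (l • innerSL ℝ y)
    rw [norm_sub_rev] at e2
    linarith
  have b6 := hanti y
  have b7 : (K : ℝ) * (3 * ε * ‖y‖) = 3 / 4 * ‖y‖ := by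
    rw [hε]; field_simp
  have b8 := mul_le_mul_of_nonneg_left b5 hK0.le
  linarith

/-- The squared distance defines the ball, and its differential is twice the radial covector,
nonzero at b; dependence would make dV(b) radial. -/
theorem isTransverseAt_ball {V : E → ℝ} {q b : E} {r : ℝ} (hr : 0 < r) (hb : dist b q = r)
    (hV : ContDiffAt ℝ ∞ V b) (hl : ∀ l : ℝ, fderiv ℝ V b ≠ l • innerSL ℝ (b - q)) :
    IsTransverseAt V (Metric.ball q r) b := by
  have hρ : ContDiff ℝ ∞ fun x : E => ‖x - q‖ ^ 2 - r ^ 2 :=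
    ((contDiff_id.sub contDiff_const).norm_sq ℝ).sub contDiff_const
  refine ⟨V, fun x => ‖x - q‖ ^ 2 - r ^ 2, hV, hρ.contDiffAt, Eventually.of_forall fun _ => rfl,
    Eventually.of_forall fun x => ?_, ?_⟩
  · rw [Metric.mem_ball, dist_eq_norm, sub_neg, sq_lt_sq₀ (norm_nonneg _) hr.le]
  · have hd : HasFDerivAt (fun x : E => ‖x - q‖ ^ 2 - r ^ 2) ((2 : ℝ) • innerSL ℝ (b - q)) b := by
      refine ((((hasFDerivAt_id b).sub_const q).norm_sq).sub_const _).congr_fderiv ?_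
      ext z
      simp
    rw [hd.fderiv, LinearIndependent.pair_iff]
    intro s t hst
    have hne : b - q ≠ 0 := by
      rw [← norm_pos_iff, ← dist_eq_norm, hb]; exact hr
    by_cases hs : s = 0
    · refine ⟨hs, ?_⟩
      have := DFunLike.congr_fun hst (b - q)
      simp only [hs, zero_smul, zero_add, smul_apply, innerSL_apply_apply,
        real_inner_self_eq_norm_sq, smul_eq_mul, zero_apply] at this
      have h2 : ‖b - q‖ ≠ 0 := norm_ne_zero_iff.2 hne
      simpa [h2] using this
    · exfalso
      refine hl (-(s⁻¹ * (t * 2))) ?_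
      ext z
      have := DFunLike.congr_fun hst z
      simp only [add_apply, smul_apply, smul_eq_mul, zero_apply] at this ⊢
      field_simp
      linarith

theorem eventually_isRegularAtZeroLevel_ball {V : E → ℝ} {G : Set E} (hG : IsOpen G)
    (hV : ContDiffOn ℝ ∞ V G) {q : E} (hq : q ∈ G) (h0 : V q = 0) (h1 : fderiv ℝ V q = 0)
    (hdet : (hessian V q).det ≠ 0) :
    ∀ᶠ r in 𝓝[>] (0 : ℝ), Metric.ball q r ⊆ G ∧ IsRegularAtZeroLevel V (Metric.ball q r) := by
  obtain ⟨R, hR, hRG⟩ := Metric.eventually_nhds_iff.1 ((hG.eventually_mem hq).and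
    (eventually_fderiv_ne_smul_innerSL hG hV hq h0 h1 hdet))
  filter_upwards [self_mem_nhdsWithin, nhdsWithin_le_nhds (eventually_lt_nhds hR)] with r hr hrR
  refine ⟨fun x hx => (hRG (lt_trans hx hrR)).1,
    ⟨1, one_pos, Metric.isBounded_ball.subset fun x hx => hx.1⟩, fun b hb hcl => ?_⟩
  have hbr : dist b q = r := by
    have : b ∈ Metric.sphere q r := Metric.frontier_ball_subset_sphere hb
    exact this
  obtain ⟨hbG, hbl⟩ := hRG (hbr.trans_lt hrR)
  have hVb : ContDiffAt ℝ ∞ V b := hV.contDiffAt (hG.mem_nhds hbG)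
  -- V is continuous at b, which lies inside G, so a cluster value 0 must be the value itself.
  have hb0 : V b = 0 := by
    have h2 : Tendsto V (𝓝[Metric.ball q r] b) (𝓝 (V b)) :=
      hVb.continuousAt.tendsto.mono_left nhdsWithin_le_nhds
    have : ClusterPt 0 (𝓝 (V b)) := hcl.clusterPt.mono h2
    exact (eq_of_nhds_neBot this).symm
  refine isTransverseAt_ball hr hbr hVb (hbl hb0 fun h => ?_)
  rw [h, dist_self] at hbr
  exact hr.ne hbr

end SmallBalls

end

theorem proposition1 (N : ℕ) (hN : 0 < N) (G : Set (EuclideanSpace ℝ (Fin N))) (hG : IsOpen G)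
    (V : EuclideanSpace ℝ (Fin N) → ℝ) (hV : IsMorseOn V G)
    (qc : EuclideanSpace ℝ (Fin N)) (hqc : qc ∈ G)
    (hcrit : ∀ q ∈ G, fderiv ℝ V q = 0 ↔ q = qc) (hzero : V qc = 0) :
    (IsRegularAtZeroLevel V G → HasCriticalExpansion V G qc) ∧
      ∀ᶠ r in 𝓝[>] (0 : ℝ), HasCriticalExpansion V (Metric.ball qc r) qc := by
  have hVs : ContDiffOn ℝ ∞ V G := fun x hx => (hV.1 x hx).contDiffAt.contDiffWithinAt
  have hqd := (hcrit qc hqc).2 rfl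
  have hdet := hV.2 qc hqc hqd
  refine ⟨hasCriticalExpansion_of_isRegularAtZeroLevel hN hG hVs hqc hcrit hzero hdet, ?_⟩
  filter_upwards [eventually_isRegularAtZeroLevel_ball hG hVs hqc hzero hqd hdet,
    self_mem_nhdsWithin] with r hr hr0
  exact hasCriticalExpansion_of_isRegularAtZeroLevel hN Metric.isOpen_ball (hVs.mono hr.1)
    (Metric.mem_ball_self hr0) (fun x hx => hcrit x (hr.1 hx)) hzero hdet hr.2
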